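/- \textbf{Conventions.} Let $G$ be a group with a finite generating set $S$. Let $\|g\|_S$ denote the word length of $g\in G$ with respect to $S\cup S^{-1}$; for a finite $X\subseteq G$ put $\|X\|_S=\max_{x\in X}\|x\|_S$ (and $\|\emptyset\|_S=0$), and for a finitely generated subgroup $H\le G$ let $\|H\|_S$ be the minimum of $\|X\|_S$ over all finite generating sets $X$ of $H$. For $H\le G$ and $g\in G\setminus H$ let $D_G(H,g)\in\mathbb N\cup\{\infty\}$ be the least order of a finite group $Q$ for which there is a homomorphism $\pi:G\to Q$ with $\pi(g)\notin\pi(H)$ ($\infty$ if there is none). Put $$F_{G,H,S}(n)=\max\{D_G(H,g): g\in G\setminus H,\ \|g\|_S\le n\},$$ $$\mathrm{Sub}_{G,S}(n)=\max\{D_G(H,g): H\le G \text{ finitely generated},\ g\in G\setminus H,\ \|H\|_S\le n,\ \|g\|_S\le n\},$$ with $\max\emptyset=0$. For functions $f,g:\mathbb N\to[0,\infty]$ write $f(n)\preceq g(n)$ if there is a $C\in\mathbb N$ with $f(n)\le C\,g(Cn)$ for all $n$ (at $n=0$ we read $\log n$ as $0$). For a nilpotent group $N$ of class $c$ with lower central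 series $\gamma_1(N)=N$, $\gamma_{i+1}(N)=[N,\gamma_i(N)]$, the Hirsch length is $h(N)=\sum_{i=1}^{c}\mathrm{rank}_{\mathbb Z}\,\gamma_i(N)/\gamma_{i+1}(N)$. \textbf{Statement.} Let $\Gamma$ be an infinite group with a finite generating set $S$, and let $N$ be a torsion-free, finitely generated nilpotent group that is isomorphic to a normal subgroup $M$ of finite index in $\Gamma$; write $[\Gamma:N]=[\Gamma:M]$. Then: (1) For every finitely generated subgroup $H\le\Gamma$ of infinite index, $$\log n\ \preceq\ F_{\Gamma,H,S}(n)\ \preceq\ (\log n)^{h(N)\,[\Gamma:N]^2}.$$ (2) $n\preceq \mathrm{Sub}_{\Gamma,S}(n)$. Moreover, for every finite generating set $T$ of $N$ there is a $k\in\mathbb N$ with $n\preceq\mathrm{Sub}_{N,T}(n)\preceq n^{k}$, and for every $k\in\mathbb N$ with $\mathrm{Sub}_{N,T}(n)\preceq n^{k}$ one has $$\mathrm{Sub}_{\Gamma,S}(n)\ \preceq\ n^{k\,[\Gamma:N]^2}.$$ -/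

import Mathlib

open scoped ENNReal

noncomputable section

namespace EffSep

/-! ### Word length and the norm of a subgroup -/

/-- `‖g‖_S`: the least length of a word in the letters `S ∪ S⁻¹` that represents `g`. -/
def wordLength {G : Type*} [Group G] (S : Finset G) (g : G) : ℕ :=
  sInf {n : ℕ | ∃ l : List G, (∀ x ∈ l, x ∈ S ∨ x⁻¹ ∈ S) ∧ l.prod = g ∧ l.length = n}

/-- `‖X‖_S = max {‖x‖_S | x ∈ X}` for a finite subset `X` (it is `0` for `X = ∅`). -/
def finsetNorm {G : Type*} [Group G] (S X : Finset G) : ℕ :=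
  X.sup (wordLength S)

/-- `‖H‖_S`: the least `‖X‖_S` over the finite generating subsets `X` of the subgroup `H`
(only meaningful for finitely generated `H`). -/
def subgroupNorm {G : Type*} [Group G] (S : Finset G) (H : Subgroup G) : ℕ :=
  sInf {n : ℕ | ∃ X : Finset G, Subgroup.closure (X : Set G) = H ∧ finsetNorm S X = n}

/-! ### The separability functions -/

/-- The relative depth `D_G(H, g)`: the least order of a finite group `Q` admitting a morphism
`π : G → Q` with `π(g) ∉ π(H)`, and `∞` if there is none. Finite groups in the lowest universe
represent all finite groups. -/
def depth {G : Type*} [Group G] (H : Subgroup G) (g : G) : ℕ∞ :=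
  sInf {m : ℕ∞ | ∃ (Q : Type) (_ : Group Q) (_ : Finite Q) (π : G →* Q),
    π g ∉ H.map π ∧ m = (Nat.card Q : ℕ∞)}

/-- `F_{G,H,S}(n)`: the maximum of `D_G(H, g)` over the `g ∈ G \ H` with `‖g‖_S ≤ n`
(it is `∞` if some such `g` cannot be separated from `H`, and `0` if there is no such `g`). -/
def farb {G : Type*} [Group G] (H : Subgroup G) (S : Finset G) (n : ℕ) : ℕ∞ :=
  ⨆ (g : G) (_ : g ∉ H) (_ : wordLength S g ≤ n), depth H g

/-- `Sub_{G,S}(n)`: the maximum of `D_G(H, g)` over the finitely generated subgroups `H` and the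
`g ∈ G \ H` with `‖H‖_S ≤ n` and `‖g‖_S ≤ n`. -/
def subSep (G : Type*) [Group G] (S : Finset G) (n : ℕ) : ℕ∞ :=
  ⨆ (H : Subgroup G) (_ : H.FG) (g : G) (_ : g ∉ H) (_ : subgroupNorm S H ≤ n)
    (_ : wordLength S g ≤ n), depth H g

/-! ### Comparison of growth -/

/-- `f ≼ g`: there is `C ∈ ℕ` with `f(n) ≤ C g(C n)` for all `n`. The values lie in `[0, ∞]`, so
that integer valued functions, possibly infinite a priori, can be compared with powers of
`log n`. -/
def GrowthLE (f g : ℕ → ℝ≥0∞) : Prop :=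
  ∃ C : ℕ, ∀ n : ℕ, f n ≤ (C : ℝ≥0∞) * g (C * n)

/-- The function `n ↦ log n` (with value `0` at `n = 0`). -/
def logFun (n : ℕ) : ℝ≥0∞ := ENNReal.ofReal (Real.log n)

/-! ### Hirsch length -/

/-- The lower central quotient `γ_{i+1}(N) / γ_{i+2}(N)`, where `γ_1(N) = N` (Mathlib's
`lowerCentralSeries` is indexed from `0`). -/
abbrev LowerCentralQuotient (N : Type*) [Group N] (i : ℕ) : Type _ :=
  ↥((⊤ : Subgroup N).lowerCentralSeries i) ⧸
    ((⊤ : Subgroup N).lowerCentralSeries (i + 1)).subgroupOf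
      ((⊤ : Subgroup N).lowerCentralSeries i)

theorem lowerCentralQuotient_mul_comm (N : Type*) [Group N] (i : ℕ)
    (a b : LowerCentralQuotient N i) : a * b = b * a := by
  induction a using QuotientGroup.induction_on with | _ x => ?_
  induction b using QuotientGroup.induction_on with | _ y => ?_
  rw [← QuotientGroup.mk_mul, ← QuotientGroup.mk_mul, eq_comm, QuotientGroup.eq,
    Subgroup.mem_subgroupOf, Subgroup.lowerCentralSeries_succ]
  have h : (((y * x)⁻¹ * (x * y) : (⊤ : Subgroup N).lowerCentralSeries i) : N) =
      (x : N)⁻¹ * (y : N)⁻¹ * ((x : N)⁻¹)⁻¹ * ((y : N)⁻¹)⁻¹ := by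
    simp [mul_assoc]
  rw [h, ← commutatorElement_def]
  exact Subgroup.commutator_mem_commutator (inv_mem x.2) (Subgroup.mem_top _)

instance lowerCentralQuotientCommGroup (N : Type*) [Group N] (i : ℕ) :
    CommGroup (LowerCentralQuotient N i) :=
  { (inferInstance : Group (LowerCentralQuotient N i)) with
    mul_comm := lowerCentralQuotient_mul_comm N i }

/-- The Hirsch length `h(N) = ∑_{i=1}^{c(N)} rank_ℤ (γ_i(N) / γ_{i+1}(N))` of a nilpotent group
`N` of nilpotency class `c(N)`. -/
def hirschLength (N : Type*) [Group N] [Group.IsNilpotent N] : ℕ :=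
  ∑ i ∈ Finset.range (Group.nilpotencyClass N),
    Module.finrank ℤ (Additive (LowerCentralQuotient N i))

end EffSep

end

open scoped ENNReal

universe u

namespace EffSep

open scoped commutatorElement

/-! Upper bounds come from the quotients of `N` by the normal subgroups `powSub N m` generated by
the `m`-th powers. Their order is `O(m ^ h(N))` (`powSub_index_le`), so it is enough to find a small
`m` such that `g` lies outside `H` times `powSub N m`.

The tool is integer valued polynomial functions on groups. One of degree `< k` is invariant modulo
`m` under `(k! m)`-th powers (`IsPoly.dvd_mul_sub`), is polynomially bounded in the word length
(`IsPoly.growth`), and extends from the kernel of a surjection onto `ℤ` to the whole nilpotent group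
(`extendsPoly_ker`). Every subgroup of infinite index lies in such a kernel, so kernels of this kind
form a chain from `N` down to a finite index overgroup of `H` (`exists_intChain`).

For fixed `H`, an element outside the last term `R` of the chain takes a nonzero value under one of
the surjections. Extending that surjection to a polynomial function on `N` makes the value an
integer `a` of polynomial size such that separation modulo `D m`-th powers can fail only if `m ∣ a`
(`exists_separating_integer`). As `lcm(1, …, r)` grows exponentially, some `m = O(log a)` does not
divide `a` (`exists_not_dvd_le`), which gives `(log n) ^ h(N)`. The elements of `R` outside `H` fall
into finitely many cosets of `H` and contribute a constant.

For varying `H`, `exists_powSub_separating` descends a chain to the trivial group, replacing `H` by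
`H ∩ ker φ`. Polynomial control survives each step: `H ∩ ker φ` has generators of polynomial length
(`exists_ker_generators`), `ker φ` is polynomially distorted (`ker_distortion`), and `D m`-th powers
of the ambient group meet `ker φ` inside its own `m`-th powers (`exists_comap_powSub_le`). Hence a
modulus polynomial in `n` suffices.

From `N` to `Γ`, a normal subgroup of `N` is intersected with its conjugates under coset
representatives, so a quotient of order `d` becomes one of order at most `i * d ^ i` with `i = [Γ :
N]` (`exists_normal_le_map`, `exists_reduction`).

The lower bounds use one cyclic subgroup: `x ^ 2 ^ i` against `⟨x ^ 2 ^ (i + 1)⟩` for varying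
subgroups, and `x ^ lcm(1, …, r)`, which dies in all quotients of order at most `r`, for a fixed
one. -/

theorem exists_letters_of_mem_closure {G : Type*} [Group G] {s : Set G} {x : G}
    (hx : x ∈ Subgroup.closure s) : ∃ l : List G, (∀ y ∈ l, y ∈ s ∨ y⁻¹ ∈ s) ∧ l.prod = x := by
  rw [← Subgroup.mem_toSubmonoid, Subgroup.closure_toSubmonoid] at hx
  obtain ⟨l, h1, h2⟩ := Submonoid.exists_list_of_mem_closure hx
  exact ⟨l, fun y hy => by simpa using h1 y hy, h2⟩

/-! ### Basic properties of word length. -/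

section WordLength

variable {G : Type*} [Group G] {S : Finset G}

theorem wordLength_prod_le {l : List G} (hl : ∀ x ∈ l, x ∈ S ∨ x⁻¹ ∈ S) :
    wordLength S l.prod ≤ l.length :=
  Nat.sInf_le ⟨l, hl, rfl, rfl⟩

theorem exists_word_of_mem_closure {g : G} (hg : g ∈ Subgroup.closure (S : Set G)) :
    ∃ l : List G, (∀ x ∈ l, x ∈ S ∨ x⁻¹ ∈ S) ∧ l.prod = g ∧ l.length = wordLength S g := by
  obtain ⟨l, hl, hp⟩ := exists_letters_of_mem_closure hg
  have : (wordLength S g) ∈ {n : ℕ | ∃ l : List G,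
      (∀ x ∈ l, x ∈ S ∨ x⁻¹ ∈ S) ∧ l.prod = g ∧ l.length = n} :=
    Nat.sInf_mem ⟨l.length, l, by simpa using hl, hp, rfl⟩
  exact this

theorem exists_word (hS : Subgroup.closure (S : Set G) = ⊤) (g : G) :
    ∃ l : List G, (∀ x ∈ l, x ∈ S ∨ x⁻¹ ∈ S) ∧ l.prod = g ∧ l.length = wordLength S g :=
  exists_word_of_mem_closure (hS ▸ Subgroup.mem_top g)

@[simp]
theorem wordLength_one : wordLength S (1 : G) = 0 :=
  Nat.le_zero.1 (wordLength_prod_le (S := S) (l := []) (by simp))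

variable (hS : Subgroup.closure (S : Set G) = ⊤)
include hS

theorem wordLength_mul_le (g h : G) :
    wordLength S (g * h) ≤ wordLength S g + wordLength S h := by
  obtain ⟨l, hl, rfl, h1⟩ := exists_word hS g
  obtain ⟨l', hl', rfl, h2⟩ := exists_word hS h
  rw [← h1, ← h2, ← List.prod_append, ← List.length_append]
  refine wordLength_prod_le fun x hx => ?_
  rcases List.mem_append.1 hx with hx | hx
  exacts [hl x hx, hl' x hx]

theorem wordLength_inv_le (g : G) : wordLength S g⁻¹ ≤ wordLength S g := by
  obtain ⟨l, hl, rfl, h1⟩ := exists_word hS g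
  rw [← h1, List.prod_inv_reverse]
  refine (wordLength_prod_le fun x hx => ?_).trans (by simp)
  simp only [List.mem_reverse, List.mem_map] at hx
  obtain ⟨y, hy, rfl⟩ := hx
  rw [inv_inv]
  exact (hl y hy).symm

theorem wordLength_inv (g : G) : wordLength S g⁻¹ = wordLength S g :=
  le_antisymm (wordLength_inv_le hS g) (by simpa using wordLength_inv_le hS g⁻¹)

theorem wordLength_pow_le (g : G) (n : ℕ) : wordLength S (g ^ n) ≤ n * wordLength S g := by
  induction n with
  | zero => simp
  | succ n ih =>
    rw [pow_succ, add_mul, one_mul]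
    exact (wordLength_mul_le hS _ _).trans (by gcongr)

theorem wordLength_zpow_le (g : G) (n : ℤ) :
    wordLength S (g ^ n) ≤ n.natAbs * wordLength S g := by
  rcases Int.natAbs_eq n with h | h
  · conv_lhs => rw [h, zpow_natCast]
    exact wordLength_pow_le hS g n.natAbs
  · conv_lhs => rw [h, zpow_neg, zpow_natCast, wordLength_inv hS]
    exact wordLength_pow_le hS g n.natAbs

theorem wordLength_list_prod_le {B : ℕ} {l : List G} (hl : ∀ x ∈ l, wordLength S x ≤ B) :
    wordLength S l.prod ≤ l.length * B := by
  induction l with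
  | nil => simp
  | cons a l ih =>
    rw [List.prod_cons, List.length_cons, add_mul, one_mul, add_comm]
    exact (wordLength_mul_le hS _ _).trans
      (add_le_add (hl a (by simp)) (ih fun x hx => hl x (by simp [hx])))

theorem exists_letter_mul {g : G} {n : ℕ} (hg : wordLength S g ≤ n + 1) (h1 : g ≠ 1) :
    ∃ s g', (s ∈ S ∨ s⁻¹ ∈ S) ∧ wordLength S g' ≤ n ∧ g = s * g' := by
  obtain ⟨l, hl, rfl, h⟩ := exists_word hS g
  cases l with
  | nil => simp at h1
  | cons s l =>
    refine ⟨s, l.prod, hl s (by simp), ?_, by simp⟩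
    refine (wordLength_prod_le fun x hx => hl x (by simp [hx])).trans ?_
    simp only [List.length_cons] at h
    omega

theorem eq_one_of_wordLength_eq_zero {g : G} (hg : wordLength S g = 0) : g = 1 := by
  obtain ⟨l, -, rfl, h⟩ := exists_word hS g
  rw [hg, List.length_eq_zero_iff] at h
  simp [h]

end WordLength

/-- A finite bound for a function on the letters `S ∪ S⁻¹`. -/
theorem exists_bound_letters {G : Type*} [Group G] (S : Finset G) (F : G → ℕ) :
    ∃ B, ∀ s, (s ∈ S ∨ s⁻¹ ∈ S) → F s ≤ B := by
  classical
  refine ⟨(S ∪ S.image (·⁻¹)).sup F, fun s hs => Finset.le_sup (f := F) ?_⟩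
  rw [Finset.mem_union, Finset.mem_image]
  rcases hs with hs | hs
  exacts [Or.inl hs, Or.inr ⟨_, hs, inv_inv s⟩]

/-! ### Subgroups generated by powers. -/

section PowSub

variable {G : Type*} [Group G]

/-- The subgroup generated by all `m`-th powers. -/
def powSub (G : Type*) [Group G] (m : ℕ) : Subgroup G :=
  Subgroup.closure (Set.range fun g : G => g ^ m)

theorem pow_mem_powSub (g : G) (m : ℕ) : g ^ m ∈ powSub G m :=
  Subgroup.subset_closure ⟨g, rfl⟩

theorem map_powSub_le {K : Type*} [Group K] (f : G →* K) (m : ℕ) :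
    (powSub G m).map f ≤ powSub K m := by
  rw [powSub, MonoidHom.map_closure, Subgroup.closure_le]
  rintro _ ⟨_, ⟨g, rfl⟩, rfl⟩
  simpa using pow_mem_powSub (f g) m

instance powSub_characteristic (m : ℕ) : (powSub G m).Characteristic :=
  Subgroup.characteristic_iff_map_le.2 fun e => map_powSub_le e.toMonoidHom m

theorem powSub_le_of_dvd {m n : ℕ} (h : m ∣ n) : powSub G n ≤ powSub G m := by
  obtain ⟨k, rfl⟩ := h
  rw [powSub, Subgroup.closure_le]
  rintro _ ⟨g, rfl⟩
  simp only [mul_comm m k, pow_mul]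
  exact pow_mem_powSub _ _

end PowSub

/-! ### Polynomial functions on groups -/

section IsPoly

variable {G : Type*} [Group G]

/-- `f : G → ℤ` is polynomial of degree `< k`: all its `k`-fold (left) differences vanish. -/
def IsPoly : ℕ → (G → ℤ) → Prop
  | 0, f => f = 0
  | k + 1, f => ∀ g, IsPoly k (fun x => f (g * x) - f x)

theorem isPoly_zero (k : ℕ) : IsPoly k (0 : G → ℤ) := by
  induction k with
  | zero => rfl
  | succ k ih => intro g; simpa using! ih

theorem IsPoly.succ {k : ℕ} {f : G → ℤ} (hf : IsPoly k f) : IsPoly (k + 1) f := by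
  induction k generalizing f with
  | zero => obtain rfl : f = 0 := hf; exact isPoly_zero 1
  | succ k ih => exact fun g => ih (hf g)

theorem IsPoly.mono {k l : ℕ} (h : k ≤ l) {f : G → ℤ} (hf : IsPoly k f) : IsPoly l f := by
  induction l, h using Nat.le_induction with
  | base => exact hf
  | succ l _ ih => exact ih.succ

theorem IsPoly.add {k : ℕ} {f g : G → ℤ} (hf : IsPoly k f) (hg : IsPoly k g) :
    IsPoly k (f + g) := by
  induction k generalizing f g with
  | zero => obtain rfl : f = 0 := hf; obtain rfl : g = 0 := hg; exact add_zero 0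
  | succ k ih =>
    intro a
    convert ih (hf a) (hg a) using 1
    ext x; simp only [Pi.add_apply]; ring

theorem IsPoly.neg {k : ℕ} {f : G → ℤ} (hf : IsPoly k f) : IsPoly k (-f) := by
  induction k generalizing f with
  | zero => obtain rfl : f = 0 := hf; exact neg_zero
  | succ k ih =>
    intro a
    convert ih (hf a) using 1
    ext x; simp only [Pi.neg_apply]; ring

theorem isPoly_hom (φ : G →* Multiplicative ℤ) : IsPoly 2 fun x => (φ x).toAdd := by
  intro g h
  simp only [map_mul, toAdd_mul]
  ext x
  simp

/-- Reduces polynomial functions on `G` to ordinary finite differences along the orbit of a cyclic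
subgroup, where Newton's formula applies. -/
theorem IsPoly.iterate_fwdDiff {k : ℕ} {f : G → ℤ} (hf : IsPoly k f) (g x : G) :
    (fwdDiff (1 : ℕ))^[k] (fun j : ℕ => f (g ^ j * x)) = 0 := by
  induction k generalizing f with
  | zero => obtain rfl : f = 0 := hf; rfl
  | succ k ih =>
    rw [Function.iterate_succ_apply, ← ih (hf g)]
    congr 1
    ext j
    simp only [fwdDiff, pow_succ', mul_assoc]

/-- From `i * C(n, i) = n * C(n - 1, i - 1)` with `n = k! m`: the factor `i` cancels against `k!`
and leaves `m`. -/
theorem dvd_choose_factorial_mul {k i m : ℕ} (hi : 1 ≤ i) (hk : i ≤ k) :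
    m ∣ (k.factorial * m).choose i := by
  obtain ⟨q, hq⟩ := Nat.dvd_factorial hi hk
  obtain ⟨j, rfl⟩ : ∃ j, i = j + 1 := ⟨i - 1, by omega⟩
  rcases Nat.eq_zero_or_pos (k.factorial * m) with h0 | h0
  · simp [h0]
  · obtain ⟨n, hn⟩ : ∃ n, k.factorial * m = n + 1 := ⟨k.factorial * m - 1, by omega⟩
    have h := Nat.add_one_mul_choose_eq n j
    rw [hn]
    rw [← hn, hq] at h
    rw [← hn, hq]
    refine ⟨q * n.choose j, Nat.eq_of_mul_eq_mul_right (Nat.add_one_pos j) ?_⟩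
    rw [← h]
    ring

/-- In the Newton expansion at `k! m`, the binomial coefficients of the terms of order between `1`
and `k` are divisible by `m`, and the higher differences vanish. -/
theorem IsPoly.dvd_pow_mul_sub {k : ℕ} {f : G → ℤ} (hf : IsPoly k f) (m : ℕ) (g x : G) :
    (m : ℤ) ∣ f (g ^ (k.factorial * m) * x) - f x := by
  have h := shift_eq_sum_fwdDiff_iter (1 : ℕ) (fun j : ℕ => f (g ^ j * x)) (k.factorial * m) 0
  simp only [smul_eq_mul, mul_one, zero_add] at h
  rw [h, Finset.sum_range_succ']
  simp only [Nat.choose_zero_right, Function.iterate_zero, id, pow_zero, one_mul, one_smul,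
    add_sub_cancel_right]
  refine Finset.dvd_sum fun i _ => ?_
  rcases le_or_gt (i + 1) k with hi | hi
  · rw [nsmul_eq_mul]
    exact dvd_mul_of_dvd_left (Int.natCast_dvd_natCast.2 (dvd_choose_factorial_mul (by omega) hi)) _
  · rw [(hf.mono hi.le).iterate_fwdDiff g x]
    simp

/-- Polynomial functions are invariant modulo `m` under translation by products of
`(k! m)`-th powers. -/
theorem IsPoly.dvd_mul_sub {k : ℕ} {f : G → ℤ} (hf : IsPoly k f) {m : ℕ} {y : G}
    (hy : y ∈ powSub G (k.factorial * m)) (x : G) : (m : ℤ) ∣ f (y * x) - f x := by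
  induction hy using Subgroup.closure_induction generalizing x with
  | mem y hy => obtain ⟨g, rfl⟩ := hy; exact hf.dvd_pow_mul_sub m g x
  | one => simp
  | mul y z _ _ h1 h2 =>
    have := dvd_add (h1 (z * x)) (h2 x)
    rwa [sub_add_sub_cancel, ← mul_assoc] at this
  | inv y _ h =>
    have := h (y⁻¹ * x)
    rw [mul_inv_cancel_left] at this
    rwa [dvd_sub_comm]

/-- Polynomial functions grow at most polynomially in the word length. -/
theorem IsPoly.growth {k : ℕ} {f : G → ℤ} (hf : IsPoly k f) {S : Finset G}
    (hS : Subgroup.closure (S : Set G) = ⊤) :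
    ∃ C : ℕ, ∀ x, (f x).natAbs ≤ C * (wordLength S x + 1) ^ k := by
  induction k generalizing f with
  | zero => obtain rfl : f = 0 := hf; exact ⟨0, by simp⟩
  | succ k ih =>
    choose c hc using fun g => ih (hf g)
    obtain ⟨B, hB⟩ := exists_bound_letters S c
    refine ⟨B + (f 1).natAbs, ?_⟩
    -- Peeling off one letter `s` changes `f` by its difference along `s`, which has lower degree;
    -- `n` such changes are added up.
    have key : ∀ n x, wordLength S x ≤ n → (f x).natAbs ≤ (f 1).natAbs + n * (B * (n + 1) ^ k) := by
      intro n
      induction n with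
      | zero =>
        intro x hx
        rw [eq_one_of_wordLength_eq_zero hS (Nat.le_zero.1 hx)]
        simp
      | succ n ihn =>
        intro x hx
        rcases eq_or_ne x 1 with rfl | h1
        · omega
        obtain ⟨s, y, hs, hy, rfl⟩ := exists_letter_mul hS hx h1
        have h2 := hc s y
        have h3 := ihn y hy
        have h4 : c s * (wordLength S y + 1) ^ k ≤ B * (n + 1 + 1) ^ k := by
          gcongr
          · exact hB s hs
          · omega
        have h5 : n * (B * (n + 1) ^ k) ≤ n * (B * (n + 1 + 1) ^ k) := by gcongr; omega
        have h6 : (f (s * y)).natAbs ≤ (f (s * y) - f y).natAbs + (f y).natAbs := by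
          simpa using Int.natAbs_add_le (f (s * y) - f y) (f y)
        rw [add_mul, one_mul]
        omega
    intro x
    refine (key _ x le_rfl).trans ?_
    have h7 : 1 ≤ (wordLength S x + 1) ^ (k + 1) := Nat.one_le_pow _ _ (by omega)
    have h8 : wordLength S x * (B * (wordLength S x + 1) ^ k) ≤
        B * (wordLength S x + 1) ^ (k + 1) := by
      rw [pow_succ]
      nlinarith [Nat.zero_le (B * (wordLength S x + 1) ^ k)]
    have h9 := Nat.mul_le_mul_left (f 1).natAbs h7
    rw [add_mul]
    omega

end IsPoly

/-! ### Extension of polynomial functions -/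

section Operators

variable {L : Type*} [Group L]

/-- Translation of functions by `g`. -/
def translate (g : L) : Module.End ℤ (L → ℤ) := LinearMap.funLeft ℤ ℤ (g * ·)

@[simp]
theorem translate_apply (g : L) (f : L → ℤ) (x : L) : translate g f x = f (g * x) := rfl

/-- The operators on functions generated by the `translate g - 1`, which have weight `i` for
`g` in the `i`-th term of the filtration `W`. -/
inductive OpWeight (W : ℕ → Subgroup L) : ℕ → Module.End ℤ (L → ℤ) → Prop
  | base {i : ℕ} {g : L} : 1 ≤ i → g ∈ W i → OpWeight W i (translate g - 1)
  | add {w : ℕ} {A B : Module.End ℤ (L → ℤ)} :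
      OpWeight W w A → OpWeight W w B → OpWeight W w (A + B)
  | neg {w : ℕ} {A : Module.End ℤ (L → ℤ)} : OpWeight W w A → OpWeight W w (-A)
  | mul {v w : ℕ} {A B : Module.End ℤ (L → ℤ)} :
      OpWeight W v A → OpWeight W w B → OpWeight W (v + w) (A * B)
  | mono {w : ℕ} {A : Module.End ℤ (L → ℤ)} : OpWeight W (w + 1) A → OpWeight W w A

theorem OpWeight.of_le {W : ℕ → Subgroup L} {v w : ℕ} (h : v ≤ w) {A : Module.End ℤ (L → ℤ)}
    (hA : OpWeight W w A) : OpWeight W v A := by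
  induction w, h using Nat.le_induction with
  | base => exact hA
  | succ w _ ih => exact ih hA.mono

/-- Composition of functions with an automorphism. -/
def pullback (σ : L ≃* L) : Module.End ℤ (L → ℤ) := LinearMap.funLeft ℤ ℤ σ

@[simp]
theorem pullback_apply (σ : L ≃* L) (f : L → ℤ) (x : L) : pullback σ f x = f (σ x) := rfl

/-- Conjugation of operators by an automorphism. -/
def conjOp (σ : L ≃* L) (A : Module.End ℤ (L → ℤ)) : Module.End ℤ (L → ℤ) :=
  pullback σ.symm * A * pullback σ

theorem pullback_mul_symm (σ : L ≃* L) : pullback σ * pullback σ.symm = 1 := by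
  ext f x
  simp [Module.End.mul_apply]

theorem conjOp_mul (σ : L ≃* L) (A B : Module.End ℤ (L → ℤ)) :
    conjOp σ (A * B) = conjOp σ A * conjOp σ B := by
  simp only [conjOp, mul_assoc]
  rw [← mul_assoc (pullback σ) (pullback σ.symm), pullback_mul_symm, one_mul]

theorem conjOp_translate (σ : L ≃* L) (g : L) : conjOp σ (translate g - 1) = translate (σ g) - 1 := by
  ext f x
  simp [conjOp, Module.End.mul_apply]

theorem translate_mul (g h : L) : translate (g * h) = translate h * translate g := by
  ext f x
  simp [Module.End.mul_apply, mul_assoc]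

/-- On generators this is the hypothesis on `σ`, through `σ g = g * (g⁻¹ * σ g)`; products follow
from the Leibniz type formula for `conjOp σ - 1`. -/
theorem OpWeight.conjOp_sub {W : ℕ → Subgroup L} {σ : L ≃* L}
    (hσ : ∀ i g, 1 ≤ i → g ∈ W i → g⁻¹ * σ g ∈ W (i + 1)) {w : ℕ} {A : Module.End ℤ (L → ℤ)}
    (hA : OpWeight W w A) : OpWeight W (w + 1) (conjOp σ A - A) := by
  induction hA with
  | @base i g hi hg =>
    have h := OpWeight.base (Nat.le_add_left 1 i) (hσ i g hi hg)
    have e : conjOp σ (translate g - 1) - (translate g - 1) =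
        (translate (g⁻¹ * σ g) - 1) +
          (translate (g⁻¹ * σ g) - 1) * (translate g - 1) := by
      have : translate (σ g) = translate (g⁻¹ * σ g) * translate g := by
        rw [← translate_mul, mul_inv_cancel_left]
      rw [conjOp_translate, this]
      noncomm_ring
    rw [e]
    exact h.add ((h.mul (OpWeight.base hi hg)).of_le (Nat.le_add_right _ _))
  | @add w A B _ _ h1 h2 =>
    have e : conjOp σ (A + B) - (A + B) = (conjOp σ A - A) + (conjOp σ B - B) := by
      simp only [conjOp, mul_add, add_mul]; abel
    rw [e]
    exact h1.add h2
  | @neg w A _ h =>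
    have e : conjOp σ (-A) - (-A) = -(conjOp σ A - A) := by
      simp only [conjOp, mul_neg, neg_mul]; abel
    rw [e]
    exact h.neg
  | @mul v w A B hA hB h1 h2 =>
    have e : conjOp σ (A * B) - A * B = (conjOp σ A - A) * B + A * (conjOp σ B - B) +
        (conjOp σ A - A) * (conjOp σ B - B) := by
      rw [conjOp_mul]; noncomm_ring
    rw [e]
    refine ((OpWeight.of_le (by omega) (h1.mul hB)).add (OpWeight.of_le (by omega) (hA.mul h2))).add
      (OpWeight.of_le (by omega) (h1.mul h2))
  | mono _ h => exact h.mono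

/-- A difference operator lowers the degree by one while its weight can be taken at most `c`, since
beyond `c` it is zero. So an operator of large weight lowers the degree by at least its weight
divided by `c`. -/
theorem OpWeight.isPoly_apply {W : ℕ → Subgroup L} {c : ℕ} (hc : 1 ≤ c)
    (hW : ∀ i, c < i → W i = ⊥) {w : ℕ} {A : Module.End ℤ (L → ℤ)} (hA : OpWeight W w A) :
    ∃ q, w ≤ c * q ∧ ∀ j f, IsPoly (q + j) f → IsPoly j (A f) := by
  induction hA with
  | @base i g hi hg =>
    rcases le_or_gt i c with h | h
    · refine ⟨1, by omega, fun j f hf => ?_⟩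
      rw [add_comm] at hf
      exact hf g
    · refine ⟨i, by nlinarith, fun j f _ => ?_⟩
      rw [hW i h, Subgroup.mem_bot] at hg
      convert isPoly_zero j
      ext x
      simp [hg]
  | @add w A B _ _ h1 h2 =>
    obtain ⟨q1, h1, h1'⟩ := h1
    obtain ⟨q2, h2, h2'⟩ := h2
    refine ⟨min q1 q2, by rcases min_choice q1 q2 with h | h <;> rw [h] <;> assumption,
      fun j f hf => ?_⟩
    exact (h1' j f (hf.mono (by gcongr; exact min_le_left _ _))).add
      (h2' j f (hf.mono (by gcongr; exact min_le_right _ _)))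
  | neg _ h =>
    obtain ⟨q, h, h'⟩ := h
    exact ⟨q, h, fun j f hf => (h' j f hf).neg⟩
  | @mul v w A B _ _ h1 h2 =>
    obtain ⟨q1, h1, h1'⟩ := h1
    obtain ⟨q2, h2, h2'⟩ := h2
    refine ⟨q1 + q2, by rw [mul_add]; omega, fun j f hf => h1' j _ (h2' _ f ?_)⟩
    convert hf using 1
    ring
  | mono _ h =>
    obtain ⟨q, h, h'⟩ := h
    exact ⟨q, by omega, h'⟩

end Operators

section Extension

variable {G : Type*} [Group G] {φ : G →* Multiplicative ℤ} {t : G}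
  (ht : φ t = Multiplicative.ofAdd 1)

include ht in
theorem toAdd_map_zpow (a : ℤ) : (φ (t ^ a)).toAdd = a := by
  simp [map_zpow, ht]

include ht in
theorem mul_zpow_mem_ker {x : G} {a : ℤ} (h : (φ x).toAdd + a = 0) : x * t ^ a ∈ φ.ker := by
  rw [MonoidHom.mem_ker, map_mul]
  apply Multiplicative.toAdd.injective
  rw [toAdd_mul, toAdd_map_zpow ht, h]
  rfl

/-- The extension of a function on the kernel of `φ : G → ℤ` which is invariant under right
translation by `t`. -/
def extendFun (f : φ.ker → ℤ) (x : G) : ℤ :=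
  f ⟨x * t ^ (-(φ x).toAdd), mul_zpow_mem_ker ht (by simp)⟩

theorem extendFun_coe (f : φ.ker → ℤ) (x : φ.ker) : extendFun ht f x = f x := by
  have : φ (x : G) = 1 := x.2
  simp [extendFun, this]

/-- The lower central filtration of `G`, restricted to `L` and indexed from `1`. -/
def lcsFiltration (L : Subgroup G) (i : ℕ) : Subgroup L :=
  ((⊤ : Subgroup G).lowerCentralSeries (i - 1)).subgroupOf L

theorem conj_mem_lcsFiltration {L : Subgroup G} [L.Normal] (y : G) (i : ℕ) (g : L) (hi : 1 ≤ i)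
    (hg : g ∈ lcsFiltration L i) :
    g⁻¹ * MulAut.conjNormal y g ∈ lcsFiltration L (i + 1) := by
  obtain ⟨i, rfl⟩ : ∃ j, i = j + 1 := ⟨i - 1, by omega⟩
  simp only [lcsFiltration, Nat.add_sub_cancel, Subgroup.mem_subgroupOf] at hg ⊢
  rw [Subgroup.lowerCentralSeries_succ]
  have := Subgroup.commutator_mem_commutator (inv_mem hg) (Subgroup.mem_top y)
  convert this using 1
  simp [commutatorElement_def, mul_assoc]

/-- Counting by weight rather than degree makes the induction close: a difference of the extension
involves conjugation by a power of `t`, which changes an operator only by terms of higher weight,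
and those kill `f`. -/
theorem isPoly_extendFun_of_killed (w : ℕ) (f : φ.ker → ℤ)
    (hf : ∀ A, OpWeight (lcsFiltration φ.ker) (w + 1) A → A f = 0) :
    IsPoly (w + 1) (extendFun ht f) := by
  have hW1 : ∀ g : φ.ker, OpWeight (lcsFiltration φ.ker) 1 (translate g - 1) := fun g =>
    OpWeight.base le_rfl (by simp [lcsFiltration])
  induction w generalizing f with
  | zero =>
    have hc : ∀ x, f x = f 1 := fun x => by
      have := congrFun (hf _ (hW1 x)) 1
      simpa [sub_eq_zero] using this
    intro g
    change _ = _
    ext x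
    simp only [extendFun]
    rw [hc, hc ⟨x * _, _⟩]
    simp
  | succ w ih =>
    intro g
    set a := (φ g).toAdd with ha
    set σ : φ.ker ≃* φ.ker := MulAut.conjNormal (t ^ a) with hσ
    set l : φ.ker := ⟨g * t ^ (-a), mul_zpow_mem_ker ht (by simp [ha])⟩ with hl
    -- With `g = l * t ^ a`, the power of `t` is moved past `x`, where it acts on the kernel
    -- component by conjugation.
    have e : (fun x => extendFun ht f (g * x) - extendFun ht f x) =
        extendFun ht (pullback σ (translate l f) - f) := by
      ext x
      simp only [extendFun, Pi.sub_apply, pullback_apply, translate_apply]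
      congr 2
      ext
      simp only [hl, hσ, Subgroup.coe_mul, MulAut.conjNormal_apply, map_mul, toAdd_mul, ← ha]
      group
    rw [e]
    refine ih _ fun A hA => ?_
    have hA' := hA.conjOp_sub (σ := σ) (conj_mem_lcsFiltration (t ^ a))
    set A' := conjOp σ A with hA'def
    have h1 : A' f = A f := by
      have := hf _ hA'
      rwa [LinearMap.sub_apply, sub_eq_zero] at this
    have h2 : A' (translate l f) = A' f := by
      have h3 : OpWeight (lcsFiltration φ.ker) (w + 1) A' := by
        have := hA'.mono.add hA
        rwa [sub_add_cancel] at this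
      have := hf _ (h3.mul (hW1 l))
      rw [Module.End.mul_apply, LinearMap.sub_apply, map_sub, sub_eq_zero] at this
      exact this
    have h4 : A (pullback σ (translate l f)) = pullback σ (A' (translate l f)) := by
      have : A * pullback σ = pullback σ * A' := by
        rw [hA'def, conjOp, ← mul_assoc, ← mul_assoc, pullback_mul_symm, one_mul]
      exact LinearMap.congr_fun this _
    -- One more difference exhausts the weight, so `A f` is constant and the composition with `σ`
    -- does not affect it.
    have h5 : ∀ x, A f x = A f 1 := fun x => by
      have := congrFun (hf _ (OpWeight.of_le (by omega) ((hW1 x).mul hA))) 1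
      simpa [sub_eq_zero, Module.End.mul_apply] using this
    rw [map_sub, h4, h2, h1]
    ext x
    simp [h5 (σ x), h5 x]

/-- A polynomial function on the kernel of a surjection from a nilpotent group to `ℤ` extends to
a polynomial function on the whole group. -/
theorem exists_isPoly_extendFun [Group.IsNilpotent G] {k : ℕ} {f : φ.ker → ℤ} (hf : IsPoly k f) :
    ∃ l, IsPoly l (extendFun ht f) := by
  obtain ⟨c, hc⟩ := (Subgroup.nilpotent_iff_lowerCentralSeries (G := G)).1 inferInstance
  -- An operator of weight above `(c + 1) * k` lowers the degree by more than `k`, hence kills `f`.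
  refine ⟨(c + 1) * k + 1, isPoly_extendFun_of_killed ht _ f fun A hA => ?_⟩
  obtain ⟨q, h1, h2⟩ := hA.isPoly_apply (c := c + 1) (by omega) (fun i hi => by
    have : (⊤ : Subgroup G).lowerCentralSeries (i - 1) = ⊥ := by
      rw [eq_bot_iff, ← hc]
      exact Subgroup.lowerCentralSeries_antitone _ (by omega)
    rw [lcsFiltration, this, Subgroup.bot_subgroupOf])
  have hkq : k < q := by
    by_contra h
    have := Nat.mul_le_mul_left (c + 1) (not_lt.1 h)
    omega
  exact h2 0 f (hf.mono (by omega))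

end Extension

/-- Every integer valued polynomial function on `K` is the pullback of one on `G` along `ι`. -/
def ExtendsPoly {K G : Type*} [Group K] [Group G] (ι : K →* G) : Prop :=
  ∀ (k : ℕ) (f : K → ℤ), IsPoly k f → ∃ (l : ℕ) (F : G → ℤ), IsPoly l F ∧ ∀ x, F (ι x) = f x

theorem extendsPoly_id (G : Type*) [Group G] : ExtendsPoly (MonoidHom.id G) :=
  fun k f hf => ⟨k, f, hf, fun _ => rfl⟩

theorem ExtendsPoly.comp {J K G : Type*} [Group J] [Group K] [Group G] {κ : J →* K} {ι : K →* G}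
    (hι : ExtendsPoly ι) (hκ : ExtendsPoly κ) : ExtendsPoly (ι.comp κ) := by
  intro k f hf
  obtain ⟨l, F, hF, h1⟩ := hκ k f hf
  obtain ⟨m, E, hE, h2⟩ := hι l F hF
  exact ⟨m, E, hE, fun x => by simp [h1, h2]⟩

theorem extendsPoly_ker {G : Type*} [Group G] [Group.IsNilpotent G] {φ : G →* Multiplicative ℤ}
    (hφ : Function.Surjective φ) : ExtendsPoly φ.ker.subtype := by
  obtain ⟨t, ht⟩ := hφ (Multiplicative.ofAdd 1)
  intro k f hf
  obtain ⟨l, hl⟩ := exists_isPoly_extendFun ht hf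
  exact ⟨l, _, hl, extendFun_coe ht f⟩

/-! ### Finitely generated nilpotent groups -/

theorem CommGroup.fg_subgroup {A : Type*} [CommGroup A] [Group.FG A] (P : Subgroup A) : P.FG := by
  have : AddGroup.FG (Additive A) := GroupFG.iff_add_fg.1 inferInstance
  have : Module.Finite ℤ (Additive A) := Module.Finite.iff_addGroup_fg.2 this
  have h : (AddSubgroup.toIntSubmodule (Subgroup.toAddSubgroup P)).FG :=
    IsNoetherian.noetherian _
  rw [Submodule.fg_iff_addSubgroup_fg] at h
  rw [Subgroup.fg_iff_add_fg]
  exact h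

theorem subgroup_fg_map {G Q : Type*} [Group G] [Group Q] (f : G →* Q) {H : Subgroup G}
    (h : H.FG) : (H.map f).FG := by
  classical
  obtain ⟨s, rfl⟩ := h
  exact ⟨s.image f, by rw [Finset.coe_image, MonoidHom.map_closure]⟩

theorem subgroup_fg_of_map_of_inf_ker {G Q : Type*} [Group G] [Group Q] (f : G →* Q)
    {H : Subgroup G} (h1 : (H.map f).FG) (h2 : (H ⊓ f.ker).FG) : H.FG := by
  obtain ⟨s, hs⟩ := h1
  have hs' : ∀ y ∈ s, ∃ x ∈ H, f x = y := fun y hy => by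
    have : y ∈ H.map f := hs ▸ Subgroup.subset_closure hy
    simpa using this
  classical
  choose! r hr hfr using hs'
  have h3 : (Subgroup.closure ((s.image r : Finset G) : Set G)).FG := ⟨_, rfl⟩
  convert h3.sup h2 using 1
  apply le_antisymm
  · intro x hx
    have h4 : f x ∈ (Subgroup.closure ((s.image r : Finset G) : Set G)).map f := by
      rw [MonoidHom.map_closure, Finset.coe_image, ← Set.image_comp]
      have : (f ∘ r) '' (s : Set Q) = s := by
        ext y
        constructor
        · rintro ⟨z, hz, rfl⟩; simpa [hfr z hz] using hz
        · exact fun hy => ⟨y, hy, hfr y hy⟩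
      rw [this, hs]
      exact Subgroup.mem_map_of_mem f hx
    obtain ⟨y, hy, hxy⟩ := h4
    have hyH : y ∈ H := by
      refine (Subgroup.closure_le H).2 ?_ hy
      intro z hz
      simp only [Finset.coe_image, Set.mem_image] at hz
      obtain ⟨w, hw, rfl⟩ := hz
      exact hr w hw
    rw [← mul_inv_cancel_left y x]
    exact Subgroup.mul_mem_sup hy
      (show y⁻¹ * x ∈ H ⊓ f.ker from ⟨H.mul_mem (H.inv_mem hyH) hx, by simp [hxy]⟩)
  · refine sup_le ((Subgroup.closure_le H).2 ?_) inf_le_left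
    intro z hz
    simp only [Finset.coe_image, Set.mem_image] at hz
    obtain ⟨w, hw, rfl⟩ := hz
    exact hr w hw

theorem fg_map_lcs_quotient {G : Type*} [Group G] {n : ℕ} (K : Subgroup G) [K.Normal]
    (hK : K = (⊤ : Subgroup G).lowerCentralSeries n) :
    (⊤ : Subgroup (G ⧸ K)).lowerCentralSeries n = ⊥ := by
  rw [← Subgroup.map_top_of_surjective (QuotientGroup.mk' K) (QuotientGroup.mk'_surjective K),
    ← Subgroup.map_lowerCentralSeries, ← hK, QuotientGroup.map_mk'_self]

theorem lcs_le_center {G : Type*} [Group G] {n : ℕ}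
    (h : (⊤ : Subgroup G).lowerCentralSeries (n + 1) = ⊥) :
    (⊤ : Subgroup G).lowerCentralSeries n ≤ Subgroup.center G := by
  intro x hx
  rw [Subgroup.mem_center_iff]
  intro g
  have := Subgroup.commutator_mem_commutator hx (Subgroup.mem_top g)
  rw [← Subgroup.lowerCentralSeries_succ, h, Subgroup.mem_bot, commutatorElement_eq_one_iff_mul_comm]
    at this
  exact this.symm

/-- A subgroup of the center is a commutative group. -/
abbrev commGroupOfLeCenter {G : Type*} [Group G] {K : Subgroup G} (hK : K ≤ Subgroup.center G) :
    CommGroup K :=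
  { (inferInstance : Group K) with
    mul_comm := fun a b => Subtype.ext (Subgroup.mem_center_iff.1 (hK b.2) a) }

theorem fg_of_le_of_le_center {G : Type*} [Group G] {K P : Subgroup G}
    (hK : K ≤ Subgroup.center G) (hfg : K.FG) (hP : P ≤ K) : P.FG := by
  let _ := commGroupOfLeCenter hK
  have : Group.FG K := (Group.fg_iff_subgroup_fg K).2 hfg
  have := CommGroup.fg_subgroup (P.subgroupOf K)
  have h2 := (subgroup_fg_map K.subtype this)
  rwa [Subgroup.subgroupOf_map_subtype, inf_eq_left.2 hP] at h2

/-- The last term is generated by the commutators of lifts of generators of the previous term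
(modulo the last) with generators of `G`. Modulo these finitely many central elements the previous
term becomes central, because the error in lifting is central already. -/
theorem fg_last_lcs {G : Type*} [Group G] [Group.FG G] {m : ℕ}
    (h : (⊤ : Subgroup G).lowerCentralSeries (m + 2) = ⊥)
    (hfg : ((⊤ : Subgroup G).lowerCentralSeries m |>.map
      (QuotientGroup.mk' ((⊤ : Subgroup G).lowerCentralSeries (m + 1)))).FG) :
    ((⊤ : Subgroup G).lowerCentralSeries (m + 1)).FG := by
  classical
  set K := (⊤ : Subgroup G).lowerCentralSeries (m + 1) with hK
  obtain ⟨s, hs⟩ := hfg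
  obtain ⟨T, hT⟩ := (Group.fg_def (G := G)).1 inferInstance
  have hs' : ∀ y ∈ s, ∃ x ∈ (⊤ : Subgroup G).lowerCentralSeries m, QuotientGroup.mk' K x = y :=
    fun y hy => by
      have : y ∈ ((⊤ : Subgroup G).lowerCentralSeries m).map (QuotientGroup.mk' K) :=
        hs ▸ Subgroup.subset_closure hy
      exact this
  choose! r hr hfr using hs'
  have hKc : K ≤ Subgroup.center G := lcs_le_center h
  set X : Finset G := (s ×ˢ T).image fun p => ⁅r p.1, p.2⁆ with hX
  have hXK : Subgroup.closure (X : Set G) ≤ K := by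
    rw [Subgroup.closure_le]
    intro z hz
    simp only [hX, Finset.coe_image, Set.mem_image, Finset.mem_coe, Finset.mem_product] at hz
    obtain ⟨p, hp, rfl⟩ := hz
    exact Subgroup.commutator_mem_commutator (hr _ hp.1) (Subgroup.mem_top _)
  set K' := Subgroup.closure (X : Set G) with hK'
  have hK'n : K'.Normal := ⟨fun x hx g => by
    have := Subgroup.mem_center_iff.1 (hKc (hXK hx)) g
    rw [this, mul_inv_cancel_right]
    exact hx⟩
  refine ⟨X, le_antisymm hXK ?_⟩
  set π := QuotientGroup.mk' K' with hπ
  have hcen : (⊤ : Subgroup G).lowerCentralSeries m ≤ (Subgroup.center (G ⧸ K')).comap π := by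
    have hgen : ∀ y ∈ s, r y ∈ (Subgroup.center (G ⧸ K')).comap π := by
      intro y hy
      have : (⊤ : Subgroup G) ≤ (Subgroup.centralizer {π (r y)}).comap π := by
        rw [← hT, Subgroup.closure_le]
        intro g hg
        have h1 : ⁅r y, g⁆ ∈ K' := Subgroup.subset_closure (by
          simp only [hX, Finset.coe_image, Set.mem_image, Finset.mem_coe, Finset.mem_product]
          exact ⟨(y, g), ⟨hy, hg⟩, rfl⟩)
        have h2 : π ⁅r y, g⁆ = 1 := (QuotientGroup.eq_one_iff _).2 h1
        rw [map_commutatorElement, commutatorElement_eq_one_iff_mul_comm] at h2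
        simp only [Subgroup.coe_comap, Set.mem_preimage, SetLike.mem_coe,
          Subgroup.mem_centralizer_singleton_iff]
        exact h2.symm
      rw [Subgroup.mem_comap, Subgroup.mem_center_iff]
      intro g
      obtain ⟨g, rfl⟩ := QuotientGroup.mk'_surjective K' g
      have h3 := this (Subgroup.mem_top g)
      rw [Subgroup.mem_comap, Subgroup.mem_centralizer_singleton_iff] at h3
      exact h3
    intro x hx
    have h4 : QuotientGroup.mk' K x ∈ (Subgroup.closure (r '' (s : Set _))).map
        (QuotientGroup.mk' K) := by
      rw [MonoidHom.map_closure, ← Set.image_comp]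
      have : (QuotientGroup.mk' K ∘ r) '' (s : Set (G ⧸ K)) = s := by
        ext y
        constructor
        · rintro ⟨z, hz, rfl⟩
          change QuotientGroup.mk' K (r z) ∈ _
          rwa [hfr z hz]
        · exact fun hy => ⟨y, hy, hfr y hy⟩
      rw [this, hs]
      exact Subgroup.mem_map_of_mem _ hx
    obtain ⟨y, hy, hxy⟩ := h4
    have hy' : y ∈ (Subgroup.center (G ⧸ K')).comap π := by
      refine (Subgroup.closure_le _).2 ?_ hy
      rintro _ ⟨z, hz, rfl⟩
      exact hgen z hz
    rw [← mul_inv_cancel_left y x]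
    refine mul_mem hy' ?_
    have h5 : y⁻¹ * x ∈ K := QuotientGroup.eq.1 hxy
    rw [Subgroup.mem_comap, Subgroup.mem_center_iff]
    intro g
    obtain ⟨g, rfl⟩ := QuotientGroup.mk'_surjective K' g
    have := Subgroup.mem_center_iff.1 (hKc h5) g
    change π g * π _ = π _ * π g
    rw [← map_mul, this, map_mul]
  rw [hK, Subgroup.lowerCentralSeries_succ, Subgroup.commutator_le]
  intro x hx g _
  have h6 := Subgroup.mem_center_iff.1 (hcen hx) (π g)
  rw [← QuotientGroup.eq_one_iff]
  change π ⁅x, g⁆ = 1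
  rw [map_commutatorElement, commutatorElement_eq_one_iff_mul_comm, h6]

theorem fg_subgroup_of_lcs_eq_bot (n : ℕ) : ∀ (G : Type*) [Group G] [Group.FG G],
    (⊤ : Subgroup G).lowerCentralSeries n = ⊥ → ∀ H : Subgroup G, H.FG := by
  induction n with
  | zero =>
    intro G _ _ h H
    rw [Subgroup.lowerCentralSeries_zero] at h
    have : H = ⊥ := by rw [eq_bot_iff, ← h]; exact le_top
    rw [this]
    exact Subgroup.FG.bot
  | succ n ih =>
    intro G _ _ h H
    set K := (⊤ : Subgroup G).lowerCentralSeries n with hK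
    have ihQ := ih (G ⧸ K) (fg_map_lcs_quotient K hK)
    have hKfg : K.FG := by
      cases n with
      | zero => rw [hK, Subgroup.lowerCentralSeries_zero]; exact Group.fg_def.1 inferInstance
      | succ m => exact fg_last_lcs h (ihQ _)
    refine subgroup_fg_of_map_of_inf_ker (QuotientGroup.mk' K) (ihQ _) ?_
    rw [QuotientGroup.ker_mk']
    exact fg_of_le_of_le_center (lcs_le_center h) hKfg inf_le_right

/-- Subgroups of finitely generated nilpotent groups are finitely generated. -/
theorem fg_subgroup {G : Type*} [Group G] [Group.FG G] [Group.IsNilpotent G] (H : Subgroup G) :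
    H.FG := by
  obtain ⟨n, hn⟩ := (Subgroup.nilpotent_iff_lowerCentralSeries (G := G)).1 inferInstance
  exact fg_subgroup_of_lcs_eq_bot n G hn H

instance fg_coe_subgroup {G : Type*} [Group G] [Group.FG G] [Group.IsNilpotent G]
    (H : Subgroup G) : Group.FG H :=
  (Group.fg_iff_subgroup_fg H).2 (fg_subgroup H)

/-! ### Indices in extensions -/

/-- Every left coset of `H` in `H ⊔ N` has a representative in `N`. -/
theorem relIndex_sup_ne_zero {G : Type*} [Group G] {H N : Subgroup G} [N.Normal]
    (h : H.relIndex N ≠ 0) : H.relIndex (H ⊔ N) ≠ 0 := by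
  have hle : N ≤ H ⊔ N := le_sup_right
  have : Finite (N ⧸ H.subgroupOf N) := Nat.finite_of_card_ne_zero h
  have hf : Function.Surjective (Quotient.map' (s₁ := QuotientGroup.leftRel (H.subgroupOf N))
      (s₂ := QuotientGroup.leftRel (H.subgroupOf (H ⊔ N)))
      (fun n : N => (⟨n, hle n.2⟩ : (H ⊔ N : Subgroup G))) (fun a b hab => by
        rw [QuotientGroup.leftRel_apply, Subgroup.mem_subgroupOf] at hab ⊢
        exact hab)) := by
    intro q
    induction q using Quotient.inductionOn' with | _ p => ?_
    obtain ⟨p, hp⟩ := p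
    rw [sup_comm] at hp
    obtain ⟨n, hn, k, hk, rfl⟩ := Subgroup.mem_sup_of_normal_left.1 hp
    refine ⟨Quotient.mk'' ⟨n, hn⟩, ?_⟩
    rw [Quotient.map'_mk'', Quotient.eq'', QuotientGroup.leftRel_apply, Subgroup.mem_subgroupOf]
    simpa using hk
  have := Finite.of_surjective _ hf
  exact Subgroup.index_ne_zero_of_finite (H := H.subgroupOf (H ⊔ N))

/-- Insert `H' (H ∩ ker f)` between `H'` and `H`: the upper index is that of the images, and the
lower one is controlled by the kernel part. -/
theorem relIndex_ne_zero_of_map_of_ker {G Q : Type*} [Group G] [Group Q] (f : G →* Q)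
    {H' H : Subgroup G} (hle : H' ≤ H) (h1 : (H'.map f).relIndex (H.map f) ≠ 0)
    (h2 : H'.relIndex (H ⊓ f.ker) ≠ 0) : H'.relIndex H ≠ 0 := by
  have e : (H'.subgroupOf H) ⊔ (f.ker.subgroupOf H) = ((H'.map f).comap f).subgroupOf H := by
    rw [Subgroup.comap_map_eq]
    apply le_antisymm
    · exact sup_le (Subgroup.comap_mono le_sup_left) (Subgroup.comap_mono le_sup_right)
    · rintro ⟨x, hx⟩ hx'
      rw [Subgroup.mem_subgroupOf] at hx'
      obtain ⟨y, hy, z, hz, rfl⟩ := Subgroup.mem_sup_of_normal_right.1 hx'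
      have hz' : z ∈ H := (Subgroup.mul_mem_cancel_left H (hle hy)).1 hx
      exact Subgroup.mem_sup_of_normal_right.2 ⟨⟨y, hle hy⟩, by simpa [Subgroup.mem_subgroupOf],
        ⟨z, hz'⟩, by simpa [Subgroup.mem_subgroupOf], rfl⟩
  have h3 : (H'.subgroupOf H).relIndex (f.ker.subgroupOf H) ≠ 0 := by
    rw [Subgroup.subgroupOf, Subgroup.relIndex_comap, Subgroup.subgroupOf_map_subtype, inf_comm]
    exact h2
  have h4 := relIndex_sup_ne_zero h3
  rw [e] at h4
  have h5 : (((H'.map f).comap f).subgroupOf H).index ≠ 0 := by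
    change ((H'.map f).comap f).relIndex H ≠ 0
    rwa [Subgroup.relIndex_comap]
  have h6 : H'.subgroupOf H ≤ ((H'.map f).comap f).subgroupOf H :=
    Subgroup.comap_mono (Subgroup.le_comap_map f H')
  change (H'.subgroupOf H).index ≠ 0
  rw [← Subgroup.relIndex_mul_index h6]
  exact mul_ne_zero h4 h5

/-! ### Homomorphisms onto the integers -/

theorem exists_surjective_int_of_infinite (A : Type*) [CommGroup A] [Group.FG A] [Infinite A] :
    ∃ φ : A →* Multiplicative ℤ, Function.Surjective φ := by
  have : AddGroup.FG (Additive A) := GroupFG.iff_add_fg.1 inferInstance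
  obtain ⟨n, ι, _, p, hp, e, ⟨E⟩⟩ := AddCommGroup.equiv_free_prod_directSum_zmod (Additive A)
  cases n with
  | zero =>
    exfalso
    have : ∀ i, NeZero (p i ^ e i) := fun i => ⟨pow_ne_zero _ (hp i).ne_zero⟩
    classical
    have : Finite (DirectSum ι fun i => ZMod (p i ^ e i)) :=
      Finite.of_equiv _ (DirectSum.addEquivProd _).symm.toEquiv
    have := Finite.of_equiv _ E.symm.toEquiv
    exact not_finite (Additive A)
  | succ n =>
    refine ⟨AddMonoidHom.toMultiplicativeRight ((Finsupp.applyAddHom (0 : Fin (n + 1))).comp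
      ((AddMonoidHom.fst _ _).comp E.toAddMonoidHom)), fun z => ?_⟩
    refine ⟨(E.symm (Finsupp.single 0 z.toAdd, 0)).toMul, ?_⟩
    apply Multiplicative.toAdd.injective
    simp [AddMonoidHom.toMultiplicativeRight]

theorem finite_of_pow_mem {K : Type*} [CommGroup K] [Group.FG K] (P : Subgroup K) {q : ℕ}
    (hq : 0 < q) (h : ∀ x : K, x ^ q ∈ P) : P.index ≠ 0 := by
  have : IsMulTorsion (K ⧸ P) := by
    intro x
    obtain ⟨x, rfl⟩ := QuotientGroup.mk_surjective x
    rw [isOfFinOrder_iff_pow_eq_one]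
    exact ⟨q, hq, by rw [← QuotientGroup.mk_pow, QuotientGroup.eq_one_iff]; exact h x⟩
  have := CommGroup.finite_of_fg_isMulTorsion (K ⧸ P) this
  exact Subgroup.index_ne_zero_of_finite

theorem pow_mul_eq_of_central {G : Type*} [Group G] {x g c : G} (hc : c ∈ Subgroup.center G)
    (h : x * g = c * (g * x)) (a : ℕ) : x ^ a * g = c ^ a * (g * x ^ a) := by
  induction a with
  | zero => simp
  | succ a ih =>
    have h1 := Subgroup.mem_center_iff.1 (pow_mem hc a) x
    rw [pow_succ' x, mul_assoc, ih, ← mul_assoc, h1, mul_assoc, ← mul_assoc x g, h, pow_succ c]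
    simp only [mul_assoc]

theorem commutator_pow_pow {G : Type*} [Group G] {x g : G} (hc : ⁅x, g⁆ ∈ Subgroup.center G)
    (a b : ℕ) : ⁅x ^ a, g ^ b⁆ = ⁅x, g⁆ ^ (a * b) := by
  have h1 : x * g = ⁅x, g⁆ * (g * x) := by simp [commutatorElement_def]
  have h2 := pow_mul_eq_of_central hc h1 a
  have h3 : g * x ^ a = (⁅x, g⁆ ^ a)⁻¹ * (x ^ a * g) := by rw [h2, inv_mul_cancel_left]
  have h4 := pow_mul_eq_of_central (inv_mem (pow_mem hc a)) h3 b
  rw [commutatorElement_def, mul_assoc, ← mul_inv_rev, h4, inv_pow, ← pow_mul, mul_inv_rev,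
    inv_inv, mul_inv_cancel_left]

/-- Induction on the class modulo the last term `K`, which is central. Once `H K` has finite index,
suitable powers of all elements lie in `H K`; commutators do not see the `K` part, and bilinearity
puts a fixed power of each element of `K` in `H`. As `K` is finitely generated abelian, `H ∩ K` has
finite index in it. -/
theorem index_ne_zero_of_sup_commutator (n : ℕ) : ∀ (G : Type*) [Group G] [Group.FG G],
    (⊤ : Subgroup G).lowerCentralSeries n = ⊥ → ∀ H : Subgroup G,
      (H ⊔ commutator G).index ≠ 0 → H.index ≠ 0 := by
  induction n with
  | zero =>
    intro G _ _ h H _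
    rw [Subgroup.lowerCentralSeries_zero] at h
    have : H = ⊤ := by rw [eq_top_iff, h]; exact bot_le
    simp [this]
  | succ n ih =>
    intro G _ _ h H hH
    set K := (⊤ : Subgroup G).lowerCentralSeries n with hK
    have hKc : K ≤ Subgroup.center G := lcs_le_center h
    set f := QuotientGroup.mk' K with hf
    have hfs : Function.Surjective f := QuotientGroup.mk'_surjective K
    have h1 : (H.map f).index ≠ 0 := by
      refine ih (G ⧸ K) (fg_map_lcs_quotient K hK) _ ?_
      have : H.map f ⊔ commutator (G ⧸ K) = (H ⊔ commutator G).map f := by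
        rw [Subgroup.map_sup, commutator_def G, Subgroup.map_commutator,
          Subgroup.map_top_of_surjective f hfs, commutator_def]
      rw [this]
      exact ne_zero_of_dvd_ne_zero hH (Subgroup.index_map_dvd _ hfs)
    rw [← Subgroup.relIndex_top_right]
    refine relIndex_ne_zero_of_map_of_ker f le_top ?_ ?_
    · rwa [Subgroup.map_top_of_surjective f hfs, Subgroup.relIndex_top_right]
    rw [top_inf_eq, hf, QuotientGroup.ker_mk']
    cases n with
    | zero =>
      rw [← Subgroup.top_lowerCentralSeries_one, h, sup_bot_eq] at hH
      rwa [hK, Subgroup.lowerCentralSeries_zero, Subgroup.relIndex_top_right]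
    | succ m =>
      have hP : (H ⊔ K).index ≠ 0 := by
        have := Subgroup.index_comap_of_surjective (H.map f) hfs
        rw [Subgroup.comap_map_eq, hf, QuotientGroup.ker_mk'] at this
        rwa [this]
      -- The factorial is needed because `H ⊔ K` need not be normal: some power up to the index lies
      -- in it, but which one depends on the element.
      set q := (H ⊔ K).index.factorial with hq
      have hpow : ∀ x, x ^ q ∈ H ⊔ K := fun x =>
        Subgroup.pow_mem_of_index_ne_zero_of_dvd hP x fun m h1 h2 => Nat.dvd_factorial h1 h2
      have hgen : ∀ x ∈ (⊤ : Subgroup G).lowerCentralSeries m, ∀ g : G, ⁅x, g⁆ ^ (q * q) ∈ H := by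
        intro x hx g
        rw [← commutator_pow_pow (hKc (Subgroup.commutator_mem_commutator hx (Subgroup.mem_top g)))]
        obtain ⟨a, ha, k, hk, hx'⟩ := Subgroup.mem_sup_of_normal_right.1 (hpow x)
        obtain ⟨b, hb, l, hl, hg'⟩ := Subgroup.mem_sup_of_normal_right.1 (hpow g)
        rw [← hx', ← hg']
        have hk' := Subgroup.mem_center_iff.1 (hKc hk)
        have hl' := Subgroup.mem_center_iff.1 (hKc hl)
        have : ⁅a * k, b * l⁆ = ⁅a, b⁆ := by
          have e : (a * k) * (b * l) = (a * b) * (k * l) := by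
            rw [mul_assoc, ← mul_assoc k, ← hk' b, mul_assoc, mul_assoc]
          have e' : (b * l) * (a * k) = (b * a) * (k * l) := by
            rw [mul_assoc, ← mul_assoc l, ← hl' a, mul_assoc, hk' l, mul_assoc]
          rw [commutatorElement_def, commutatorElement_def, mul_assoc, ← mul_inv_rev, e, e']
          group
        rw [this]
        exact H.mul_mem (H.mul_mem (H.mul_mem ha hb) (H.inv_mem ha)) (H.inv_mem hb)
      have hall : ∀ k ∈ K, k ^ (q * q) ∈ H := by
        intro k hk
        have hk2 := hk
        rw [hK, Subgroup.mem_lowerCentralSeries_succ_iff] at hk2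
        induction hk2 using Subgroup.closure_induction with
        | mem x hx => obtain ⟨y, hy, g, -, rfl⟩ := hx; exact hgen y hy g
        | one => simp
        | mul x y hx hy h1 h2 =>
          have hx' : x ∈ K := hx
          have : Commute x y := (Subgroup.mem_center_iff.1 (hKc hx') y).symm
          rw [this.mul_pow]
          exact mul_mem (h1 hx) (h2 hy)
        | inv x hx h1 => rw [inv_pow]; exact inv_mem (h1 hx)
      let _ := commGroupOfLeCenter hKc
      have : Group.FG K := (Group.fg_iff_subgroup_fg K).2 (fg_subgroup_of_lcs_eq_bot _ G h K)
      have hq0 : 0 < q * q := by positivity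
      exact finite_of_pow_mem (H.subgroupOf K) hq0 fun x => hall x x.2

/-- A subgroup of infinite index in a finitely generated nilpotent group lies in the kernel of a
surjection onto `ℤ`. -/
theorem exists_surjective_int_of_index_eq_zero {G : Type*} [Group G] [Group.FG G]
    [Group.IsNilpotent G] (H : Subgroup G) (hH : H.index = 0) :
    ∃ φ : G →* Multiplicative ℤ, Function.Surjective φ ∧ H ≤ φ.ker := by
  obtain ⟨n, hn⟩ := (Subgroup.nilpotent_iff_lowerCentralSeries (G := G)).1 inferInstance
  have h1 : (H ⊔ commutator G).index = 0 := by
    by_contra h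
    exact index_ne_zero_of_sup_commutator n G hn H h hH
  set f : G →* Abelianization G := Abelianization.of
  have hf : Function.Surjective f := QuotientGroup.mk'_surjective _
  set B := H.map f
  set g : G →* Abelianization G ⧸ B := (QuotientGroup.mk' B).comp f with hg
  have hgs : Function.Surjective g := (QuotientGroup.mk'_surjective B).comp hf
  have h2 : B.index = 0 := by
    rw [← Subgroup.index_comap_of_surjective B hf, Subgroup.comap_map_eq, Abelianization.ker_of, h1]
  have : Group.FG (Abelianization G ⧸ B) := Group.fg_of_surjective hgs
  have : Infinite (Abelianization G ⧸ B) := by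
    by_contra h
    rw [not_infinite_iff_finite] at h
    exact Subgroup.index_ne_zero_of_finite h2
  obtain ⟨φ, hφ⟩ := exists_surjective_int_of_infinite (Abelianization G ⧸ B)
  refine ⟨φ.comp g, hφ.comp hgs, fun x hx => ?_⟩
  have : g x = 1 := (QuotientGroup.eq_one_iff (N := B) _).2 (Subgroup.mem_map_of_mem f hx)
  rw [MonoidHom.mem_ker, MonoidHom.comp_apply, this, map_one]

/-- `G` has a monotone rank function on its subgroups which drops on subgroups of infinite
index. -/
def HasRank (G : Type*) [Group G] : Prop :=
  ∃ ν : Subgroup G → ℕ, Monotone ν ∧ ∀ H' H, H' ≤ H → H'.relIndex H = 0 → ν H' < ν H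

/-- The `ℤ`-rank works: equal ranks make the quotient torsion, hence finite, since it is finitely
generated. -/
theorem hasRank_of_comm (A : Type*) [CommGroup A] [Group.FG A] : HasRank A := by
  have : AddGroup.FG (Additive A) := GroupFG.iff_add_fg.1 inferInstance
  have : Module.Finite ℤ (Additive A) := Module.Finite.iff_addGroup_fg.2 this
  set s : Subgroup A → Submodule ℤ (Additive A) := fun H =>
    AddSubgroup.toIntSubmodule (Subgroup.toAddSubgroup H)
  have hs : Monotone s := fun H' H h => h
  refine ⟨fun H => Module.finrank ℤ (s H), fun H' H h => Submodule.finrank_mono (hs h), ?_⟩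
  intro H' H hle h0
  refine lt_of_le_of_ne (Submodule.finrank_mono (hs hle)) fun heq => ?_
  have h1 := Submodule.finrank_quotient_add_finrank ((s H').submoduleOf (s H))
  have h2 : Module.finrank ℤ ((s H').submoduleOf (s H)) = Module.finrank ℤ (s H') :=
    (Submodule.submoduleOfEquivOfLe (hs hle)).finrank_eq
  simp only at heq
  have h3 : Module.finrank ℤ (s H ⧸ (s H').submoduleOf (s H)) = 0 := by omega
  rw [Module.finrank_eq_zero_iff_isTorsion] at h3
  have h4 : Finite (s H ⧸ (s H').submoduleOf (s H)) := by
    have := Module.finite_of_fg_torsion _ h3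
    exact this
  have h5 : IsMulTorsion (H ⧸ H'.subgroupOf H) := by
    intro x
    obtain ⟨x, rfl⟩ := QuotientGroup.mk_surjective x
    obtain ⟨⟨a, ha⟩, hx⟩ := @h3 (Submodule.Quotient.mk (⟨Additive.ofMul x.1, x.2⟩ : s H))
    have ha0 : a ≠ 0 := nonZeroDivisors.ne_zero ha
    rw [isOfFinOrder_iff_zpow_eq_one]
    refine ⟨a, ha0, ?_⟩
    rw [Submonoid.mk_smul, ← Submodule.Quotient.mk_smul, Submodule.Quotient.mk_eq_zero] at hx
    rw [← QuotientGroup.mk_zpow, QuotientGroup.eq_one_iff]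
    exact hx
  have : Group.FG H := (Group.fg_iff_subgroup_fg H).2 (CommGroup.fg_subgroup H)
  have := CommGroup.finite_of_fg_isMulTorsion _ h5
  exact Subgroup.index_ne_zero_of_finite (H := H'.subgroupOf H) h0

theorem hasRank_of_extension {G : Type*} [Group G] (K : Subgroup G) [K.Normal] (hK : HasRank K)
    (hQ : HasRank (G ⧸ K)) : HasRank G := by
  obtain ⟨ν, hν, hν'⟩ := hK
  obtain ⟨μ, hμ, hμ'⟩ := hQ
  set f := QuotientGroup.mk' K
  have m1 : ∀ {H' H : Subgroup G}, H' ≤ H → H'.subgroupOf K ≤ H.subgroupOf K :=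
    fun h => Subgroup.comap_mono h
  have m2 : ∀ {H' H : Subgroup G}, H' ≤ H → H'.map f ≤ H.map f := fun h => Subgroup.map_mono h
  refine ⟨fun H => ν (H.subgroupOf K) + μ (H.map f),
    fun H' H h => add_le_add (hν (m1 h)) (hμ (m2 h)), fun H' H h h0 => ?_⟩
  by_cases h1 : (H'.map f).relIndex (H.map f) = 0
  · exact add_lt_add_of_le_of_lt (hν (m1 h)) (hμ' _ _ (m2 h) h1)
  · refine add_lt_add_of_lt_of_le (hν' _ _ (m1 h) ?_) (hμ (m2 h))
    rw [Subgroup.subgroupOf, Subgroup.relIndex_comap, Subgroup.subgroupOf_map_subtype]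
    by_contra h2
    refine relIndex_ne_zero_of_map_of_ker f h h1 ?_ h0
    rwa [QuotientGroup.ker_mk']

theorem hasRank_of_lcs_eq_bot (n : ℕ) : ∀ (G : Type*) [Group G] [Group.FG G],
    (⊤ : Subgroup G).lowerCentralSeries n = ⊥ → HasRank G := by
  induction n with
  | zero =>
    intro G _ _ h
    rw [Subgroup.lowerCentralSeries_zero] at h
    refine ⟨fun _ => 0, fun _ _ _ => le_rfl, fun H' H _ h0 => ?_⟩
    have : H = ⊥ := by rw [eq_bot_iff, ← h]; exact le_top
    rw [this, Subgroup.relIndex_bot_right] at h0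
    exact absurd h0 one_ne_zero
  | succ n ih =>
    intro G _ _ h
    set K := (⊤ : Subgroup G).lowerCentralSeries n with hK
    have hKc : K ≤ Subgroup.center G := lcs_le_center h
    refine hasRank_of_extension K ?_ (ih _ (fg_map_lcs_quotient K hK))
    let _ := commGroupOfLeCenter hKc
    have : Group.FG K := (Group.fg_iff_subgroup_fg K).2 (fg_subgroup_of_lcs_eq_bot _ G h K)
    exact hasRank_of_comm K

/-- There is a chain of `r` subgroups from `G` to a finite index overgroup of `H`, each the kernel
of a surjection of the preceding one onto `ℤ`. -/
def IntChain : ℕ → ∀ (G : Type u) [Group G], Subgroup G → Prop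
  | 0, _, _, H => H.index ≠ 0
  | r + 1, G, _, H => ∃ φ : G →* Multiplicative ℤ, Function.Surjective φ ∧ H ≤ φ.ker ∧
      IntChain r φ.ker (H.subgroupOf φ.ker)

theorem index_ker_eq_zero {G : Type*} [Group G] {φ : G →* Multiplicative ℤ}
    (hφ : Function.Surjective φ) : φ.ker.index = 0 := by
  rw [Subgroup.index_ker, MonoidHom.range_eq_top.2 hφ, Nat.card_eq_zero]
  right
  exact (Subgroup.topEquiv (G := Multiplicative ℤ)).toEquiv.infinite_iff.2
    (inferInstanceAs (Infinite ℤ))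

/-- The rank bounds the length of the chain: each kernel has infinite index, so `ν` drops when
passing to it. -/
theorem exists_intChain_of_rank (b : ℕ) : ∀ (G : Type u) [Group G] [Group.FG G]
    [Group.IsNilpotent G] (ν : Subgroup G → ℕ), Monotone ν →
    (∀ H' H, H' ≤ H → H'.relIndex H = 0 → ν H' < ν H) → ν ⊤ ≤ b →
    ∀ H : Subgroup G, ∃ r, IntChain r G H := by
  induction b with
  | zero =>
    intro G _ _ _ ν _ h1 h2 H
    refine ⟨0, fun h => ?_⟩
    have := h1 H ⊤ le_top (by rwa [Subgroup.relIndex_top_right])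
    omega
  | succ b ih =>
    intro G _ _ _ ν h0 h1 h2 H
    by_cases h : H.index = 0
    · obtain ⟨φ, hφ, hle⟩ := exists_surjective_int_of_index_eq_zero H h
      obtain ⟨r, hr⟩ := ih φ.ker (fun K => ν (K.map φ.ker.subtype))
        (fun K' K hK => h0 (Subgroup.map_mono hK))
        (fun K' K hK hrel => h1 _ _ (Subgroup.map_mono hK) (by
          rwa [Subgroup.relIndex_map_map_of_injective _ _ φ.ker.subtype_injective]))
        (by
          have := h1 φ.ker ⊤ le_top (by rw [Subgroup.relIndex_top_right, index_ker_eq_zero hφ])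
          rw [← MonoidHom.range_eq_map, Subgroup.range_subtype]
          omega) (H.subgroupOf φ.ker)
      exact ⟨r + 1, φ, hφ, hle, hr⟩
    · exact ⟨0, h⟩

theorem exists_intChain {G : Type u} [Group G] [Group.FG G] [Group.IsNilpotent G]
    (H : Subgroup G) : ∃ r, IntChain r G H := by
  obtain ⟨n, hn⟩ := (Subgroup.nilpotent_iff_lowerCentralSeries (G := G)).1 inferInstance
  obtain ⟨ν, h1, h2⟩ := hasRank_of_lcs_eq_bot n G hn
  exact exists_intChain_of_rank _ G ν h1 h2 le_rfl H

/-! ### The index of the subgroup of `m`-th powers -/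

theorem map_powSub_of_surjective {G K : Type*} [Group G] [Group K] {f : G →* K}
    (hf : Function.Surjective f) (m : ℕ) : (powSub G m).map f = powSub K m := by
  refine le_antisymm (map_powSub_le f m) ?_
  rw [powSub, Subgroup.closure_le]
  rintro _ ⟨k, rfl⟩
  obtain ⟨g, rfl⟩ := hf k
  exact ⟨g ^ m, pow_mem_powSub g m, map_pow f g m⟩

/-- With `A ≅ ℤ ^ n × T` and `T` finite, the kernel of `A → (ℤ/m) ^ n × T` consists of `m`-th
powers. Keeping `T` whole costs only the constant `|T|`. -/
theorem powSub_index_le_of_comm (A : Type*) [CommGroup A] [Group.FG A] :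
    ∃ C : ℕ, ∀ m, 0 < m → (powSub A m).index ≠ 0 ∧
      (powSub A m).index ≤ C * m ^ Module.finrank ℤ (Additive A) := by
  have : AddGroup.FG (Additive A) := GroupFG.iff_add_fg.1 inferInstance
  obtain ⟨n, ι, _, p, hp, e, ⟨E⟩⟩ := AddCommGroup.equiv_free_prod_directSum_zmod (Additive A)
  have : ∀ i, NeZero (p i ^ e i) := fun i => ⟨pow_ne_zero _ (hp i).ne_zero⟩
  classical
  set T := DirectSum ι fun i => ZMod (p i ^ e i)
  have hTf : Finite T := Finite.of_equiv _ (DirectSum.addEquivProd _).symm.toEquiv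
  have hA : Module.Finite ℤ (Additive A) := Module.Finite.iff_addGroup_fg.2 inferInstance
  have hrank : n ≤ Module.finrank ℤ (Additive A) := by
    have := LinearMap.finrank_le_finrank_of_injective (R := ℤ)
      (f := (E.symm.toAddMonoidHom.comp (AddMonoidHom.inl (Fin n →₀ ℤ) T)).toIntLinearMap)
      (fun x y h => by
        have := E.symm.injective h
        exact congrArg Prod.fst this)
    simpa using this
  refine ⟨Nat.card T, fun m hm => ?_⟩
  have : NeZero m := ⟨hm.ne'⟩
  let F : Additive A →+ (Fin n → ZMod m) × T :=
    (AddMonoidHom.prodMap ((AddMonoidHom.pi fun i => (Int.castAddHom (ZMod m)).comp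
      (Pi.evalAddMonoidHom _ i)).comp (Finsupp.coeFnAddHom : (Fin n →₀ ℤ) →+ (Fin n → ℤ)))
      (AddMonoidHom.id T)).comp E.toAddMonoidHom
  let F' : A →* Multiplicative ((Fin n → ZMod m) × T) := AddMonoidHom.toMultiplicativeRight F
  have hker : F'.ker ≤ powSub A m := by
    intro a ha
    have h1 : F (Additive.ofMul a) = 0 := ha
    have h2 : ∀ i, ((E (Additive.ofMul a)).1 i : ZMod m) = 0 := fun i =>
      congrFun (congrArg Prod.fst h1) i
    have h3 : (E (Additive.ofMul a)).2 = 0 := congrArg Prod.snd h1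
    simp only [ZMod.intCast_zmod_eq_zero_iff_dvd] at h2
    choose v hv using h2
    set w : (Fin n →₀ ℤ) × T := (Finsupp.equivFunOnFinite.symm v, 0) with hw
    have h4 : E (Additive.ofMul a) = m • w := by
      refine Prod.ext ?_ ?_
      · ext i; simp [hw, hv i]
      · rw [h3, hw, Prod.smul_mk, smul_zero]
    have h5 : a = (E.symm w).toMul ^ m := by
      have : Additive.ofMul a = m • E.symm w := by
        rw [← map_nsmul, ← h4, AddEquiv.symm_apply_apply]
      exact this
    rw [h5]
    exact pow_mem_powSub _ _
  have hfin : Finite (Multiplicative ((Fin n → ZMod m) × T)) :=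
    inferInstanceAs (Finite ((Fin n → ZMod m) × T))
  have hk0 : F'.ker.index ≠ 0 := by
    rw [Subgroup.index_ker]
    exact Nat.card_pos.ne'
  have hdvd := Subgroup.index_dvd_of_le hker
  refine ⟨ne_zero_of_dvd_ne_zero hk0 hdvd, (Nat.le_of_dvd (Nat.pos_of_ne_zero hk0) hdvd).trans ?_⟩
  rw [Subgroup.index_ker]
  refine (Nat.card_le_card_of_injective _ F'.range.subtype_injective).trans ?_
  rw [Nat.card_congr Multiplicative.toAdd, Nat.card_prod, Nat.card_fun, mul_comm]
  simp only [Nat.card_eq_fintype_card, Fintype.card_fin, ZMod.card]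
  gcongr

/-- Each successive factor is a quotient of a lower central quotient modulo its `m`-th powers, so
the exponents add up to partial sums of the Hirsch length. -/
theorem powSub_index_le_of_lcs (N : Type*) [Group N] [Group.FG N] [Group.IsNilpotent N] (i : ℕ) :
    ∃ C : ℕ, ∀ m, 0 < m → ((⊤ : Subgroup N).lowerCentralSeries i ⊔ powSub N m).index ≠ 0 ∧
      ((⊤ : Subgroup N).lowerCentralSeries i ⊔ powSub N m).index ≤
        C * m ^ ∑ j ∈ Finset.range i, Module.finrank ℤ (Additive (LowerCentralQuotient N j)) := by
  induction i with
  | zero => exact ⟨1, fun m _ => by simp⟩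
  | succ i ih =>
    obtain ⟨C, hC⟩ := ih
    have hfg : Group.FG (LowerCentralQuotient N i) :=
      Group.fg_of_surjective (f := QuotientGroup.mk' _) (QuotientGroup.mk'_surjective _)
    obtain ⟨D, hD⟩ := powSub_index_le_of_comm (LowerCentralQuotient N i)
    refine ⟨D * C, fun m hm => ?_⟩
    obtain ⟨h1, h2⟩ := hC m hm
    obtain ⟨h3, h4⟩ := hD m hm
    set A := (⊤ : Subgroup N).lowerCentralSeries i with hA
    set A' := (⊤ : Subgroup N).lowerCentralSeries (i + 1) with hA'
    have hle : A' ≤ A := Subgroup.lowerCentralSeries_antitone _ (Nat.le_succ i)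
    set P := powSub N m with hP
    set f : A →* LowerCentralQuotient N i := QuotientGroup.mk' (A'.subgroupOf A) with hf
    have hfs : Function.Surjective f := QuotientGroup.mk'_surjective _
    have h5 : (powSub (LowerCentralQuotient N i) m).comap f ≤ (A' ⊔ P).subgroupOf A := by
      rw [← map_powSub_of_surjective hfs, Subgroup.comap_map_eq, hf, QuotientGroup.ker_mk']
      refine sup_le ?_ (Subgroup.comap_mono le_sup_left)
      rw [Subgroup.subgroupOf, ← Subgroup.map_le_iff_le_comap]
      exact (map_powSub_le _ _).trans le_sup_right
    have h6 : (A' ⊔ P).relIndex (A ⊔ P) = ((A' ⊔ P).subgroupOf A).index := by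
      have : A ⊔ P = A ⊔ (A' ⊔ P) := by rw [← sup_assoc, sup_eq_left.2 hle]
      rw [this, Subgroup.relIndex_sup_right]
      rfl
    have h7 := Subgroup.index_dvd_of_le h5
    rw [Subgroup.index_comap_of_surjective _ hfs] at h7
    rw [← Subgroup.relIndex_mul_index (sup_le_sup_right hle P), h6]
    refine ⟨mul_ne_zero (ne_zero_of_dvd_ne_zero h3 h7) h1, ?_⟩
    have h8 := (Nat.le_of_dvd (Nat.pos_of_ne_zero h3) h7).trans h4
    calc _ ≤ _ := Nat.mul_le_mul h8 h2
      _ = _ := by rw [Finset.sum_range_succ, pow_add]; ring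

/-- The index of the subgroup of `m`-th powers is `O(m ^ h(N))`. -/
theorem powSub_index_le (N : Type*) [Group N] [Group.FG N] [Group.IsNilpotent N] :
    ∃ C : ℕ, ∀ m, 0 < m → (powSub N m).index ≠ 0 ∧
      (powSub N m).index ≤ C * m ^ hirschLength N := by
  obtain ⟨C, hC⟩ := powSub_index_le_of_lcs N (Group.nilpotencyClass N)
  have h : (⊤ : Subgroup N).lowerCentralSeries (Group.nilpotencyClass N) = ⊥ :=
    Subgroup.lowerCentralSeries_nilpotencyClass
  simp only [h, bot_sup_eq] at hC
  exact ⟨C, hC⟩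

/-! ### Polynomially bounded functions -/

/-- `f` is bounded by a polynomial. -/
def PolyBdd (f : ℕ → ℕ) : Prop := ∃ C k : ℕ, ∀ n, f n ≤ C * (n + 1) ^ k

theorem PolyBdd.of_le {f g : ℕ → ℕ} (hg : PolyBdd g) (h : ∀ n, f n ≤ g n) : PolyBdd f := by
  obtain ⟨C, k, hC⟩ := hg
  exact ⟨C, k, fun n => (h n).trans (hC n)⟩

theorem polyBdd_const (c : ℕ) : PolyBdd fun _ => c := ⟨c, 0, by simp⟩

theorem polyBdd_id : PolyBdd fun n => n := ⟨1, 1, by simp⟩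

theorem PolyBdd.add {f g : ℕ → ℕ} (hf : PolyBdd f) (hg : PolyBdd g) :
    PolyBdd fun n => f n + g n := by
  obtain ⟨C, k, hC⟩ := hf
  obtain ⟨D, l, hD⟩ := hg
  refine ⟨C + D, k + l, fun n => ?_⟩
  have h1 : (n + 1) ^ k ≤ (n + 1) ^ (k + l) := Nat.pow_le_pow_right (by omega) (by omega)
  have h2 : (n + 1) ^ l ≤ (n + 1) ^ (k + l) := Nat.pow_le_pow_right (by omega) (by omega)
  rw [add_mul]
  exact add_le_add ((hC n).trans (Nat.mul_le_mul_left _ h1))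
    ((hD n).trans (Nat.mul_le_mul_left _ h2))

theorem PolyBdd.mul {f g : ℕ → ℕ} (hf : PolyBdd f) (hg : PolyBdd g) :
    PolyBdd fun n => f n * g n := by
  obtain ⟨C, k, hC⟩ := hf
  obtain ⟨D, l, hD⟩ := hg
  refine ⟨C * D, k + l, fun n => (Nat.mul_le_mul (hC n) (hD n)).trans_eq ?_⟩
  ring

theorem PolyBdd.pow {f : ℕ → ℕ} (hf : PolyBdd f) (j : ℕ) : PolyBdd fun n => f n ^ j := by
  induction j with
  | zero => simpa using polyBdd_const 1
  | succ j ih => simpa only [pow_succ] using ih.mul hf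

theorem PolyBdd.comp {f g : ℕ → ℕ} (hf : PolyBdd f) (hg : PolyBdd g) :
    PolyBdd fun n => f (g n) := by
  obtain ⟨C, k, hC⟩ := hf
  exact ((polyBdd_const C).mul ((hg.add (polyBdd_const 1)).pow k)).of_le fun n => hC (g n)

/-- A monotone version of a polynomial bound. -/
theorem PolyBdd.exists_monotone {f : ℕ → ℕ} (hf : PolyBdd f) :
    ∃ p, Monotone p ∧ PolyBdd p ∧ ∀ n, f n ≤ p n := by
  obtain ⟨C, k, hC⟩ := hf
  exact ⟨fun n => C * (n + 1) ^ k, fun a b h => by dsimp only; gcongr, ⟨C, k, fun _ => le_rfl⟩, hC⟩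

/-! ### Powers and subgroups -/

theorem torsionFree_subgroup {G : Type*} [Group G] (hG : ∀ g : G, g ≠ 1 → ¬ IsOfFinOrder g)
    (H : Subgroup G) : ∀ g : H, g ≠ 1 → ¬ IsOfFinOrder g := fun g hg h =>
  hG g (by simpa using hg) (H.subtype.isOfFinOrder h)

theorem subsingleton_of_index_bot {G : Type*} [Group G]
    (hG : ∀ g : G, g ≠ 1 → ¬ IsOfFinOrder g) (h : (⊥ : Subgroup G).index ≠ 0) :
    Subsingleton G := by
  rw [Subgroup.index_bot] at h
  have : Finite G := Nat.finite_of_card_ne_zero h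
  refine ⟨fun a b => ?_⟩
  have : ∀ g : G, g = 1 := fun g => by
    by_contra hg
    exact hG g hg (isOfFinOrder_of_finite g)
  rw [this a, this b]

/-- Says that the power topology of `N` induces that of `K`, with linear loss in the modulus. The
target `N` stays fixed while `K` shrinks along the chain, so only the extension property of `ι` has
to be passed on. -/
theorem exists_comap_powSub_le (r : ℕ) : ∀ (K : Type u) [Group K] [Group.IsNilpotent K]
    (_ : ∀ g : K, g ≠ 1 → ¬ IsOfFinOrder g) (_ : IntChain r K ⊥) (N : Type u) [Group N]
    (ι : K →* N) (_ : ExtendsPoly ι),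
    ∃ D, 0 < D ∧ ∀ m, (powSub N (D * m)).comap ι ≤ powSub K m := by
  induction r with
  | zero =>
    intro K _ _ hK h N _ ι _
    have := subsingleton_of_index_bot hK h
    refine ⟨1, one_pos, fun m x _ => ?_⟩
    rw [Subsingleton.elim x 1]
    exact one_mem _
  | succ r ih =>
    intro K _ _ hK h N _ ι hι
    obtain ⟨φ, hφ, -, hr⟩ := h
    rw [Subgroup.bot_subgroupOf] at hr
    obtain ⟨D, hD, hD'⟩ := ih φ.ker (torsionFree_subgroup hK _) hr N (ι.comp φ.ker.subtype)
      (hι.comp (extendsPoly_ker hφ))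
    obtain ⟨l, F, hF, hFφ⟩ := hι 2 _ (isPoly_hom φ)
    obtain ⟨t, ht⟩ := hφ (Multiplicative.ofAdd 1)
    refine ⟨l.factorial * D, by positivity, fun m z hz => ?_⟩
    rw [Subgroup.mem_comap, mul_assoc] at hz
    have h1 := hF.dvd_mul_sub hz 1
    rw [mul_one, ← map_one ι, hFφ, hFφ, map_one, toAdd_one, sub_zero] at h1
    obtain ⟨a, ha⟩ := h1
    -- The extension of `φ` to `N` shows that `φ z` is a multiple of `D m`, so `w` has the same
    -- image under `φ` as `z` and is a power with respect to both moduli.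
    set w : K := t ^ (a * (D * m : ℕ)) with hw
    have hwφ : (φ w).toAdd = (φ z).toAdd := by rw [hw, toAdd_map_zpow ht, ha]; ring
    have hz1 : w⁻¹ * z ∈ φ.ker := by
      rw [MonoidHom.mem_ker, map_mul, map_inv, inv_mul_eq_one]
      exact Multiplicative.toAdd.injective hwφ
    have hw1 : ι w ∈ powSub N (D * m) := by
      rw [hw, zpow_mul, zpow_natCast, map_pow]
      exact pow_mem_powSub _ _
    have hw2 : w ∈ powSub K m := by
      rw [hw, Nat.cast_mul, ← mul_assoc, zpow_mul, zpow_natCast]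
      exact pow_mem_powSub _ _
    have h2 : (⟨w⁻¹ * z, hz1⟩ : φ.ker) ∈ powSub φ.ker m := by
      refine hD' m ?_
      rw [Subgroup.mem_comap, MonoidHom.comp_apply, Subgroup.subtype_apply, map_mul, map_inv]
      exact mul_mem (inv_mem hw1) (powSub_le_of_dvd (Dvd.intro_left _ rfl) hz)
    have h3 : w⁻¹ * z ∈ powSub K m := map_powSub_le φ.ker.subtype m (Subgroup.mem_map_of_mem _ h2)
    rw [← mul_inv_cancel_left w z]
    exact mul_mem hw2 h3

/-! ### Distortion -/

section Distortion

variable {G : Type*} [Group G]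

/-- Descending induction along the lower central series: conjugating once more by `t` multiplies by
a conjugate of a commutator one step deeper, so the degree of the bound rises by one per step. -/
theorem conj_growth_nat {L : Subgroup G} [L.Normal] {T : Finset L}
    (hT : Subgroup.closure (T : Set L) = ⊤) (t : G) {c : ℕ}
    (hc : (⊤ : Subgroup G).lowerCentralSeries c = ⊥) (d : ℕ) : ∀ (i : ℕ) (_ : c ≤ i + d) (u : L)
    (_ : (u : G) ∈ (⊤ : Subgroup G).lowerCentralSeries i),
    ∃ C k : ℕ, ∀ a : ℕ, wordLength T (MulAut.conjNormal (t ^ a) u) ≤ C * (a + 1) ^ k := by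
  induction d with
  | zero =>
    intro i hi u hu
    have h := Subgroup.lowerCentralSeries_antitone ⊤ hi hu
    rw [add_zero] at hi
    have h1 := Subgroup.lowerCentralSeries_antitone (⊤ : Subgroup G) hi hu
    rw [hc, Subgroup.mem_bot] at h1
    have : u = 1 := by ext; exact h1
    exact ⟨0, 0, fun a => by simp [this]⟩
  | succ d ih =>
    intro i hi u hu
    have h1 : ((u⁻¹ * MulAut.conjNormal t u : L) : G) ∈
        (⊤ : Subgroup G).lowerCentralSeries (i + 1) := by
      have := Subgroup.commutator_mem_commutator (inv_mem hu) (Subgroup.mem_top t)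
      rw [Subgroup.lowerCentralSeries_succ]
      convert this using 1
      simp [commutatorElement_def, mul_assoc]
    obtain ⟨C, k, hC⟩ := ih (i + 1) (by omega) _ h1
    refine ⟨wordLength T u + C, k + 1, fun a => ?_⟩
    have key : ∀ a : ℕ, wordLength T (MulAut.conjNormal (t ^ a) u) ≤
        wordLength T u + a * (C * (a + 1) ^ k) := by
      intro a
      induction a with
      | zero => simp
      | succ a iha =>
        have e : MulAut.conjNormal (t ^ (a + 1)) u = MulAut.conjNormal (t ^ a) u *
            MulAut.conjNormal (t ^ a) (u⁻¹ * MulAut.conjNormal t u) := by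
          rw [← map_mul, mul_inv_cancel_left, pow_succ, map_mul, MulAut.mul_apply]
        rw [e]
        have h2 : a * (C * (a + 1) ^ k) ≤ a * (C * (a + 1 + 1) ^ k) := by gcongr; omega
        have h3 : C * (a + 1) ^ k ≤ C * (a + 1 + 1) ^ k := by gcongr; omega
        have h4 := hC a
        have h5 := wordLength_mul_le hT (MulAut.conjNormal (t ^ a) u)
          (MulAut.conjNormal (t ^ a) (u⁻¹ * MulAut.conjNormal t u))
        rw [add_mul a, one_mul]
        omega
    refine (key a).trans ?_
    have h6 : 1 ≤ (a + 1) ^ (k + 1) := Nat.one_le_pow _ _ (by omega)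
    have h7 := Nat.mul_le_mul_left (wordLength T u) h6
    have h8 : a * (C * (a + 1) ^ k) ≤ C * (a + 1) ^ (k + 1) := by
      calc a * (C * (a + 1) ^ k) ≤ (a + 1) * (C * (a + 1) ^ k) := by gcongr; omega
        _ = _ := by ring
    rw [add_mul]
    omega

theorem conj_growth [Group.IsNilpotent G] {L : Subgroup G} [L.Normal] {T : Finset L}
    (hT : Subgroup.closure (T : Set L) = ⊤) (t : G) (u : L) :
    ∃ C k : ℕ, ∀ a : ℤ, wordLength T (MulAut.conjNormal (t ^ a) u) ≤ C * (a.natAbs + 1) ^ k := by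
  obtain ⟨c, hc⟩ := (Subgroup.nilpotent_iff_lowerCentralSeries (G := G)).1 inferInstance
  obtain ⟨C, k, h1⟩ := conj_growth_nat hT t hc c 0 (by omega) u (by simp)
  obtain ⟨D, l, h2⟩ := conj_growth_nat hT t⁻¹ hc c 0 (by omega) u (by simp)
  refine ⟨C + D, k + l, fun a => ?_⟩
  have h3 : (a.natAbs + 1) ^ k ≤ (a.natAbs + 1) ^ (k + l) :=
    Nat.pow_le_pow_right (by omega) (by omega)
  have h4 : (a.natAbs + 1) ^ l ≤ (a.natAbs + 1) ^ (k + l) :=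
    Nat.pow_le_pow_right (by omega) (by omega)
  rcases Int.natAbs_eq a with h | h
  · have : t ^ a = t ^ a.natAbs := by conv_lhs => rw [h, zpow_natCast]
    rw [this]
    exact (h1 _).trans (Nat.mul_le_mul (by omega) h3)
  · have : t ^ a = t⁻¹ ^ a.natAbs := by conv_lhs => rw [h, zpow_neg, zpow_natCast, ← inv_pow]
    rw [this]
    exact (h2 _).trans (Nat.mul_le_mul (by omega) h4)

/-- The kernel of a homomorphism onto `ℤ` is at most polynomially distorted in a finitely generated
nilpotent group. -/
theorem ker_distortion [Group.IsNilpotent G] {φ : G →* Multiplicative ℤ} {t : G}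
    (ht : φ t = Multiplicative.ofAdd 1) {S : Finset G}
    (hS : Subgroup.closure (S : Set G) = ⊤) {T : Finset φ.ker}
    (hT : Subgroup.closure (T : Set φ.ker) = ⊤) :
    ∃ p : ℕ → ℕ, PolyBdd p ∧ ∀ n (x : φ.ker), wordLength S (x : G) ≤ n → wordLength T x ≤ p n := by
  have hmem : ∀ x : G, t ^ (-(φ x).toAdd) * x ∈ φ.ker := fun x => by
    rw [MonoidHom.mem_ker, map_mul]
    apply Multiplicative.toAdd.injective
    rw [toAdd_mul, toAdd_map_zpow ht]
    simp
  set π : G → φ.ker := fun x => ⟨t ^ (-(φ x).toAdd) * x, hmem x⟩ with hπ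
  choose C k hCk using fun s => conj_growth hT t (π s)
  obtain ⟨C', hC'⟩ := exists_bound_letters S C
  obtain ⟨k', hk'⟩ := exists_bound_letters S k
  obtain ⟨B, hB⟩ := (isPoly_hom φ).growth hS
  set q : ℕ → ℕ := fun n => C' * (B * (n + 1) ^ 2 + 1) ^ k' with hq
  have hqm : Monotone q := fun a b h => by simp only [hq]; gcongr
  have hqp : PolyBdd q := (polyBdd_const C').mul
    ((((polyBdd_const B).mul ((polyBdd_id.add (polyBdd_const 1)).pow 2)).add
      (polyBdd_const 1)).pow k')
  have key : ∀ n x, wordLength S x ≤ n → wordLength T (π x) ≤ n * q n := by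
    intro n
    induction n with
    | zero =>
      intro x hx
      rw [eq_one_of_wordLength_eq_zero hS (Nat.le_zero.1 hx)]
      have : π 1 = 1 := by ext; simp [hπ]
      simp [this]
    | succ n ih =>
      intro x hx
      rcases eq_or_ne x 1 with rfl | h1
      · have : π 1 = 1 := by ext; simp [hπ]
        simp [this]
      obtain ⟨s, y, hs, hy, rfl⟩ := exists_letter_mul hS hx h1
      -- Each letter contributes one conjugate by a power of `t` whose exponent is polynomially
      -- bounded, so `conj_growth` applies uniformly.
      have e : π (s * y) = MulAut.conjNormal (t ^ (-(φ y).toAdd)) (π s) * π y := by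
        ext
        simp only [hπ, Subgroup.coe_mul, MulAut.conjNormal_apply, map_mul, toAdd_mul]
        group
      have h2 : wordLength T (MulAut.conjNormal (t ^ (-(φ y).toAdd)) (π s)) ≤ q n := by
        refine (hCk s _).trans ?_
        rw [Int.natAbs_neg]
        have h3 : (φ y).toAdd.natAbs + 1 ≤ B * (n + 1) ^ 2 + 1 := by
          refine Nat.succ_le_succ ((hB y).trans ?_)
          gcongr
        calc C s * ((φ y).toAdd.natAbs + 1) ^ k s
            ≤ C' * ((φ y).toAdd.natAbs + 1) ^ k' :=
              Nat.mul_le_mul (hC' s hs) (Nat.pow_le_pow_right (by omega) (hk' s hs))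
          _ ≤ _ := by simp only [hq]; gcongr
      have h4 := ih y hy
      have h5 : q n ≤ q (n + 1) := hqm (Nat.le_succ n)
      have h6 : n * q n ≤ n * q (n + 1) := Nat.mul_le_mul_left _ h5
      rw [e, add_mul, one_mul]
      have := wordLength_mul_le hT (MulAut.conjNormal (t ^ (-(φ y).toAdd)) (π s)) (π y)
      omega
  refine ⟨fun n => n * q n, polyBdd_id.mul hqp, fun n x hx => ?_⟩
  have : π x = x := by
    have hx1 : φ (x : G) = 1 := x.2
    ext
    simp [hπ, hx1]
  rw [← this]
  exact key n x hx

end Distortion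

/-- Bézout coefficients of polynomial size for the greatest common divisor of integers bounded
by `B`. -/
theorem exists_bezout_bounded (Y : Finset ℤ) (B : ℕ) (hY : ∀ y ∈ Y, |y| ≤ (B : ℤ)) :
    ∃ (d : ℕ) (c : ℤ → ℤ), ∑ y ∈ Y, c y * y = d ∧ (∀ y ∈ Y, (d : ℤ) ∣ y) ∧ d ≤ B ∧
      ∀ y ∈ Y, |c y| ≤ ((B + (2 * B + 1) * (B * B) : ℕ) : ℤ) := by
  by_cases h0 : ∀ y ∈ Y, y = 0
  · refine ⟨0, 0, by simp, fun y hy => by simp [h0 y hy], Nat.zero_le _, fun y _ => ?_⟩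
    simp only [Pi.zero_apply, abs_zero]
    exact Int.natCast_nonneg _
  push Not at h0
  obtain ⟨y₀, hy₀, hne⟩ := h0
  obtain ⟨c, hc⟩ := Finset.gcd_eq_sum_mul Y (id : ℤ → ℤ)
  obtain ⟨d, hd⟩ : ∃ d : ℕ, Y.gcd id = (d : ℤ) :=
    Int.eq_ofNat_of_zero_le (Int.nonneg_of_normalize_eq_self Finset.normalize_gcd)
  have hdvd : ∀ y ∈ Y, (d : ℤ) ∣ y := fun y hy => hd ▸ Finset.gcd_dvd (f := id) hy
  have hdB : d ≤ B := by
    have h1 := Int.le_of_dvd (abs_pos.2 hne) ((dvd_abs _ _).2 (hdvd y₀ hy₀))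
    have := hY y₀ hy₀
    omega
  have hcard : (Y.card : ℤ) ≤ 2 * B + 1 := by
    have h1 : Y ⊆ Finset.Icc (-(B : ℤ)) B := fun y hy => by
      rw [Finset.mem_Icc]; exact abs_le.1 (hY y hy)
    have h2 := Finset.card_le_card h1
    rw [Int.card_Icc] at h2
    omega
  -- All coefficients except that of `y₀` are reduced modulo `y₀`, the quotients being absorbed
  -- there. The coefficient of `y₀` is then bounded by solving the identity for it.
  set c' : ℤ → ℤ := fun y => if y = y₀ then c y₀ + ∑ z ∈ Y.erase y₀, (c z / y₀) * z
    else c y % y₀ with hc'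
  have hcy₀ : c' y₀ = c y₀ + ∑ z ∈ Y.erase y₀, (c z / y₀) * z := by simp [hc']
  have hcz : ∀ z, z ≠ y₀ → c' z = c z % y₀ := fun z hz => by simp [hc', hz]
  have hsum : ∑ y ∈ Y, c' y * y = d := by
    rw [← hd, hc, ← Finset.add_sum_erase Y _ hy₀, ← Finset.add_sum_erase Y _ hy₀, hcy₀, add_mul,
      Finset.sum_mul, add_assoc, ← Finset.sum_add_distrib]
    congr 1
    · simp [mul_comm]
    · refine Finset.sum_congr rfl fun z hz => ?_
      rw [hcz z (Finset.ne_of_mem_erase hz), Int.emod_def, id]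
      ring
  have hsmall : ∀ z, z ≠ y₀ → |c' z| ≤ (B : ℤ) := fun z hz => by
    rw [hcz z hz, abs_of_nonneg (Int.emod_nonneg _ hne)]
    exact (Int.emod_lt_abs _ hne).le.trans (hY y₀ hy₀)
  refine ⟨d, c', hsum, hdvd, hdB, fun y hy => ?_⟩
  push_cast
  rcases eq_or_ne y y₀ with rfl | hyne
  · have h1 : c' y * y = d - ∑ z ∈ Y.erase y, c' z * z := by
      rw [← hsum, ← Finset.add_sum_erase Y _ hy, add_sub_cancel_right]
    have h2 : |∑ z ∈ Y.erase y, c' z * z| ≤ (2 * B + 1) * (B * B) := by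
      calc |∑ z ∈ Y.erase y, c' z * z| ≤ ∑ z ∈ Y.erase y, |c' z * z| :=
            Finset.abs_sum_le_sum_abs _ _
        _ ≤ ∑ z ∈ Y.erase y, ((B : ℤ) * B) := by
            refine Finset.sum_le_sum fun z hz => ?_
            rw [abs_mul]
            exact mul_le_mul (hsmall z (Finset.ne_of_mem_erase hz))
              (hY z (Finset.mem_of_mem_erase hz)) (abs_nonneg _) (by positivity)
        _ = (Y.erase y).card * ((B : ℤ) * B) := by simp
        _ ≤ _ := by
            refine mul_le_mul_of_nonneg_right (le_trans ?_ hcard) (by positivity)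
            exact_mod_cast Finset.card_le_card (Finset.erase_subset _ _)
    have h3 : |c' y| ≤ |c' y * y| := by
      rw [abs_mul]
      exact le_mul_of_one_le_right (abs_nonneg _) (Int.one_le_abs hne)
    have h4 : |c' y * y| ≤ d + |∑ z ∈ Y.erase y, c' z * z| := by
      rw [h1]
      exact (abs_sub _ _).trans (by simp)
    have : (d : ℤ) ≤ B := by exact_mod_cast hdB
    linarith
  · have := hsmall y hyne
    have h5 : (0 : ℤ) ≤ (2 * B + 1) * (B * B) := by positivity
    linarith

/-! ### Generators of the kernel of a homomorphism to the integers -/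

section IterComm

variable {G : Type*} [Group G]

/-- The iterated commutators `[x⁻¹, h, …, h]`, up to inversion. -/
def iterComm (h x : G) : ℕ → G
  | 0 => x
  | k + 1 => (iterComm h x k)⁻¹ * h * iterComm h x k * h⁻¹

theorem iterComm_mem_lcs (h x : G) (k : ℕ) :
    iterComm h x k ∈ (⊤ : Subgroup G).lowerCentralSeries k := by
  induction k with
  | zero => simp
  | succ k ih =>
    have := Subgroup.commutator_mem_commutator (inv_mem ih) (Subgroup.mem_top h)
    rw [Subgroup.lowerCentralSeries_succ]
    convert this using 1
    simp [iterComm, commutatorElement_def]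

theorem iterComm_mem {H : Subgroup G} {h x : G} (hh : h ∈ H) (hx : x ∈ H) (k : ℕ) :
    iterComm h x k ∈ H := by
  induction k with
  | zero => exact hx
  | succ k ih => exact H.mul_mem (H.mul_mem (H.mul_mem (H.inv_mem ih) hh) ih) (H.inv_mem hh)

theorem wordLength_iterComm_le {S : Finset G} (hS : Subgroup.closure (S : Set G) = ⊤) {h x : G}
    {q : ℕ} (hh : wordLength S h ≤ q) (hx : wordLength S x ≤ q) (k : ℕ) :
    wordLength S (iterComm h x k) ≤ 4 ^ k * q := by
  induction k with
  | zero => simpa [iterComm] using hx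
  | succ k ih =>
    have h1 := wordLength_mul_le hS ((iterComm h x k)⁻¹ * h * iterComm h x k) h⁻¹
    have h2 := wordLength_mul_le hS ((iterComm h x k)⁻¹ * h) (iterComm h x k)
    have h3 := wordLength_mul_le hS (iterComm h x k)⁻¹ h
    rw [wordLength_inv hS] at h1 h3
    have h4 : q ≤ 4 ^ k * q := Nat.le_mul_of_pos_left _ (by positivity)
    rw [iterComm, pow_succ]
    nlinarith

theorem conj_iterComm (h x : G) (k : ℕ) :
    h * iterComm h x k * h⁻¹ = iterComm h x k * iterComm h x (k + 1) := by
  simp [iterComm, mul_assoc]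

/-- Conjugation by `h` sends `u_k` to `u_k u_{k+1}`. The sequence ends at `1` by nilpotency, so the
inverse conjugation is handled by descending induction on `k`. -/
theorem mem_normalizer_closure_iterComm {c : ℕ}
    (hc : (⊤ : Subgroup G).lowerCentralSeries c = ⊥) (h : G) (X : Set G) :
    h ∈ Subgroup.normalizer
      (Subgroup.closure {u | ∃ x ∈ X, ∃ k, u = iterComm h x k} : Set G) := by
  set U := {u | ∃ x ∈ X, ∃ k, u = iterComm h x k} with hU
  have hz : ∀ x k, c ≤ k → iterComm h x k = 1 := fun x k hk => by
    have := Subgroup.lowerCentralSeries_antitone ⊤ hk (iterComm_mem_lcs h x k)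
    rwa [hc, Subgroup.mem_bot] at this
  have hmem : ∀ x ∈ X, ∀ k, iterComm h x k ∈ Subgroup.closure U := fun x hx k =>
    Subgroup.subset_closure ⟨x, hx, k, rfl⟩
  have h1 : Subgroup.closure U ≤ (Subgroup.closure U).comap (MulAut.conj h).toMonoidHom := by
    rw [Subgroup.closure_le]
    rintro _ ⟨x, hx, k, rfl⟩
    simp only [Subgroup.coe_comap, Set.mem_preimage, MulEquiv.coe_toMonoidHom, MulAut.conj_apply,
      conj_iterComm]
    exact mul_mem (hmem x hx k) (hmem x hx (k + 1))
  have h2 : Subgroup.closure U ≤ (Subgroup.closure U).comap (MulAut.conj h⁻¹).toMonoidHom := by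
    rw [Subgroup.closure_le]
    rintro _ ⟨x, hx, k, rfl⟩
    simp only [Subgroup.coe_comap, Set.mem_preimage, MulEquiv.coe_toMonoidHom, MulAut.conj_apply,
      inv_inv, SetLike.mem_coe]
    have : ∀ j k, c ≤ k + j → h⁻¹ * iterComm h x k * h ∈ Subgroup.closure U := by
      intro j
      induction j with
      | zero => intro k hk; rw [hz x k hk]; simp
      | succ j ih =>
        intro k hk
        have e : h⁻¹ * iterComm h x k * h =
            iterComm h x k * (h⁻¹ * iterComm h x (k + 1) * h)⁻¹ := by
          have := conj_iterComm h x k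
          rw [eq_mul_inv_iff_mul_eq]
          calc _ = h⁻¹ * (iterComm h x k * iterComm h x (k + 1)) * h := by group
            _ = _ := by rw [← this]; group
        rw [e]
        exact mul_mem (hmem x hx k) (inv_mem (ih (k + 1) (by omega)))
    exact this c k (by omega)
  rw [Subgroup.mem_normalizer_iff]
  intro g
  refine ⟨fun hg => by simpa using h1 hg, fun hg => ?_⟩
  have := h2 hg
  simpa [mul_assoc] using this

end IterComm

/-- Choose `h₀ ∈ H` generating modulo the kernel, with short Bézout coefficients, and correct each
generator of `H` by a power of `h₀`. The kernel part is generated by all `h₀`-conjugates of the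
corrected generators; finitely many iterated commutators with `h₀` replace these infinitely many
conjugates. -/
theorem exists_ker_generators {G : Type*} [Group G] [Group.IsNilpotent G] {S : Finset G}
    (hS : Subgroup.closure (S : Set G) = ⊤) (φ : G →* Multiplicative ℤ) :
    ∃ p : ℕ → ℕ, PolyBdd p ∧ ∀ (n : ℕ) (H : Subgroup G),
      H ≤ Subgroup.closure {x | x ∈ H ∧ wordLength S x ≤ n} →
      ∃ (d : ℕ) (h₀ : G), h₀ ∈ H ∧ (φ h₀).toAdd = d ∧ (∀ x ∈ H, (d : ℤ) ∣ (φ x).toAdd) ∧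
        (d = 0 → h₀ = 1) ∧ wordLength S h₀ ≤ p n ∧ d ≤ p n ∧
        ∀ x ∈ H, φ x = 1 → x ∈ Subgroup.closure {x | x ∈ H ∧ φ x = 1 ∧ wordLength S x ≤ p n} := by
  classical
  obtain ⟨c, hc⟩ := (Subgroup.nilpotent_iff_lowerCentralSeries (G := G)).1 inferInstance
  obtain ⟨b, hb⟩ := (isPoly_hom φ).growth hS
  set B : ℕ → ℕ := fun n => b * (n + 1) ^ 2 with hB
  have hBp : PolyBdd B := ⟨b, 2, fun _ => le_rfl⟩
  set E : ℕ → ℕ := fun n => B n + (2 * B n + 1) * (B n * B n) with hE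
  have hEp : PolyBdd E := hBp.add ((((polyBdd_const 2).mul hBp).add (polyBdd_const 1)).mul
    (hBp.mul hBp))
  set p₁ : ℕ → ℕ := fun n => (2 * B n + 1) * (E n * n) with hp₁
  have hp₁p : PolyBdd p₁ := (((polyBdd_const 2).mul hBp).add (polyBdd_const 1)).mul
    (hEp.mul polyBdd_id)
  set q : ℕ → ℕ := fun n => n + B n * p₁ n + p₁ n with hq
  have hqp : PolyBdd q := (polyBdd_id.add (hBp.mul hp₁p)).add hp₁p
  refine ⟨fun n => 4 ^ c * q n + B n, ((polyBdd_const _).mul hqp).add hBp, fun n H hH => ?_⟩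
  set X : Set G := {x | x ∈ H ∧ wordLength S x ≤ n} with hX
  have hXB : ∀ x ∈ X, |(φ x).toAdd| ≤ (B n : ℤ) := fun x hx => by
    rw [Int.abs_eq_natAbs]
    have h1 := hb x
    have h2 : b * (wordLength S x + 1) ^ 2 ≤ B n := by
      simp only [hB]
      have := hx.2
      gcongr
    exact_mod_cast h1.trans h2
  -- Bézout runs over the values of `φ`, polynomially many, rather than over `X`, whose size is not
  -- controlled.
  set Y : Finset ℤ := (Finset.Icc (-(B n : ℤ)) (B n)).filter fun y => ∃ x ∈ X, (φ x).toAdd = y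
    with hY
  have hYmem : ∀ x ∈ X, (φ x).toAdd ∈ Y := fun x hx => by
    rw [hY, Finset.mem_filter, Finset.mem_Icc]
    exact ⟨abs_le.1 (hXB x hx), x, hx, rfl⟩
  have hYX : ∀ y ∈ Y, ∃ x ∈ X, (φ x).toAdd = y := fun y hy => (Finset.mem_filter.1 hy).2
  choose! ρ hρ hρφ using hYX
  have hYcard : Y.card ≤ 2 * B n + 1 := by
    refine (Finset.card_filter_le _ _).trans ?_
    rw [Int.card_Icc]
    omega
  obtain ⟨d, a, hsum, hdvd, hdB, ha⟩ := exists_bezout_bounded Y (B n) fun y hy => by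
    rw [← hρφ y hy]; exact hXB _ (hρ y hy)
  have hdH : ∀ x ∈ H, (d : ℤ) ∣ (φ x).toAdd := by
    intro x hx
    have hx' := hH hx
    clear hx
    induction hx' using Subgroup.closure_induction with
    | mem x hx => exact hdvd _ (hYmem x hx)
    | one => simp
    | mul x y _ _ h1 h2 => rw [map_mul, toAdd_mul]; exact dvd_add h1 h2
    | inv x _ h1 => rwa [map_inv, toAdd_inv, dvd_neg]
  obtain ⟨h₀, hh₀, hh₀φ, hd0, hh₀len⟩ : ∃ h₀ ∈ H, (φ h₀).toAdd = d ∧ (d = 0 → h₀ = 1) ∧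
      wordLength S h₀ ≤ p₁ n := by
    rcases Nat.eq_zero_or_pos d with hd | hd
    · exact ⟨1, one_mem _, by simp [hd], fun _ => rfl, by simp⟩
    refine ⟨(Y.toList.map fun y => ρ y ^ a y).prod, ?_, ?_, fun h => by omega, ?_⟩
    · refine list_prod_mem fun z hz => ?_
      obtain ⟨y, hy, rfl⟩ := List.mem_map.1 hz
      exact zpow_mem (hρ y (Finset.mem_toList.1 hy)).1 _
    · rw [← hsum, map_list_prod, List.map_map, ← Finset.sum_map_toList, toAdd_list_sum,
        List.map_map]
      congr 1
      refine List.map_congr_left fun y hy => ?_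
      simp [hρφ y (Finset.mem_toList.1 hy)]
    · refine (wordLength_list_prod_le hS (B := E n * n) fun z hz => ?_).trans ?_
      · obtain ⟨y, hy, rfl⟩ := List.mem_map.1 hz
        have hy' := Finset.mem_toList.1 hy
        refine (wordLength_zpow_le hS _ _).trans (Nat.mul_le_mul ?_ (hρ y hy').2)
        have := ha y hy'
        rw [Int.abs_eq_natAbs] at this
        exact_mod_cast this
      · rw [List.length_map, Finset.length_toList]
        exact Nat.mul_le_mul_right _ hYcard
  -- For `d = 0` all values are zero and `h₀ = 1`, so division by zero is harmless.
  set x₀ : G → G := fun x => x * h₀ ^ (-((φ x).toAdd / d)) with hx₀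
  have hx₀H : ∀ x ∈ X, x₀ x ∈ H := fun x hx => mul_mem hx.1 (zpow_mem hh₀ _)
  have hx₀φ : ∀ x ∈ X, φ (x₀ x) = 1 := fun x hx => by
    apply Multiplicative.toAdd.injective
    simp only [hx₀, map_mul, map_zpow, toAdd_mul, toAdd_zpow, hh₀φ, toAdd_one, smul_eq_mul]
    rw [neg_mul, Int.ediv_mul_cancel (hdH x hx.1), add_neg_cancel]
  have hx₀len : ∀ x ∈ X, wordLength S (x₀ x) ≤ q n := fun x hx => by
    refine (wordLength_mul_le hS _ _).trans ?_
    have h1 := wordLength_zpow_le hS h₀ (-((φ x).toAdd / d))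
    have h2 : (-((φ x).toAdd / d)).natAbs ≤ B n := by
      rw [Int.natAbs_neg]
      have h3 := hXB x hx
      rw [Int.abs_eq_natAbs] at h3
      have h4 : ((φ x).toAdd / (d : ℤ)).natAbs ≤ (φ x).toAdd.natAbs := Int.natAbs_ediv_le_natAbs _ _
      have : (φ x).toAdd.natAbs ≤ B n := by exact_mod_cast h3
      omega
    have h5 : (-((φ x).toAdd / (d : ℤ))).natAbs * wordLength S h₀ ≤ B n * p₁ n :=
      Nat.mul_le_mul h2 hh₀len
    have h6 := hx.2
    simp only [hq]
    omega
  set U : Set G := {u | ∃ x ∈ x₀ '' X, ∃ k, u = iterComm h₀ x k} with hU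
  have hnorm := mem_normalizer_closure_iterComm hc h₀ (x₀ '' X)
  have hnormz : ∀ (i : ℤ) (g : G), g ∈ Subgroup.closure U →
      h₀ ^ i * g * (h₀ ^ i)⁻¹ ∈ Subgroup.closure U := fun i g hg =>
    (Subgroup.mem_normalizer_iff.1 (zpow_mem hnorm i) g).1 hg
  have hdecomp : ∀ x ∈ Subgroup.closure X, ∃ u ∈ Subgroup.closure U, ∃ i : ℤ, x = u * h₀ ^ i := by
    intro x hx
    induction hx using Subgroup.closure_induction with
    | mem x hx =>
      refine ⟨x₀ x, Subgroup.subset_closure ⟨x₀ x, ⟨x, hx, rfl⟩, 0, rfl⟩, (φ x).toAdd / d, ?_⟩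
      simp [hx₀]
    | one => exact ⟨1, one_mem _, 0, by simp⟩
    | mul x y _ _ h1 h2 =>
      obtain ⟨u, hu, i, rfl⟩ := h1
      obtain ⟨v, hv, j, rfl⟩ := h2
      exact ⟨_, mul_mem hu (hnormz i v hv), i + j, by group⟩
    | inv x _ h1 =>
      obtain ⟨u, hu, i, rfl⟩ := h1
      exact ⟨_, hnormz (-i) _ (inv_mem hu), -i, by group⟩
  refine ⟨d, h₀, hh₀, hh₀φ, hdH, hd0, ?_, ?_, fun x hx hxφ => ?_⟩
  · have : p₁ n ≤ 4 ^ c * q n :=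
      (by simp only [hq]; omega : p₁ n ≤ q n).trans (Nat.le_mul_of_pos_left _ (by positivity))
    dsimp only
    omega
  · dsimp only
    omega
  have hUφ : ∀ u ∈ U, φ u = 1 := by
    rintro _ ⟨_, ⟨x, hx, rfl⟩, k, rfl⟩
    have : ∀ k, φ (iterComm h₀ (x₀ x) k) = 1 := by
      intro k
      induction k with
      | zero => exact hx₀φ x hx
      | succ k ih => simp [iterComm, ih]
    exact this k
  have hUsub : U ⊆ {x | x ∈ H ∧ φ x = 1 ∧ wordLength S x ≤ 4 ^ c * q n + B n} := by
    intro u hu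
    refine ⟨?_, hUφ u hu, ?_⟩
    · obtain ⟨_, ⟨x, hx, rfl⟩, k, rfl⟩ := hu
      exact iterComm_mem hh₀ (hx₀H x hx) k
    · obtain ⟨_, ⟨x, hx, rfl⟩, k, rfl⟩ := hu
      rcases le_or_gt c k with hk | hk
      · have := Subgroup.lowerCentralSeries_antitone ⊤ hk (iterComm_mem_lcs h₀ (x₀ x) k)
        rw [hc, Subgroup.mem_bot] at this
        simp [this]
      · have h1 := wordLength_iterComm_le hS (hh₀len.trans (by simp only [hq]; omega))
          (hx₀len x hx) k
        have h2 : 4 ^ k * q n ≤ 4 ^ c * q n :=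
          Nat.mul_le_mul_right _ (Nat.pow_le_pow_right (by omega) hk.le)
        omega
  refine Subgroup.closure_mono hUsub ?_
  obtain ⟨u, hu, i, rfl⟩ := hdecomp x (hH hx)
  have hu1 : φ u = 1 := by
    have : Subgroup.closure U ≤ φ.ker := (Subgroup.closure_le _).2 hUφ
    exact this hu
  rw [map_mul, hu1, one_mul] at hxφ
  have hi : h₀ ^ i = 1 := by
    rcases Nat.eq_zero_or_pos d with hd | hd
    · rw [hd0 hd, one_zpow]
    · have := congrArg Multiplicative.toAdd hxφ
      rw [map_zpow, toAdd_zpow, hh₀φ, toAdd_one, smul_eq_mul, mul_eq_zero] at this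
      rcases this with h | h
      · rw [h, zpow_zero]
      · omega
  rw [hi, mul_one]
  exact hu

/-! ### Separation modulo powers. -/

theorem dvd_toAdd_of_mem_powSub {G : Type*} [Group G] (φ : G →* Multiplicative ℤ) {m : ℕ} {x : G}
    (hx : x ∈ powSub G m) : (m : ℤ) ∣ (φ x).toAdd := by
  have h := map_powSub_le φ m (Subgroup.mem_map_of_mem φ hx)
  generalize φ x = y at h
  induction h using Subgroup.closure_induction with
  | mem y hy =>
    obtain ⟨z, rfl⟩ := hy
    simp
  | one => simp
  | mul y z _ _ h1 h2 => rw [toAdd_mul]; exact dvd_add h1 h2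
  | inv y _ h1 => rw [toAdd_inv, dvd_neg]; exact h1

/-- Effective subgroup separability: in a torsion-free finitely generated nilpotent group, elements
are separated from subgroups modulo `m`-th powers, for some `m` of polynomial size. -/
theorem exists_powSub_separating (r : ℕ) : ∀ (G : Type u) [Group G] [Group.FG G]
    [Group.IsNilpotent G] (_ : ∀ g : G, g ≠ 1 → ¬ IsOfFinOrder g) (_ : IntChain r G ⊥)
    (S : Finset G) (_ : Subgroup.closure (S : Set G) = ⊤),
    ∃ p : ℕ → ℕ, PolyBdd p ∧ ∀ (n : ℕ) (H : Subgroup G),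
      H ≤ Subgroup.closure {x | x ∈ H ∧ wordLength S x ≤ n} → ∀ g, g ∉ H → wordLength S g ≤ n →
      ∃ m, 0 < m ∧ m ≤ p n ∧ ∀ h ∈ H, h⁻¹ * g ∉ powSub G m := by
  induction r with
  | zero =>
    intro G _ _ _ hG h S _
    have := subsingleton_of_index_bot hG h
    refine ⟨fun _ => 0, polyBdd_const 0, fun n H _ g hg _ => ?_⟩
    rw [Subsingleton.elim g 1] at hg
    exact absurd (one_mem H) hg
  | succ r ih =>
    intro G _ _ _ hG h S hS
    obtain ⟨φ, hφ, -, hr⟩ := h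
    rw [Subgroup.bot_subgroupOf] at hr
    obtain ⟨t, ht⟩ := hφ (Multiplicative.ofAdd 1)
    obtain ⟨T, hT⟩ := (Group.fg_def (G := φ.ker)).1 inferInstance
    obtain ⟨D, hD, hD'⟩ := exists_comap_powSub_le r φ.ker (torsionFree_subgroup hG _) hr G
      φ.ker.subtype (extendsPoly_ker hφ)
    obtain ⟨p₁, hp₁, hdist⟩ := ker_distortion ht hS hT
    obtain ⟨p₂, hp₂, hgen⟩ := exists_ker_generators hS φ
    obtain ⟨p₃, hp₃, hsep⟩ := ih φ.ker (torsionFree_subgroup hG _) hr T hT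
    obtain ⟨P₁, hP₁m, hP₁, hP₁le⟩ := hp₁.exists_monotone
    obtain ⟨P₃, hP₃m, hP₃, hP₃le⟩ := hp₃.exists_monotone
    obtain ⟨b, hb⟩ := (isPoly_hom φ).growth hS
    set B : ℕ → ℕ := fun n => b * (n + 1) ^ 2 with hB
    have hBp : PolyBdd B := ⟨b, 2, fun _ => le_rfl⟩
    set q : ℕ → ℕ := fun n => n + B n * p₂ n + p₂ n with hq
    have hqp : PolyBdd q := (polyBdd_id.add (hBp.mul hp₂)).add hp₂
    set Q : ℕ → ℕ := fun n => P₃ (P₁ (q n)) with hQ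
    have hQp : PolyBdd Q := hP₃.comp (hP₁.comp hqp)
    refine ⟨fun n => (B n + 1) + p₂ n + (p₂ n + 1) * D * Q n,
      ((hBp.add (polyBdd_const 1)).add hp₂).add
        (((hp₂.add (polyBdd_const 1)).mul (polyBdd_const D)).mul hQp), fun n H hH g hg hgn => ?_⟩
    obtain ⟨d, h₀, hh₀, hh₀φ, hdH, hd0, hh₀len, hdlen, hker⟩ := hgen n H hH
    have hgB : (φ g).toAdd.natAbs ≤ B n := (hb g).trans (by simp only [hB]; gcongr)
    by_cases hdg : (d : ℤ) ∣ (φ g).toAdd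
    swap
    · -- the image of `g` in `ℤ` is not in the image of `H`
      rcases Nat.eq_zero_or_pos d with rfl | hd
      · refine ⟨(φ g).toAdd.natAbs + 1, by omega, by dsimp only; omega, fun h hh hmem => ?_⟩
        have h1 := dvd_toAdd_of_mem_powSub φ hmem
        have h2 : (φ h).toAdd = 0 := by simpa using hdH h hh
        rw [map_mul, map_inv, toAdd_mul, toAdd_inv, h2, neg_zero, zero_add] at h1
        have h3 := Int.natCast_dvd.1 h1
        have h4 : (φ g).toAdd.natAbs ≠ 0 := fun h0 => hdg (by simpa using h0)
        have := Nat.le_of_dvd (Nat.pos_of_ne_zero h4) h3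
        omega
      · refine ⟨d, hd, by dsimp only; omega, fun h hh hmem => hdg ?_⟩
        have h1 := dvd_toAdd_of_mem_powSub φ hmem
        rw [map_mul, map_inv, toAdd_mul, toAdd_inv] at h1
        have := dvd_add (hdH h hh) h1
        rwa [add_neg_cancel_left] at this
    -- Now `g` agrees with a power of `h₀` under `φ`; dividing by it moves the problem into `ker φ`
    -- without affecting membership in `H`.
    set a := (φ g).toAdd / d with ha
    have had : a * d = (φ g).toAdd := Int.ediv_mul_cancel hdg
    set g' := g * h₀ ^ (-a) with hg'
    have hg'φ : φ g' = 1 := by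
      apply Multiplicative.toAdd.injective
      rw [hg', map_mul, map_zpow, toAdd_mul, toAdd_zpow, hh₀φ, smul_eq_mul, neg_mul, had,
        add_neg_cancel, toAdd_one]
    have hg'H : g' ∉ H := fun h => hg (by
      have := mul_mem h (zpow_mem hh₀ a)
      rwa [hg', zpow_neg, inv_mul_cancel_right] at this)
    have hg'len : wordLength S g' ≤ q n := by
      refine (wordLength_mul_le hS _ _).trans ?_
      have h1 := wordLength_zpow_le hS h₀ (-a)
      have h2 : (-a).natAbs ≤ B n := by
        rw [Int.natAbs_neg]
        exact (Int.natAbs_ediv_le_natAbs _ _).trans hgB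
      have h3 : (-a).natAbs * wordLength S h₀ ≤ B n * p₂ n := Nat.mul_le_mul h2 hh₀len
      simp only [hq]
      omega
    have hlen : ∀ x : φ.ker, wordLength S (x : G) ≤ q n → wordLength T x ≤ P₁ (q n) :=
      fun x hx => (hdist _ x hx).trans (hP₁le _)
    have hH' : H.subgroupOf φ.ker ≤ Subgroup.closure
        {x | x ∈ H.subgroupOf φ.ker ∧ wordLength T x ≤ P₁ (q n)} := by
      intro x hx
      have h1 := hker x hx x.2
      have h2 : Subgroup.closure {x | x ∈ H ∧ φ x = 1 ∧ wordLength S x ≤ p₂ n} ≤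
          (Subgroup.closure {x | x ∈ H.subgroupOf φ.ker ∧ wordLength T x ≤ P₁ (q n)}).map
            φ.ker.subtype := by
        rw [Subgroup.closure_le]
        rintro y ⟨hy, hyφ, hyl⟩
        refine ⟨⟨y, hyφ⟩, Subgroup.subset_closure ⟨hy, hlen _ (hyl.trans ?_)⟩, rfl⟩
        simp only [hq]
        omega
      obtain ⟨y, hy, hyx⟩ := h2 h1
      rwa [← Subtype.ext hyx]
    obtain ⟨m, hm, hmle, hmsep⟩ := hsep _ (H.subgroupOf φ.ker) hH' ⟨g', hg'φ⟩ hg'H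
      (hlen ⟨g', hg'φ⟩ hg'len)
    -- The extra factor `d` in the modulus converts divisibility of `c * d` into divisibility of the
    -- exponent `c` of `h₀`.
    obtain ⟨e, he, hee, hede⟩ : ∃ e, 0 < e ∧ e ≤ p₂ n + 1 ∧ (d ≠ 0 → e = d) := by
      rcases Nat.eq_zero_or_pos d with hd | hd
      · exact ⟨1, one_pos, by omega, fun h => absurd hd h⟩
      · exact ⟨d, hd, by omega, fun _ => rfl⟩
    refine ⟨e * (D * m), by positivity, ?_, fun h hh hmem => ?_⟩
    · have h1 : m ≤ Q n := hmle.trans (hP₃le _)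
      have h2 : e * (D * m) ≤ (p₂ n + 1) * D * Q n := by
        rw [← mul_assoc]
        gcongr
      dsimp only
      omega
    set y := h₀ ^ a * (h⁻¹ * g) * (h₀ ^ a)⁻¹ with hy
    have hymem : y ∈ powSub G (e * (D * m)) :=
      Subgroup.Normal.conj_mem inferInstance _ hmem _
    set h' := h * h₀ ^ (-a) with hh'
    have hh'H : h' ∈ H := mul_mem hh (zpow_mem hh₀ _)
    have hyg : y = h'⁻¹ * g' := by
      rw [hy, hh', hg']; group
    set c := (φ h').toAdd / d with hc
    have hcd : c * d = (φ h').toAdd := Int.ediv_mul_cancel (hdH h' hh'H)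
    have hyφ : (φ y).toAdd = -(c * d) := by
      rw [hyg, map_mul, hg'φ, mul_one, map_inv, toAdd_inv, hcd]
    set k := h' * h₀ ^ (-c) with hk
    have hkφ : φ k = 1 := by
      apply Multiplicative.toAdd.injective
      rw [hk, map_mul, map_zpow, toAdd_mul, toAdd_zpow, hh₀φ, smul_eq_mul, neg_mul, hcd,
        add_neg_cancel, toAdd_one]
    have hkH : k ∈ H := mul_mem hh'H (zpow_mem hh₀ _)
    have hh₀c : h₀ ^ c ∈ powSub G (D * m) := by
      by_cases hd : d = 0
      · rw [hd0 hd, one_zpow]; exact one_mem _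
      · have h1 := dvd_toAdd_of_mem_powSub φ hymem
        rw [hyφ, dvd_neg, hede hd, Nat.cast_mul, mul_comm (d : ℤ)] at h1
        obtain ⟨i, hi⟩ := Int.dvd_of_mul_dvd_mul_right (Int.natCast_ne_zero.2 hd) h1
        rw [hi, mul_comm _ i, zpow_mul, zpow_natCast]
        exact pow_mem_powSub _ _
    -- The element `h'` of `H` has been pushed into `ker φ` at the cost of a `D m`-th power, so the
    -- separation obtained inside `ker φ` is contradicted.
    have hfin : k⁻¹ * g' ∈ powSub G (D * m) := by
      have : k⁻¹ * g' = h₀ ^ c * y := by rw [hyg, hk]; group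
      rw [this]
      exact mul_mem hh₀c (powSub_le_of_dvd (Dvd.intro_left _ rfl) hymem)
    exact hmsep ⟨k, hkφ⟩ hkH (hD' m hfin)

/-- Separation from a fixed subgroup `H`: outside of an overgroup `R` in which `H` has finite index
there is an integer of polynomial size obstructing membership in `H` modulo `D m`-th powers. -/
theorem exists_separating_integer (r : ℕ) : ∀ (K : Type u) [Group K] [Group.IsNilpotent K]
    (H : Subgroup K) (_ : IntChain r K H) (N : Type u) [Group N] (S : Finset N)
    (_ : Subgroup.closure (S : Set N) = ⊤) (ι : K →* N) (_ : ExtendsPoly ι),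
    ∃ (R : Subgroup K) (D : ℕ) (p : ℕ → ℕ), H ≤ R ∧ H.relIndex R ≠ 0 ∧ 0 < D ∧ PolyBdd p ∧
      ∀ g, g ∉ R → ∃ a : ℕ, a ≠ 0 ∧ a ≤ p (wordLength S (ι g)) ∧
        ∀ m h, h ∈ H → ι (h⁻¹ * g) ∈ powSub N (D * m) → m ∣ a := by
  induction r with
  | zero =>
    intro K _ _ H h N _ S _ ι _
    exact ⟨⊤, 1, fun _ => 0, le_top, by rwa [Subgroup.relIndex_top_right], one_pos, polyBdd_const 0,
      fun g hg => absurd (Subgroup.mem_top g) hg⟩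
  | succ r ih =>
    intro K _ _ H h N _ S hS ι hι
    obtain ⟨φ, hφ, hle, hr⟩ := h
    obtain ⟨R, D, p, hHR, hrel, hD, hp, hsep⟩ := ih φ.ker (H.subgroupOf φ.ker) hr N S hS
      (ι.comp φ.ker.subtype) (hι.comp (extendsPoly_ker hφ))
    obtain ⟨l, F, hF, hFφ⟩ := hι 2 _ (isPoly_hom φ)
    obtain ⟨C, hC⟩ := hF.growth hS
    have hmapH : (H.subgroupOf φ.ker).map φ.ker.subtype = H := by
      rw [Subgroup.subgroupOf_map_subtype, inf_eq_left.2 hle]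
    refine ⟨R.map φ.ker.subtype, l.factorial * D, fun n => C * (n + 1) ^ l + p n, ?_, ?_,
      by positivity, PolyBdd.add ⟨C, l, fun _ => le_rfl⟩ hp, fun g hg => ?_⟩
    · rw [← hmapH]; exact Subgroup.map_mono hHR
    · rwa [← hmapH, Subgroup.relIndex_map_map_of_injective _ _ φ.ker.subtype_injective]
    by_cases hgφ : φ g = 1
    · obtain ⟨a, ha0, hap, ha⟩ := hsep ⟨g, hgφ⟩ fun h => hg ⟨_, h, rfl⟩
      refine ⟨a, ha0, hap.trans (Nat.le_add_left _ _), fun m h hh hmem => ?_⟩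
      refine ha m ⟨h, hle hh⟩ hh ?_
      rw [mul_assoc] at hmem
      exact powSub_le_of_dvd (Dvd.intro_left _ rfl) hmem
    · refine ⟨(φ g).toAdd.natAbs, fun h => hgφ (by simpa using h), ?_, fun m h hh hmem => ?_⟩
      · rw [← hFφ g]
        exact (hC _).trans (Nat.le_add_right _ _)
      -- Polynomial invariance is under left translation, so `h⁻¹ * g` is first conjugated to `g *
      -- h⁻¹`; translating `h` by it then compares `φ g` with `φ h = 0`.
      · have h1 : ι (g * h⁻¹) ∈ powSub N (l.factorial * m) := by
          have := Subgroup.Normal.conj_mem inferInstance _ hmem (ι h)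
          rw [← map_inv, ← map_mul, ← map_mul, mul_inv_cancel_left] at this
          refine powSub_le_of_dvd ⟨D, by ring⟩ this
        have h2 := hF.dvd_mul_sub h1 (ι h)
        have hh1 : φ h = 1 := hle hh
        rw [← map_mul, inv_mul_cancel_right, hFφ, hFφ, hh1, toAdd_one, sub_zero] at h2
        exact Int.natCast_dvd.1 h2

/-! ### Depth -/

section Depth

variable {G : Type*} [Group G] {H : Subgroup G} {g : G}

theorem depth_le_index (K : Subgroup G) [K.Normal] (hK : K.index ≠ 0)
    (hsep : ∀ h ∈ H, h⁻¹ * g ∉ K) : depth H g ≤ K.index := by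
  have : Finite (G ⧸ K) := Nat.finite_of_card_ne_zero hK
  refine sInf_le ⟨Shrink.{0} (G ⧸ K), inferInstance, inferInstance,
    (Shrink.mulEquiv.{0} (α := G ⧸ K)).symm.toMonoidHom.comp (QuotientGroup.mk' K), ?_, ?_⟩
  · rintro ⟨h, hh, he⟩
    have := (Shrink.mulEquiv.{0} (α := G ⧸ K)).symm.injective he
    exact hsep h hh (QuotientGroup.eq.1 this)
  · rw [Nat.card_congr (equivShrink.{0} (G ⧸ K)).symm]
    rfl

theorem exists_normal_of_depth_le {d : ℕ} (h : depth H g ≤ d) :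
    ∃ K : Subgroup G, K.Normal ∧ K.index ≠ 0 ∧ K.index ≤ d ∧ ∀ h ∈ H, h⁻¹ * g ∉ K := by
  have hne : {m : ℕ∞ | ∃ (Q : Type) (_ : Group Q) (_ : Finite Q) (π : G →* Q),
      π g ∉ H.map π ∧ m = (Nat.card Q : ℕ∞)}.Nonempty := by
    rw [Set.nonempty_iff_ne_empty]
    intro h0
    rw [depth, h0, sInf_empty, top_le_iff] at h
    exact ENat.natCast_ne_top d h
  obtain ⟨Q, _, _, π, hπ, hQ⟩ := csInf_mem hne
  have hcard : Nat.card Q ≤ d := by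
    rw [depth, hQ] at h
    exact_mod_cast h
  refine ⟨π.ker, inferInstance, ?_, ?_, fun h hh hmem => hπ ⟨h, hh, ?_⟩⟩
  · rw [Subgroup.index_ker]
    exact Nat.card_pos.ne'
  · rw [Subgroup.index_ker]
    exact (Nat.card_le_card_of_injective _ π.range.subtype_injective).trans hcard
  · rw [MonoidHom.mem_ker, map_mul, map_inv, inv_mul_eq_one] at hmem
    exact hmem

theorem le_depth {m : ℕ} (h : ∀ (Q : Type) [Group Q] [Finite Q] (π : G →* Q),
    π g ∉ H.map π → m ≤ Nat.card Q) : (m : ℕ∞) ≤ depth H g := by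
  refine le_sInf ?_
  rintro _ ⟨Q, _, _, π, hπ, rfl⟩
  exact_mod_cast h Q π hπ

theorem depth_mul_right {h : G} (hh : h ∈ H) : depth H (g * h) = depth H g := by
  have : ∀ (Q : Type) [Group Q] (π : G →* Q), π (g * h) ∈ H.map π ↔ π g ∈ H.map π := by
    intro Q _ π
    rw [map_mul]
    exact Subgroup.mul_mem_cancel_right _ (Subgroup.mem_map_of_mem π hh)
  simp only [depth, this]

end Depth

/-! ### Norms of subgroups and balls in the word metric. -/

section Norms

variable {G : Type*} [Group G] {S : Finset G}

/-- Together with `subgroupNorm_le`, this trades the minimum over finite generating sets for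
generation by the elements of a ball. Finite generation excludes the default value `0` of the
infimum. -/
theorem le_closure_of_subgroupNorm_le {H : Subgroup G} (hfg : H.FG) {n : ℕ}
    (h : subgroupNorm S H ≤ n) : H ≤ Subgroup.closure {x | x ∈ H ∧ wordLength S x ≤ n} := by
  obtain ⟨X, hX⟩ := hfg
  have : subgroupNorm S H ∈
      {n : ℕ | ∃ X : Finset G, Subgroup.closure (X : Set G) = H ∧ finsetNorm S X = n} :=
    Nat.sInf_mem ⟨_, X, hX, rfl⟩
  obtain ⟨X, hX, hn⟩ := this
  have h1 : (X : Set G) ⊆ {x | x ∈ H ∧ wordLength S x ≤ n} := fun x hx =>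
    ⟨hX ▸ Subgroup.subset_closure hx, (Finset.le_sup (f := wordLength S) hx).trans (hn.trans_le h)⟩
  conv_lhs => rw [← hX]
  exact Subgroup.closure_mono h1

theorem finite_ball (hS : Subgroup.closure (S : Set G) = ⊤) (n : ℕ) :
    {g : G | wordLength S g ≤ n}.Finite := by
  classical
  induction n with
  | zero =>
    refine (Set.finite_singleton (1 : G)).subset fun g hg => ?_
    exact eq_one_of_wordLength_eq_zero hS (Nat.le_zero.1 hg)
  | succ n ih =>
    refine ((Set.finite_singleton (1 : G)).union
      (Set.Finite.image2 (· * ·) (S ∪ S.image (·⁻¹)).finite_toSet ih)).subset fun g hg => ?_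
    rcases eq_or_ne g 1 with rfl | h1
    · exact Or.inl rfl
    · obtain ⟨s, g', hs, hg', rfl⟩ := exists_letter_mul hS hg h1
      refine Or.inr ⟨s, ?_, g', hg', rfl⟩
      rw [Finset.mem_coe, Finset.mem_union, Finset.mem_image]
      rcases hs with hs | hs
      exacts [Or.inl hs, Or.inr ⟨_, hs, inv_inv s⟩]

theorem subgroupNorm_le (hS : Subgroup.closure (S : Set G) = ⊤) {H : Subgroup G} {n : ℕ}
    (h : H ≤ Subgroup.closure {x | x ∈ H ∧ wordLength S x ≤ n}) : subgroupNorm S H ≤ n := by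
  have hfin : {x | x ∈ H ∧ wordLength S x ≤ n}.Finite := (finite_ball hS n).subset fun x hx => hx.2
  have : finsetNorm S hfin.toFinset ≤ n := Finset.sup_le fun x hx => (hfin.mem_toFinset.1 hx).2
  refine le_trans (Nat.sInf_le ⟨hfin.toFinset, ?_, rfl⟩) this
  rw [hfin.coe_toFinset]
  exact le_antisymm ((Subgroup.closure_le H).2 fun x hx => hx.1) h

end Norms

/-! ### Reduction to a normal subgroup of finite index -/

/-- A finite group has finitely many pairs of a subset and an element. The uniformity is what makes
coset representatives in `H` short for all `H` at once. -/
theorem exists_uniform_word_bound (Q : Type*) [Group Q] [Finite Q] :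
    ∃ c : ℕ, ∀ (Y : Set Q) (q : Q), q ∈ Subgroup.closure Y →
      ∃ l : List Q, (∀ x ∈ l, x ∈ Y ∨ x⁻¹ ∈ Y) ∧ l.prod = q ∧ l.length ≤ c := by
  have : ∀ p : {p : Set Q × Q // p.2 ∈ Subgroup.closure p.1}, ∃ l : List Q,
      (∀ x ∈ l, x ∈ p.1.1 ∨ x⁻¹ ∈ p.1.1) ∧ l.prod = p.1.2 := fun p =>
    exists_letters_of_mem_closure p.2
  choose l h1 h2 using this
  obtain ⟨c, hc⟩ := Set.Finite.bddAbove (Set.finite_range fun p => (l p).length)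
  exact ⟨c, fun Y q hq => ⟨l ⟨(Y, q), hq⟩, h1 _, h2 _, hc ⟨_, rfl⟩⟩⟩

theorem exists_uniform_representative {G Q : Type*} [Group G] [Group Q] [Finite Q] (π : G →* Q) :
    ∃ c : ℕ, ∀ (X : Set G) (g : G), g ∈ Subgroup.closure X →
      ∃ l : List G, (∀ x ∈ l, x ∈ X ∨ x⁻¹ ∈ X) ∧ π l.prod = π g ∧ l.length ≤ c := by
  obtain ⟨c, hc⟩ := exists_uniform_word_bound Q
  refine ⟨c, fun X g hg => ?_⟩
  have h1 : π g ∈ Subgroup.closure (π '' X) := by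
    rw [← MonoidHom.map_closure]
    exact Subgroup.mem_map_of_mem π hg
  obtain ⟨l, hl, hlp, hlc⟩ := hc _ _ h1
  have : ∀ l : List Q, (∀ x ∈ l, x ∈ π '' X ∨ x⁻¹ ∈ π '' X) →
      ∃ l' : List G, (∀ x ∈ l', x ∈ X ∨ x⁻¹ ∈ X) ∧ π l'.prod = l.prod ∧ l'.length = l.length := by
    intro l
    induction l with
    | nil => exact fun _ => ⟨[], by simp⟩
    | cons a l ih =>
      intro h
      obtain ⟨l', h1, h2, h3⟩ := ih fun x hx => h x (by simp [hx])
      obtain ⟨b, hb, hbπ⟩ : ∃ b, (b ∈ X ∨ b⁻¹ ∈ X) ∧ π b = a := by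
        rcases h a (by simp) with ⟨b, hb, he⟩ | ⟨b, hb, he⟩
        · exact ⟨b, Or.inl hb, he⟩
        · exact ⟨b⁻¹, Or.inr (by simpa using hb), by rw [map_inv, he, inv_inv]⟩
      refine ⟨b :: l', fun x hx => ?_, by simp [h2, hbπ], by simp [h3]⟩
      rcases List.mem_cons.1 hx with rfl | hx
      exacts [hb, h1 x hx]
  obtain ⟨l', h1, h2, h3⟩ := this l hl
  exact ⟨l', h1, h2.trans hlp, h3.trans_le hlc⟩

section Reduction

variable {Γ N : Type*} [Group Γ] [Group N] {j : N →* Γ} [j.range.Normal] [j.range.FiniteIndex]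

/-- Since the image of `K₀` is normal in `M`, its conjugates in `Γ` depend only on the coset modulo
`M`; there are at most `[Γ : M]` of them, all of the same index in `M`. -/
theorem exists_normal_le_map (hj : Function.Injective j) (K₀ : Subgroup N) [K₀.Normal]
    (h0 : K₀.index ≠ 0) : ∃ K : Subgroup Γ, K.Normal ∧ K.index ≠ 0 ∧
      K.index ≤ j.range.index * K₀.index ^ j.range.index ∧ K ≤ K₀.map j := by
  set M := j.range
  set P := K₀.map j with hP
  have hPM : P ≤ M := Subgroup.map_le_range j K₀
  have : Fintype (Γ ⧸ M) := Fintype.ofFinite _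
  set f : Γ ⧸ M → Subgroup Γ := fun q => P.comap (MulAut.conj q.out⁻¹).toMonoidHom with hf
  have hrel : ∀ q, (f q).relIndex M = K₀.index := fun q => by
    have e : M.map (MulAut.conj q.out⁻¹).toMonoidHom = M := by
      ext x
      constructor
      · rintro ⟨y, hy, rfl⟩
        exact Subgroup.Normal.conj_mem inferInstance _ hy _
      · intro hx
        refine ⟨q.out * x * q.out⁻¹, Subgroup.Normal.conj_mem inferInstance _ hx _, ?_⟩
        simp [mul_assoc]
    rw [hf, Subgroup.relIndex_comap, e, hP]
    change (K₀.map j).relIndex j.range = _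
    rw [MonoidHom.range_eq_map, Subgroup.relIndex_map_map_of_injective _ _ hj,
      Subgroup.relIndex_top_right]
  have hfM : ∀ q, f q ≤ M := fun q x hx => by
    have h1 : q.out⁻¹ * x * q.out ∈ M := hPM (by simpa [hf] using hx)
    have := Subgroup.Normal.conj_mem inferInstance _ h1 q.out
    simpa [mul_assoc] using this
  have hle : ⨅ q, f q ≤ M := (iInf_le f (1 : Γ)).trans (hfM _)
  have hcore : ⨅ q, f q ≤ P.normalCore := by
    intro a ha b
    rw [Subgroup.mem_iInf] at ha
    have h1 := ha (QuotientGroup.mk b⁻¹)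
    set o := (QuotientGroup.mk b⁻¹ : Γ ⧸ M).out with ho
    have h2 : o⁻¹ * a * o ∈ P := by
      have h2 : o⁻¹ * a * o⁻¹⁻¹ ∈ P := h1
      rwa [inv_inv] at h2
    have h3 : o⁻¹ * b⁻¹ ∈ M := by
      rw [← QuotientGroup.eq, ho, QuotientGroup.out_eq']
    obtain ⟨n, hn⟩ := h3
    obtain ⟨k, hk, hk'⟩ := h2
    refine ⟨n⁻¹ * k * n⁻¹⁻¹, Subgroup.Normal.conj_mem inferInstance _ hk _, ?_⟩
    rw [map_mul, map_mul, inv_inv, map_inv, hn, hk']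
    group
  have hprod : ∏ q, (f q).relIndex M = K₀.index ^ M.index := by
    simp only [hrel, Finset.prod_const, Finset.card_univ]
    rw [Subgroup.index_eq_card M, Nat.card_eq_fintype_card]
  have hne : (⨅ q, f q).index ≠ 0 := by
    rw [← Subgroup.relIndex_mul_index hle]
    exact mul_ne_zero (Subgroup.relIndex_iInf_ne_zero fun q => by rw [hrel]; exact h0)
      Subgroup.FiniteIndex.index_ne_zero
  have hdvd := Subgroup.index_dvd_of_le hcore
  refine ⟨P.normalCore, inferInstance, ne_zero_of_dvd_ne_zero hne hdvd,
    (Nat.le_of_dvd (Nat.pos_of_ne_zero hne) hdvd).trans ?_, Subgroup.normalCore_le P⟩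
  rw [← Subgroup.relIndex_mul_index hle, mul_comm]
  refine Nat.mul_le_mul_left _ ?_
  rw [← hprod]
  exact Subgroup.relIndex_iInf_le f

/-- The word length on a finite index normal subgroup is at most linear in the ambient one. -/
theorem exists_wordLength_le_mul (hj : Function.Injective j) {S : Finset Γ}
    (hS : Subgroup.closure (S : Set Γ) = ⊤) {T : Finset N}
    (hT : Subgroup.closure (T : Set N) = ⊤) :
    ∃ C : ℕ, ∀ x : N, wordLength T x ≤ C * wordLength S (j x) := by
  classical
  set M := j.range
  set π := QuotientGroup.mk' M with hπ
  -- Schreier rewriting; the transversal is normalised at the trivial coset so that elements of `M`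
  -- receive no correction at the end.
  set R : Γ ⧸ M → Γ := fun q => if q = 1 then 1 else q.out with hR
  have hRπ : ∀ q, π (R q) = q := fun q => by
    simp only [hR]
    split_ifs with h
    · rw [map_one, h]
    · exact QuotientGroup.out_eq' q
  have hmem : ∀ (s : Γ) (q : Γ ⧸ M), ∃ y : N, j y = (R (π s * q))⁻¹ * s * R q := fun s q => by
    have : (R (π s * q))⁻¹ * s * R q ∈ M := by
      rw [← QuotientGroup.eq_one_iff]
      change π _ = 1
      rw [map_mul, map_mul, map_inv, hRπ, hRπ]
      group
    exact this
  choose Y hY using hmem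
  have : Fintype (Γ ⧸ M) := Fintype.ofFinite _
  obtain ⟨B, hB⟩ := exists_bound_letters S fun s => Finset.univ.sup fun q => wordLength T (Y s q)
  have hB' : ∀ s, (s ∈ S ∨ s⁻¹ ∈ S) → ∀ q, wordLength T (Y s q) ≤ B := fun s hs q =>
    (Finset.le_sup (f := fun q => wordLength T (Y s q)) (Finset.mem_univ q)).trans (hB s hs)
  have key : ∀ n g, wordLength S g ≤ n → ∃ y : N, g = R (π g) * j y ∧ wordLength T y ≤ B * n := by
    have h1 : ∃ y : N, (1 : Γ) = R (π 1) * j y ∧ wordLength T y ≤ 0 := ⟨1, by simp [hR], by simp⟩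
    intro n
    induction n with
    | zero =>
      intro g hg
      rw [eq_one_of_wordLength_eq_zero hS (Nat.le_zero.1 hg)]
      exact h1
    | succ n ih =>
      intro g hg
      rcases eq_or_ne g 1 with rfl | hg1
      · obtain ⟨y, hy, hy'⟩ := h1
        exact ⟨y, hy, hy'.trans (Nat.zero_le _)⟩
      obtain ⟨s, g', hs, hg', rfl⟩ := exists_letter_mul hS hg hg1
      obtain ⟨y, hy, hyl⟩ := ih g' hg'
      refine ⟨Y s (π g') * y, ?_, ?_⟩
      · conv_lhs => rw [hy]
        rw [map_mul, map_mul, hY]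
        group
      · have := wordLength_mul_le hT (Y s (π g')) y
        have := hB' s hs (π g')
        rw [mul_add, mul_one]
        omega
  refine ⟨B, fun x => ?_⟩
  obtain ⟨y, hy, hyl⟩ := key _ (j x) le_rfl
  have h2 : π (j x) = 1 := (QuotientGroup.eq_one_iff _).2 ⟨x, rfl⟩
  rw [h2] at hy
  simp only [hR, if_true, one_mul] at hy
  rw [← hj hy] at hyl
  exact hyl

/-- The generators of the intersection of a subgroup with a normal subgroup of finite index. -/
theorem exists_comap_generators {S : Finset Γ} (hS : Subgroup.closure (S : Set Γ) = ⊤) :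
    ∃ c : ℕ, ∀ (n : ℕ) (H : Subgroup Γ), H ≤ Subgroup.closure {x | x ∈ H ∧ wordLength S x ≤ n} →
      (∀ g ∈ H, ∃ r ∈ H, wordLength S r ≤ c * n ∧ r⁻¹ * g ∈ j.range) ∧
      H ⊓ j.range ≤ Subgroup.closure {x | x ∈ H ⊓ j.range ∧ wordLength S x ≤ c * n} := by
  classical
  set M := j.range with hM
  set π := QuotientGroup.mk' M with hπ
  obtain ⟨c, hc⟩ := exists_uniform_representative π
  refine ⟨2 * c + 1, fun n H hH => ?_⟩
  set X : Set Γ := {x | x ∈ H ∧ wordLength S x ≤ n} with hX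
  have hrep : ∀ g ∈ H, ∃ r ∈ H, wordLength S r ≤ c * n ∧ π r = π g := by
    intro g hg
    obtain ⟨l, hl, hlπ, hlc⟩ := hc X g (hH hg)
    have hl' : ∀ x ∈ l, x ∈ H ∧ wordLength S x ≤ n := fun x hx => by
      rcases hl x hx with h | h
      · exact h
      · exact ⟨by simpa using H.inv_mem h.1, by simpa [wordLength_inv hS] using h.2⟩
    refine ⟨l.prod, list_prod_mem fun x hx => (hl' x hx).1, ?_, hlπ⟩
    exact (wordLength_list_prod_le hS fun x hx => (hl' x hx).2).trans (Nat.mul_le_mul_right _ hlc)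
  have hle : c * n ≤ (2 * c + 1) * n := Nat.mul_le_mul_right _ (by omega)
  refine ⟨fun g hg => ?_, ?_⟩
  · obtain ⟨r, hr, hrl, hrπ⟩ := hrep g hg
    exact ⟨r, hr, hrl.trans hle, QuotientGroup.eq.1 hrπ⟩
  have hrep' : ∀ q : Γ ⧸ M, ∃ r ∈ H, wordLength S r ≤ c * n ∧ (q = 1 → r = 1) ∧
      (q ∈ H.map π → π r = q) := by
    intro q
    by_cases hq : q = 1
    · exact ⟨1, one_mem _, by simp, fun _ => rfl, fun _ => by simp [hq]⟩
    · by_cases hqH : q ∈ H.map π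
      · obtain ⟨g, hg, rfl⟩ := hqH
        obtain ⟨r, hr, hrl, hrπ⟩ := hrep g hg
        exact ⟨r, hr, hrl, fun h => absurd h hq, fun _ => hrπ⟩
      · exact ⟨1, one_mem _, by simp, fun _ => rfl, fun h => absurd h hqH⟩
  choose R hRH hRl hR1 hRπ using hrep'
  set U : Set Γ := {x | x ∈ H ⊓ M ∧ wordLength S x ≤ (2 * c + 1) * n} with hU
  have hXH : Subgroup.closure X ≤ H := (Subgroup.closure_le H).2 fun z hz => hz.1
  -- These are the Schreier generators of `H ∩ M`: two short representatives and one generator,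
  -- whence the constant `2 * c + 1`.
  have hstep : ∀ g ∈ H, ∀ y ∈ H, wordLength S y ≤ n →
      R (π g) * y * (R (π (g * y)))⁻¹ ∈ Subgroup.closure U := by
    intro g hg y hy hyl
    refine Subgroup.subset_closure ⟨Subgroup.mem_inf.2
      ⟨mul_mem (mul_mem (hRH _) hy) (inv_mem (hRH _)), ?_⟩, ?_⟩
    · rw [← QuotientGroup.eq_one_iff]
      change π _ = 1
      rw [map_mul, map_mul, map_inv, hRπ _ (Subgroup.mem_map_of_mem π hg),
        hRπ _ (Subgroup.mem_map_of_mem π (mul_mem hg hy)), map_mul]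
      group
    · have h1 := wordLength_mul_le hS (R (π g) * y) (R (π (g * y)))⁻¹
      have h2 := wordLength_mul_le hS (R (π g)) y
      have h3 := hRl (π g)
      have h4 := hRl (π (g * y))
      rw [wordLength_inv hS] at h1
      have : (2 * c + 1) * n = c * n + n + c * n := by ring
      omega
  have key : ∀ g ∈ Subgroup.closure X, ∃ u ∈ Subgroup.closure U, g = u * R (π g) := by
    have hstep' : ∀ g ∈ H, ∀ y ∈ H, wordLength S y ≤ n →
        (∃ u ∈ Subgroup.closure U, g = u * R (π g)) →
        ∃ u ∈ Subgroup.closure U, g * y = u * R (π (g * y)) := by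
      rintro g hg y hy hyl ⟨u, hu, hug⟩
      refine ⟨_, mul_mem hu (hstep g hg y hy hyl), ?_⟩
      conv_lhs => rw [hug]
      group
    intro g hg
    induction hg using Subgroup.closure_induction_right with
    | one => exact ⟨1, one_mem _, by rw [map_one, hR1 _ rfl, one_mul]⟩
    | mul_right x hx y hy ih => exact hstep' x (hXH hx) y hy.1 hy.2 ih
    | mul_inv_cancel x hx y hy ih =>
      exact hstep' x (hXH hx) y⁻¹ (inv_mem hy.1) ((wordLength_inv_le hS y).trans hy.2) ih
  rintro g ⟨hgH, hgM⟩
  obtain ⟨u, hu, hug⟩ := key g (hH hgH)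
  have hg1 : π g = 1 := (QuotientGroup.eq_one_iff _).2 hgM
  rw [hR1 _ hg1, mul_one] at hug
  rwa [hug]

theorem depth_le_of_comap (hj : Function.Injective j) {H : Subgroup Γ} {r : Γ} (hr : r ∈ H) {y : N}
    {d : ℕ} (h : depth (H.comap j) y ≤ d) :
    depth H (r * j y) ≤ (j.range.index * d ^ j.range.index : ℕ) := by
  obtain ⟨K₀, _, hK0, hKd, hsep⟩ := exists_normal_of_depth_le h
  obtain ⟨K, _, hK1, hK2, hK3⟩ := exists_normal_le_map hj K₀ hK0
  refine (depth_le_index K hK1 fun h hh hmem => ?_).trans ?_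
  · obtain ⟨k, hk, hke⟩ := hK3 hmem
    have hz : j (y * k⁻¹) = r⁻¹ * h := by rw [map_mul, map_inv, hke]; group
    refine hsep (y * k⁻¹) ?_ ?_
    · rw [Subgroup.mem_comap, hz]
      exact mul_mem (inv_mem hr) hh
    · have : (y * k⁻¹)⁻¹ * y = k := by group
      rwa [this]
  · exact_mod_cast hK2.trans (Nat.mul_le_mul_left _ (Nat.pow_le_pow_left hKd _))

/-- Separating an element from a subgroup of `Γ` reduces to the finite index subgroup `N`. -/
theorem exists_reduction (hj : Function.Injective j) {S : Finset Γ}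
    (hS : Subgroup.closure (S : Set Γ) = ⊤) {T : Finset N}
    (hT : Subgroup.closure (T : Set N) = ⊤) :
    ∃ C : ℕ, ∀ (n : ℕ) (H : Subgroup Γ), H ≤ Subgroup.closure {x | x ∈ H ∧ wordLength S x ≤ n} →
      subgroupNorm T (H.comap j) ≤ C * n ∧
      ∀ g, g ∉ H → wordLength S g ≤ n → depth H g ≤ j.range.index ∨
        ∃ y, y ∉ H.comap j ∧ wordLength T y ≤ C * n ∧
          ∀ d : ℕ, depth (H.comap j) y ≤ d →
            depth H g ≤ (j.range.index * d ^ j.range.index : ℕ) := by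
  obtain ⟨C, hC⟩ := exists_wordLength_le_mul hj hS hT
  obtain ⟨c, hc⟩ := exists_comap_generators (j := j) hS
  refine ⟨C * (c + 1), fun n H hH => ?_⟩
  obtain ⟨hrep, hgen⟩ := hc n H hH
  have hlen : ∀ y : N, wordLength S (j y) ≤ c * n + n →
      wordLength T y ≤ C * (c + 1) * n := fun y hy => by
    refine (hC y).trans ?_
    rw [mul_assoc, add_mul, one_mul]
    exact Nat.mul_le_mul_left _ hy
  refine ⟨subgroupNorm_le hT fun y hy => ?_, fun g hg hgn => ?_⟩
  · have h1 : j y ∈ Subgroup.closure {x | x ∈ H ⊓ j.range ∧ wordLength S x ≤ c * n} :=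
      hgen ⟨hy, y, rfl⟩
    have h2 : Subgroup.closure {x | x ∈ H ⊓ j.range ∧ wordLength S x ≤ c * n} ≤
        (Subgroup.closure {x | x ∈ H.comap j ∧ wordLength T x ≤ C * (c + 1) * n}).map j := by
      rw [Subgroup.closure_le]
      rintro _ ⟨⟨hx, z, rfl⟩, hxl⟩
      exact ⟨z, Subgroup.subset_closure ⟨hx, hlen z (by omega)⟩, rfl⟩
    obtain ⟨z, hz, hzy⟩ := h2 h1
    rwa [← hj hzy]
  -- If `g ∉ H M`, the quotient `Γ / M` itself separates; otherwise a short element of `H` moves `g`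
  -- into `M`.
  · by_cases hgM : ∃ h ∈ H, h⁻¹ * g ∈ j.range
    · right
      obtain ⟨h, hh, hgM⟩ := hgM
      obtain ⟨r, hr, hrl, hrh⟩ := hrep h hh
      have : r⁻¹ * g ∈ j.range := by
        have := mul_mem hrh hgM
        rwa [mul_assoc, mul_inv_cancel_left] at this
      obtain ⟨y, hy⟩ := this
      have hgy : g = r * j y := by rw [hy, mul_inv_cancel_left]
      refine ⟨y, fun hyH => hg ?_, hlen y ?_, fun d hd => ?_⟩
      · rw [hgy]; exact mul_mem hr hyH
      · rw [hy]
        have := wordLength_mul_le hS r⁻¹ g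
        rw [wordLength_inv hS] at this
        omega
      · rw [hgy]; exact depth_le_of_comap hj hr hd
    · left
      push Not at hgM
      exact depth_le_index j.range Subgroup.FiniteIndex.index_ne_zero hgM

end Reduction

/-! ### Growth estimates -/

section Growth

variable {G : Type*} [Group G] {S : Finset G}

theorem depth_le_farb {H : Subgroup G} {g : G} {n : ℕ} (hg : g ∉ H) (hn : wordLength S g ≤ n) :
    depth H g ≤ farb H S n :=
  le_iSup₂_of_le g hg (le_iSup_of_le hn le_rfl)

theorem depth_le_subSep {H : Subgroup G} {g : G} {n : ℕ} (hfg : H.FG) (hg : g ∉ H)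
    (hH : subgroupNorm S H ≤ n) (hn : wordLength S g ≤ n) : depth H g ≤ subSep G S n :=
  le_iSup₂_of_le H hfg (le_iSup₂_of_le g hg (le_iSup₂_of_le hH hn le_rfl))

theorem subSep_le {n : ℕ} {d : ℕ∞} (h : ∀ (H : Subgroup G) (g : G), H.FG → g ∉ H →
    subgroupNorm S H ≤ n → wordLength S g ≤ n → depth H g ≤ d) : subSep G S n ≤ d :=
  iSup₂_le fun H hfg => iSup₂_le fun g hg => iSup₂_le fun hH hn => h H g hfg hg hH hn

theorem farb_le {H : Subgroup G} {n : ℕ} {d : ℕ∞} (h : ∀ g, g ∉ H → wordLength S g ≤ n →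
    depth H g ≤ d) : farb H S n ≤ d :=
  iSup₂_le fun g hg => iSup_le fun hn => h g hg hn

theorem subSep_zero (hS : Subgroup.closure (S : Set G) = ⊤) : subSep G S 0 = 0 :=
  nonpos_iff_eq_zero.1 <| subSep_le fun H g _ hg _ h0 => absurd
    (by rw [eq_one_of_wordLength_eq_zero hS (Nat.le_zero.1 h0)]; exact one_mem H) hg

theorem farb_zero (hS : Subgroup.closure (S : Set G) = ⊤) (H : Subgroup G) : farb H S 0 = 0 :=
  nonpos_iff_eq_zero.1 <| farb_le fun g hg h0 => absurd
    (by rw [eq_one_of_wordLength_eq_zero hS (Nat.le_zero.1 h0)]; exact one_mem H) hg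

theorem toENNReal_le_natCast {x : ℕ∞} {n : ℕ} (h : x ≤ n) : (x : ℝ≥0∞) ≤ n := by
  simpa using ENat.toENNReal_le.2 h

theorem natCast_le_toENNReal {x : ℕ∞} {n : ℕ} (h : (n : ℕ∞) ≤ x) : (n : ℝ≥0∞) ≤ x := by
  simpa using ENat.toENNReal_le.2 h

theorem growthLE_pow {f : ℕ → ℕ∞} {A k : ℕ} (h0 : f 0 = 0)
    (h : ∀ n, 1 ≤ n → f n ≤ (A * n ^ k : ℕ)) :
    GrowthLE (fun n => (f n : ℝ≥0∞)) fun n => (n : ℝ≥0∞) ^ k := by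
  refine ⟨A + 1, fun n => ?_⟩
  rcases Nat.eq_zero_or_pos n with rfl | hn
  · simp [h0]
  refine (toENNReal_le_natCast (h n hn)).trans ?_
  have : A * n ^ k ≤ (A + 1) * ((A + 1) * n) ^ k := by
    gcongr
    · omega
    · exact Nat.le_mul_of_pos_left _ (by omega)
  dsimp only
  exact_mod_cast this

theorem growthLE_log_pow {f : ℕ → ℕ∞} {A e E : ℕ} (heE : e ≤ E) (h0 : f 0 = 0)
    (h : ∀ n, 1 ≤ n → f n ≤ (A * (Nat.log 2 n + 1) ^ e : ℕ)) :
    GrowthLE (fun n => (f n : ℝ≥0∞)) fun n => logFun n ^ E := by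
  refine ⟨A * 2 ^ E + 3, fun n => ?_⟩
  rcases Nat.eq_zero_or_pos n with rfl | hn
  · simp [h0]
  refine (toENNReal_le_natCast (h n hn)).trans ?_
  -- The factor `2 ^ E` pays for passing from base `2` to natural logarithms; the summand `3` gives
  -- `log 3 ≥ 1`, which absorbs the `+ 1` and keeps the right side positive at `n = 1`.
  set C := A * 2 ^ E + 3 with hC
  have hn' : (1 : ℝ) ≤ n := by exact_mod_cast hn
  have hlog : ((Nat.log 2 n + 1 : ℕ) : ℝ) ≤ 2 * Real.log ((C * n : ℕ) : ℝ) := by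
    have h1 : (Nat.log 2 n : ℝ) * Real.log 2 ≤ Real.log n := by
      rw [← Real.log_pow]
      refine Real.log_le_log (by positivity) ?_
      exact_mod_cast Nat.pow_log_le_self 2 hn.ne'
    have h2 : (1 : ℝ) / 2 ≤ Real.log 2 := by have := Real.log_two_gt_d9; linarith
    have h3 : (1 : ℝ) ≤ Real.log 3 := by
      rw [Real.le_log_iff_exp_le (by norm_num)]
      exact Real.exp_one_lt_d9.le.trans (by norm_num)
    have h4 : Real.log 3 + Real.log n ≤ Real.log ((C * n : ℕ) : ℝ) := by
      rw [← Real.log_mul (by norm_num) (by positivity)]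
      refine Real.log_le_log (by positivity) ?_
      push_cast
      gcongr
      have : 3 ≤ C := by omega
      exact_mod_cast this
    have h5 : (Nat.log 2 n : ℝ) * (1 / 2) ≤ (Nat.log 2 n : ℝ) * Real.log 2 := by gcongr
    push_cast at h4 ⊢
    linarith
  have hlog0 : 0 ≤ Real.log ((C * n : ℕ) : ℝ) := Real.log_natCast_nonneg _
  have hfin : ((A * (Nat.log 2 n + 1) ^ e : ℕ) : ℝ) ≤ C * Real.log ((C * n : ℕ) : ℝ) ^ E := by
    have h1 : (Nat.log 2 n + 1) ^ e ≤ (Nat.log 2 n + 1) ^ E :=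
      Nat.pow_le_pow_right (by omega) heE
    have h2 : ((Nat.log 2 n + 1 : ℕ) : ℝ) ^ E ≤ (2 * Real.log ((C * n : ℕ) : ℝ)) ^ E := by gcongr
    have h3 : ((A * (Nat.log 2 n + 1) ^ e : ℕ) : ℝ) ≤ A * ((Nat.log 2 n + 1 : ℕ) : ℝ) ^ E := by
      exact_mod_cast Nat.mul_le_mul_left A h1
    refine h3.trans ((mul_le_mul_of_nonneg_left h2 (Nat.cast_nonneg A)).trans ?_)
    rw [mul_pow, ← mul_assoc]
    refine mul_le_mul_of_nonneg_right ?_ (by positivity)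
    have : A * 2 ^ E ≤ C := by omega
    exact_mod_cast this
  dsimp only [logFun]
  rw [← ENNReal.ofReal_pow hlog0, ← ENNReal.ofReal_natCast (A * _),
    ← ENNReal.ofReal_natCast C, ← ENNReal.ofReal_mul (Nat.cast_nonneg C)]
  exact ENNReal.ofReal_le_ofReal hfin

/-! ### Lower bounds -/

theorem growthLE_subSep (hS : Subgroup.closure (S : Set G) = ⊤) {x : G} (hx : ¬ IsOfFinOrder x) :
    GrowthLE (fun n => (n : ℝ≥0∞)) fun n => (subSep G S n : ℝ≥0∞) := by
  refine ⟨2 * wordLength S x + 1, fun n => ?_⟩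
  rcases Nat.eq_zero_or_pos n with rfl | hn
  · simp
  set i := Nat.log 2 n with hi
  have h1 : 2 ^ i ≤ n := Nat.pow_log_le_self 2 hn.ne'
  have h2 : n < 2 ^ (i + 1) := Nat.lt_pow_succ_log_self (by norm_num) n
  set H := Subgroup.zpowers (x ^ 2 ^ (i + 1)) with hH
  have hinj := injective_zpow_iff_not_isOfFinOrder.2 hx
  have hg : x ^ 2 ^ i ∉ H := by
    rintro ⟨a, ha⟩
    have h3 : x ^ (((2 ^ (i + 1) : ℕ) : ℤ) * a) = x ^ ((2 ^ i : ℕ) : ℤ) := by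
      rw [zpow_mul, zpow_natCast, zpow_natCast]
      exact ha
    have h4 := hinj h3
    push_cast at h4
    rw [pow_succ, mul_assoc] at h4
    have h5 : (2 : ℤ) ^ i ≠ 0 := by positivity
    have h6 : (2 : ℤ) * a = 1 := mul_left_cancel₀ h5 (by rw [h4, mul_one])
    omega
  have hlen : ∀ k, k ≤ i + 1 → wordLength S (x ^ 2 ^ k) ≤ (2 * wordLength S x + 1) * n := by
    intro k hk
    refine (wordLength_pow_le hS x _).trans ?_
    have h3 : 2 ^ k ≤ 2 * n :=
      (Nat.pow_le_pow_right (by norm_num) hk).trans (by rw [pow_succ]; omega)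
    calc 2 ^ k * wordLength S x ≤ 2 * n * wordLength S x := Nat.mul_le_mul_right _ h3
      _ ≤ _ := by nlinarith
  have hnorm : subgroupNorm S H ≤ (2 * wordLength S x + 1) * n := by
    refine subgroupNorm_le hS ?_
    rw [hH, Subgroup.zpowers_le]
    exact Subgroup.subset_closure ⟨Subgroup.mem_zpowers _, hlen _ le_rfl⟩
  -- Unless `2 ^ (i + 1)` divides the order of `π x`, Bézout shows that a power `π x ^ 2 ^ k` with
  -- `k ≤ i` lies in the image of `H`, hence so does the image of `x ^ 2 ^ i`.
  have hdepth : ((2 ^ (i + 1) : ℕ) : ℕ∞) ≤ depth H (x ^ 2 ^ i) := by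
    refine le_depth fun Q _ _ π hπ => ?_
    by_contra hcard
    refine hπ ?_
    have h3 : ¬ 2 ^ (i + 1) ∣ orderOf (π x) := fun h =>
      hcard (Nat.le_of_dvd Nat.card_pos (h.trans (orderOf_dvd_natCard _)))
    obtain ⟨k, hk, hgcd⟩ := (Nat.dvd_prime_pow Nat.prime_two).1
      (Nat.gcd_dvd_left (2 ^ (i + 1)) (orderOf (π x)))
    have hki : k ≤ i := by
      by_contra hki
      have : k = i + 1 := by omega
      rw [this] at hgcd
      exact h3 (hgcd ▸ Nat.gcd_dvd_right _ _)
    have h4 : π x ^ 2 ^ k ∈ H.map π := by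
      refine ⟨(x ^ 2 ^ (i + 1)) ^ (Nat.gcdA (2 ^ (i + 1)) (orderOf (π x))),
        ⟨_, rfl⟩, ?_⟩
      have h5 := Nat.gcd_eq_gcd_ab (2 ^ (i + 1)) (orderOf (π x))
      rw [map_zpow, map_pow, ← zpow_natCast (π x) (2 ^ k), ← hgcd, h5, zpow_add, zpow_mul, zpow_mul,
        zpow_natCast, zpow_natCast, pow_orderOf_eq_one, one_zpow, mul_one]
    rw [map_pow, ← Nat.add_sub_cancel' hki, pow_add, pow_mul]
    exact pow_mem h4 _
  have hfg : H.FG := ⟨{x ^ 2 ^ (i + 1)}, by rw [Finset.coe_singleton, hH,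
    Subgroup.zpowers_eq_closure]⟩
  have h6 := hdepth.trans (depth_le_subSep hfg hg hnorm (hlen i (by omega)))
  have h7 : ((n : ℕ) : ℝ≥0∞) ≤ subSep G S ((2 * wordLength S x + 1) * n) :=
    natCast_le_toENNReal (le_trans (by exact_mod_cast h2.le) h6)
  refine h7.trans (le_mul_of_one_le_left zero_le ?_)
  exact_mod_cast (by omega : 1 ≤ 2 * wordLength S x + 1)

/-- Chebyshev's upper bound `ψ(r) = O(r)`, exponentiated. -/
theorem exists_lcmUpto_le_pow : ∃ A : ℕ, 2 ≤ A ∧ ∀ r, Nat.lcmUpto r ≤ A ^ r := by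
  obtain ⟨A, hA⟩ := exists_nat_ge (Real.exp (Real.log 4 + 4))
  refine ⟨A + 2, by omega, fun r => ?_⟩
  have h1 : Real.log (Nat.lcmUpto r) ≤ r * Real.log ((A + 2 : ℕ) : ℝ) := by
    rw [← Chebyshev.psi_eq_log_lcmUpto]
    refine (Chebyshev.psi_le_const_mul_self (Nat.cast_nonneg r)).trans ?_
    rw [mul_comm]
    gcongr
    rw [Real.le_log_iff_exp_le (by positivity)]
    push_cast
    linarith
  rw [← Real.log_pow, Real.log_le_log_iff (by exact_mod_cast Nat.lcmUpto_pos r) (by positivity)]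
    at h1
  exact_mod_cast h1

theorem growthLE_farb (hS : Subgroup.closure (S : Set G) = ⊤) {H : Subgroup G} {x : G}
    (hx : ∀ k : ℕ, k ≠ 0 → x ^ k ∉ H) :
    GrowthLE logFun fun n => (farb H S n : ℝ≥0∞) := by
  obtain ⟨A, hA, hlcm⟩ := exists_lcmUpto_le_pow
  obtain ⟨B, hB⟩ := exists_nat_ge (Real.log A)
  refine ⟨wordLength S x + B, fun n => ?_⟩
  rcases Nat.eq_zero_or_pos n with rfl | hn
  · simp [logFun]
  set r := Nat.log A n with hr
  have h1 : A ^ r ≤ n := Nat.pow_log_le_self A hn.ne'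
  have h2 : n < A ^ (r + 1) := Nat.lt_pow_succ_log_self (by omega) n
  -- Trivial in every group of order at most `r`, yet of length `O(A ^ r)`, hence `O(n)`.
  set g := x ^ Nat.lcmUpto r with hg
  have hgH : g ∉ H := hx _ (Nat.lcmUpto_ne_zero r)
  have hlen : wordLength S g ≤ (wordLength S x + B) * n := by
    refine (wordLength_pow_le hS x _).trans ?_
    rw [mul_comm, add_mul]
    exact (Nat.mul_le_mul_left _ ((hlcm r).trans h1)).trans (Nat.le_add_right _ _)
  have hdepth : ((r + 1 : ℕ) : ℕ∞) ≤ depth H g := by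
    refine le_depth fun Q _ _ π hπ => ?_
    by_contra hcard
    refine hπ ?_
    have h3 : Nat.card Q ∣ Nat.lcmUpto r :=
      Finset.dvd_lcm (f := id) (Finset.mem_Icc.2 ⟨Nat.card_pos, Nat.lt_succ_iff.1 (not_le.1 hcard)⟩)
    have : π g = 1 := by
      rw [hg, map_pow]
      exact orderOf_dvd_iff_pow_eq_one.1 ((orderOf_dvd_natCard _).trans h3)
    rw [this]
    exact one_mem _
  have h4 : ((r + 1 : ℕ) : ℝ≥0∞) ≤ farb H S ((wordLength S x + B) * n) :=
    natCast_le_toENNReal (hdepth.trans (depth_le_farb hgH hlen))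
  have h5 : Real.log n ≤ (B * (r + 1) : ℕ) := by
    have : Real.log n ≤ (r + 1 : ℕ) * Real.log A := by
      rw [← Real.log_pow]
      refine Real.log_le_log (by exact_mod_cast hn) ?_
      exact_mod_cast h2.le
    refine this.trans ?_
    push_cast
    rw [mul_comm]
    gcongr
  calc logFun n ≤ ENNReal.ofReal ((B * (r + 1) : ℕ) : ℝ) := ENNReal.ofReal_le_ofReal h5
    _ = (B : ℝ≥0∞) * ((r + 1 : ℕ) : ℝ≥0∞) := by rw [ENNReal.ofReal_natCast, Nat.cast_mul]
    _ ≤ _ := by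
      refine mul_le_mul' ?_ h4
      exact_mod_cast Nat.le_add_left _ _

end Growth

/-! ### Upper bounds for nilpotent groups -/

section Upper

variable {N : Type u} [Group N] [Group.FG N] [Group.IsNilpotent N]

theorem exists_powSub_separating_of_torsionFree (hN : ∀ g : N, g ≠ 1 → ¬ IsOfFinOrder g)
    {T : Finset N} (hT : Subgroup.closure (T : Set N) = ⊤) :
    ∃ p : ℕ → ℕ, PolyBdd p ∧ ∀ (n : ℕ) (H : Subgroup N), subgroupNorm T H ≤ n → ∀ g, g ∉ H →
      wordLength T g ≤ n → ∃ m, 0 < m ∧ m ≤ p n ∧ ∀ h ∈ H, h⁻¹ * g ∉ powSub N m := by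
  obtain ⟨r, hr⟩ := exists_intChain (⊥ : Subgroup N)
  obtain ⟨p, hp, h⟩ := exists_powSub_separating r N hN hr T hT
  exact ⟨p, hp, fun n H hH => h n H (le_closure_of_subgroupNorm_le (fg_subgroup H) hH)⟩

theorem exists_subSep_le (hN : ∀ g : N, g ≠ 1 → ¬ IsOfFinOrder g)
    {T : Finset N} (hT : Subgroup.closure (T : Set N) = ⊤) :
    ∃ A k : ℕ, ∀ n, 1 ≤ n → subSep N T n ≤ (A * n ^ k : ℕ) := by
  obtain ⟨p, hp, hsep⟩ := exists_powSub_separating_of_torsionFree hN hT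
  obtain ⟨C, hC⟩ := powSub_index_le N
  obtain ⟨A, k, hA⟩ := (polyBdd_const C).mul (hp.pow (hirschLength N))
  refine ⟨A * 2 ^ k, k, fun n hn => subSep_le fun H g hfg hg hH hgn => ?_⟩
  obtain ⟨m, hm, hmp, hms⟩ := hsep n H hH g hg hgn
  obtain ⟨h1, h2⟩ := hC m hm
  refine (depth_le_index (powSub N m) h1 hms).trans ?_
  have h3 : C * m ^ hirschLength N ≤ C * p n ^ hirschLength N := by gcongr
  have h4 : A * (n + 1) ^ k ≤ A * 2 ^ k * n ^ k := by
    rw [mul_assoc, ← mul_pow]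
    gcongr
    omega
  exact_mod_cast h2.trans (h3.trans ((hA n).trans h4))

/-- If all integers up to `2 * L + 2` divided `a`, so would their least common multiple, which by
Chebyshev's lower bound exceeds `2 ^ L > a`. -/
theorem exists_not_dvd_le {a : ℕ} (ha : a ≠ 0) :
    ∃ m, 0 < m ∧ ¬ m ∣ a ∧ m ≤ 2 * (Nat.log 2 a + 1) + 2 := by
  by_contra! h
  set L := Nat.log 2 a + 1 with hL
  have h1 : Nat.lcmUpto (2 * L + 2) ∣ a := Finset.lcm_dvd fun m hm => by
    rw [Finset.mem_Icc] at hm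
    by_contra hdvd
    have := h m hm.1 hdvd
    omega
  have h2 := Nat.le_of_dvd (Nat.pos_of_ne_zero ha) h1
  have h3 : a < 2 ^ L := Nat.lt_pow_succ_log_self (by norm_num) a
  have h4 := Chebyshev.two_pow_le_mul_lcmUpto (2 * L + 2)
  have h5 : L < 2 ^ L := Nat.lt_two_pow_self
  have h6 : (2 * L + 2 + 1) * Nat.lcmUpto (2 * L + 2) ≤ (2 * L + 2 + 1) * 2 ^ L :=
    Nat.mul_le_mul_left _ (h2.trans h3.le)
  have h7 : 2 ^ (2 * L + 2) = 4 * 2 ^ L * 2 ^ L := by rw [pow_add, two_mul, pow_add]; ring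
  have h8 : (2 * L + 2 + 1) * 2 ^ L < 4 * 2 ^ L * 2 ^ L := by
    refine Nat.mul_lt_mul_of_pos_right ?_ (by positivity)
    omega
  omega

theorem log_le_of_polyBdd {p : ℕ → ℕ} (hp : PolyBdd p) :
    ∃ c : ℕ, ∀ n a, 1 ≤ n → a ≤ p n → Nat.log 2 a ≤ c * (Nat.log 2 n + 1) := by
  obtain ⟨C, k, hC⟩ := hp
  refine ⟨C + k, fun n a hn ha => ?_⟩
  set l := Nat.log 2 n + 1 with hl
  have h1 : n + 1 ≤ 2 ^ l := Nat.lt_pow_succ_log_self (by norm_num) n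
  have h2 : a ≤ 2 ^ ((C + k) * l) := by
    refine ha.trans ((hC n).trans ?_)
    rw [add_mul, pow_add]
    refine Nat.mul_le_mul ?_ ?_
    · exact Nat.lt_two_pow_self.le.trans
        (Nat.pow_le_pow_right (by norm_num) (Nat.le_mul_of_pos_right _ (by omega)))
    · rw [mul_comm k, pow_mul]
      exact Nat.pow_le_pow_left h1 k
  calc Nat.log 2 a ≤ Nat.log 2 (2 ^ ((C + k) * l)) := Nat.log_mono_right h2
    _ = _ := Nat.log_pow (by norm_num) _

/-- In a torsion-free finitely generated nilpotent group, a fixed subgroup `H` is separated from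
elements of length `n` by quotients of order `O((log n) ^ h(N))`. -/
theorem exists_depth_le_log (hN : ∀ g : N, g ≠ 1 → ¬ IsOfFinOrder g)
    {T : Finset N} (hT : Subgroup.closure (T : Set N) = ⊤) (H : Subgroup N) :
    ∃ A : ℕ, ∀ n g, 1 ≤ n → g ∉ H → wordLength T g ≤ n →
      depth H g ≤ (A * (Nat.log 2 n + 1) ^ hirschLength N : ℕ) := by
  obtain ⟨r, hr⟩ := exists_intChain H
  obtain ⟨R, D, p, hHR, hrel, hD, hp, hsep⟩ := exists_separating_integer r N H hr N T hT
    (MonoidHom.id N) (extendsPoly_id N)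
  obtain ⟨P, hPm, hP, hPle⟩ := hp.exists_monotone
  obtain ⟨c, hc⟩ := log_le_of_polyBdd hP
  obtain ⟨C, hC⟩ := powSub_index_le N
  obtain ⟨q, -, hq⟩ := exists_powSub_separating_of_torsionFree hN hT
  have hfin : ∀ g, ∃ d : ℕ, g ∉ H → depth H g ≤ d := fun g => by
    by_cases hg : g ∈ H
    · exact ⟨0, fun h => absurd hg h⟩
    · obtain ⟨m, hm, -, hms⟩ := hq _ H (le_max_left _ (wordLength T g)) g hg (le_max_right _ _)
      exact ⟨_, fun _ => depth_le_index (powSub N m) (hC m hm).1 hms⟩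
  choose d hd using hfin
  have : Finite (R ⧸ H.subgroupOf R) := Nat.finite_of_card_ne_zero hrel
  -- Depth is constant on left cosets of `H`, so elements of `R` outside `H` have bounded depth.
  obtain ⟨A₀, hA₀⟩ := (Set.finite_range fun x : R ⧸ H.subgroupOf R => d x.out).bddAbove
  refine ⟨A₀ + C * (D * (2 * (c + 1) + 2)) ^ hirschLength N, fun n g hn hg hgn => ?_⟩
  set l := Nat.log 2 n + 1 with hl
  have hl1 : 1 ≤ l ^ hirschLength N := Nat.one_le_pow _ _ (by omega)
  by_cases hgR : g ∈ R
  · set o : R := (QuotientGroup.mk (⟨g, hgR⟩ : R) : R ⧸ H.subgroupOf R).out with ho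
    have h1 : o⁻¹ * ⟨g, hgR⟩ ∈ H.subgroupOf R := by
      rw [← QuotientGroup.eq, ho, QuotientGroup.out_eq']
    have h2 : g = (o : N) * ((o : N)⁻¹ * g) := by group
    have h3 : (o : N)⁻¹ * g ∈ H := h1
    have h4 : (o : N) ∉ H := fun h => hg (by rw [h2]; exact mul_mem h h3)
    rw [h2, depth_mul_right h3]
    refine (hd _ h4).trans ?_
    have h5 : d o ≤ A₀ := hA₀ ⟨_, rfl⟩
    have h6 : A₀ ≤ (A₀ + C * (D * (2 * (c + 1) + 2)) ^ hirschLength N) * l ^ hirschLength N := by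
      rw [add_mul]
      exact (Nat.le_mul_of_pos_right _ hl1).trans (Nat.le_add_right _ _)
    exact_mod_cast h5.trans h6
  · obtain ⟨a, ha0, hap, ha⟩ := hsep g hgR
    obtain ⟨m, hm, hma, hml⟩ := exists_not_dvd_le ha0
    have h1 : Nat.log 2 a ≤ c * l := hc n a hn (hap.trans ((hPle _).trans (hPm hgn)))
    have h2 : m ≤ (2 * (c + 1) + 2) * l := by
      have : 1 ≤ l := by omega
      have e : (2 * (c + 1) + 2) * l = 2 * (c * l) + 4 * l := by ring
      omega
    obtain ⟨h3, h4⟩ := hC (D * m) (by positivity)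
    refine (depth_le_index (powSub N (D * m)) h3 fun h hh hmem => hma (ha m h hh hmem)).trans ?_
    have h5 : C * (D * m) ^ hirschLength N ≤
        C * (D * (2 * (c + 1) + 2)) ^ hirschLength N * l ^ hirschLength N := by
      rw [mul_assoc, ← mul_pow, mul_assoc D]
      gcongr
    have h6 : C * (D * (2 * (c + 1) + 2)) ^ hirschLength N * l ^ hirschLength N ≤
        (A₀ + C * (D * (2 * (c + 1) + 2)) ^ hirschLength N) * l ^ hirschLength N := by
      gcongr
      omega
    exact_mod_cast h4.trans (h5.trans h6)

end Upper

/-! ### Virtually nilpotent groups -/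

section Virtual

variable {Γ : Type*} {N : Type u} [Group Γ] [Group N] [Group.FG N] [Group.IsNilpotent N]
  {j : N →* Γ} [j.range.Normal] [j.range.FiniteIndex]

theorem growthLE_farb_upper (hN : ∀ g : N, g ≠ 1 → ¬ IsOfFinOrder g)
    (hj : Function.Injective j) {S : Finset Γ} (hS : Subgroup.closure (S : Set Γ) = ⊤)
    (H : Subgroup Γ) (hfg : H.FG) :
    GrowthLE (fun n => (farb H S n : ℝ≥0∞))
      fun n => logFun n ^ (hirschLength N * j.range.index ^ 2) := by
  obtain ⟨T, hT⟩ := (Group.fg_def (G := N)).1 inferInstance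
  set i := j.range.index with hi
  have hi1 : 1 ≤ i := Nat.one_le_iff_ne_zero.2 Subgroup.FiniteIndex.index_ne_zero
  obtain ⟨A, hA⟩ := exists_depth_le_log hN hT (H.comap j)
  obtain ⟨C, hC⟩ := exists_reduction hj hS hT
  set n₀ := subgroupNorm S H with hn₀
  set q := C * (n₀ + 1) with hq
  have hlogq : ∀ n, 1 ≤ n → Nat.log 2 (q * n) + 1 ≤ (q + 1) * (Nat.log 2 n + 1) := by
    intro n hn
    have h1 : q * n < 2 ^ (q + (Nat.log 2 n + 1)) := by
      rw [pow_add]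
      exact Nat.mul_lt_mul'' Nat.lt_two_pow_self (Nat.lt_pow_succ_log_self (by norm_num) n)
    have h2 : Nat.log 2 (q * n) < q + (Nat.log 2 n + 1) :=
      Nat.log_lt_of_lt_pow' (by omega) h1
    nlinarith
  -- The conjugation argument yields the exponent `h(N) * i`, which is at most `h(N) * i ^ 2`. The
  -- norm of the fixed `H` enters only through the constant `q`.
  refine growthLE_log_pow (A := i + i * (A * (q + 1) ^ hirschLength N) ^ i)
    (e := hirschLength N * i) (Nat.mul_le_mul_left _ (Nat.le_self_pow (by norm_num) i))
    (farb_zero hS H) fun n hn => farb_le fun g hg hgn => ?_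
  set l := Nat.log 2 n + 1 with hl
  have hH : H ≤ Subgroup.closure {x | x ∈ H ∧ wordLength S x ≤ n₀ + n} :=
    le_closure_of_subgroupNorm_le hfg (Nat.le_add_right _ _)
  have hl1 : 1 ≤ l ^ (hirschLength N * i) := Nat.one_le_pow _ _ (by omega)
  rcases (hC _ H hH).2 g hg (hgn.trans (Nat.le_add_left _ _)) with h | ⟨y, hy, hyl, hyd⟩
  · refine h.trans ?_
    have : i ≤ (i + i * (A * (q + 1) ^ hirschLength N) ^ i) * l ^ (hirschLength N * i) := by
      rw [add_mul]
      exact (Nat.le_mul_of_pos_right _ hl1).trans (Nat.le_add_right _ _)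
    exact_mod_cast this
  · have h1 : wordLength T y ≤ q * n := by
      refine hyl.trans ?_
      rw [hq, mul_assoc]
      refine Nat.mul_le_mul_left _ ?_
      rw [add_mul, one_mul]
      exact Nat.add_le_add_right (Nat.le_mul_of_pos_right _ hn) _
    have h2 : depth (H.comap j) y ≤ (A * ((q + 1) * l) ^ hirschLength N : ℕ) := by
      have hqn : 1 ≤ q * n := Nat.one_le_iff_ne_zero.2 fun h => hy <| by
        rw [eq_one_of_wordLength_eq_zero hT (Nat.le_zero.1 (h1.trans h.le))]
        exact one_mem _
      refine (hA (q * n) y hqn hy h1).trans ?_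
      have := Nat.mul_le_mul_left A (Nat.pow_le_pow_left (hlogq n hn) (hirschLength N))
      exact_mod_cast this
    refine (hyd _ h2).trans ?_
    have h3 : i * (A * ((q + 1) * l) ^ hirschLength N) ^ i ≤
        (i + i * (A * (q + 1) ^ hirschLength N) ^ i) * l ^ (hirschLength N * i) := by
      have e : i * (A * ((q + 1) * l) ^ hirschLength N) ^ i =
          i * (A * (q + 1) ^ hirschLength N) ^ i * l ^ (hirschLength N * i) := by
        rw [mul_pow (q + 1), ← mul_assoc A, mul_pow _ (l ^ hirschLength N), ← pow_mul, ← mul_assoc]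
      rw [e, add_mul]
      exact Nat.le_add_left _ _
    exact_mod_cast h3

theorem growthLE_subSep_upper (hj : Function.Injective j) {S : Finset Γ}
    (hS : Subgroup.closure (S : Set Γ) = ⊤) {T : Finset N}
    (hT : Subgroup.closure (T : Set N) = ⊤) {k : ℕ}
    (hk : GrowthLE (fun n => (subSep N T n : ℝ≥0∞)) fun n => (n : ℝ≥0∞) ^ k) :
    GrowthLE (fun n => (subSep Γ S n : ℝ≥0∞)) fun n => (n : ℝ≥0∞) ^ (k * j.range.index ^ 2) := by
  set i := j.range.index with hi
  have hi1 : 1 ≤ i := Nat.one_le_iff_ne_zero.2 Subgroup.FiniteIndex.index_ne_zero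
  obtain ⟨C, hC⟩ := exists_reduction hj hS hT
  obtain ⟨B, hB⟩ := hk
  refine growthLE_pow (A := i + i * (B * (B * C) ^ k) ^ i) (subSep_zero hS) fun n hn =>
    subSep_le fun H g hfg hg hH hgn => ?_
  obtain ⟨hnorm, hred⟩ := hC n H (le_closure_of_subgroupNorm_le hfg hH)
  have hn1 : ∀ e, 1 ≤ n ^ e := fun e => Nat.one_le_pow _ _ hn
  rcases hred g hg hgn with h | ⟨y, hy, hyl, hyd⟩
  · refine h.trans ?_
    have : i ≤ (i + i * (B * (B * C) ^ k) ^ i) * n ^ (k * i ^ 2) := by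
      rw [add_mul]
      exact (Nat.le_mul_of_pos_right _ (hn1 _)).trans (Nat.le_add_right _ _)
    exact_mod_cast this
  · have h1 := depth_le_subSep (fg_subgroup (H.comap j)) hy hnorm hyl
    have h2 : subSep N T (C * n) ≤ (B * (B * (C * n)) ^ k : ℕ) := by
      have := hB (C * n)
      rw [← ENat.toENNReal_le]
      simpa using this
    refine (hyd _ (h1.trans h2)).trans ?_
    have h3 : i * (B * (B * (C * n)) ^ k) ^ i ≤
        (i + i * (B * (B * C) ^ k) ^ i) * n ^ (k * i ^ 2) := by
      have e : i * (B * (B * (C * n)) ^ k) ^ i = i * (B * (B * C) ^ k) ^ i * n ^ (k * i) := by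
        rw [← mul_assoc B C, mul_pow (B * C), ← mul_assoc B ((B * C) ^ k), mul_pow _ (n ^ k),
          ← pow_mul, ← mul_assoc]
      rw [e, add_mul]
      refine le_trans ?_ (Nat.le_add_left _ _)
      refine Nat.mul_le_mul_left _ (Nat.pow_le_pow_right hn ?_)
      exact Nat.mul_le_mul_left _ (Nat.le_self_pow (by norm_num) i)
    exact_mod_cast h3

theorem growthLE_farb_lower (j : N →* Γ) [j.range.FiniteIndex] {S : Finset Γ}
    (hS : Subgroup.closure (S : Set Γ) = ⊤) {H : Subgroup Γ} (hH : ¬ H.FiniteIndex) :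
    GrowthLE logFun fun n => (farb H S n : ℝ≥0∞) := by
  have h0 : (H.comap j).index = 0 := by
    by_contra h
    refine hH ⟨fun h1 => ?_⟩
    have h2 : H.relIndex j.range ≠ 0 := by
      rwa [Subgroup.index_comap] at h
    have h3 : j.range.relIndex ⊤ ≠ 0 := by
      rw [Subgroup.relIndex_top_right]; exact Subgroup.FiniteIndex.index_ne_zero
    have := Subgroup.relIndex_ne_zero_trans h2 h3
    rw [Subgroup.relIndex_top_right] at this
    exact this h1
  -- A lift `t` of the generator of `ℤ` has no nontrivial power in the preimage of `H`, which is
  -- what `growthLE_farb` needs.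
  obtain ⟨φ, hφ, hle⟩ := exists_surjective_int_of_index_eq_zero _ h0
  obtain ⟨t, ht⟩ := hφ (Multiplicative.ofAdd 1)
  refine growthLE_farb hS (x := j t) fun k hk hmem => hk ?_
  rw [← map_pow] at hmem
  have h1 : φ (t ^ k) = 1 := hle hmem
  have h2 := congrArg Multiplicative.toAdd h1
  rw [map_pow, ht] at h2
  simpa using h2

end Virtual

end EffSep

theorem mainTheorem5 {Γ N : Type*} [Group Γ] [Infinite Γ] (S : Finset Γ)
    (hS : Subgroup.closure (S : Set Γ) = ⊤)
    [Group N] [Group.FG N] [Group.IsNilpotent N]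
    (hN : ∀ g : N, g ≠ 1 → ¬ IsOfFinOrder g)
    (M : Subgroup Γ) [M.Normal] [M.FiniteIndex] (e : N ≃* M) :
    (∀ H : Subgroup Γ, H.FG → ¬ H.FiniteIndex →
      EffSep.GrowthLE EffSep.logFun (fun n => (EffSep.farb H S n : ENNReal)) ∧
      EffSep.GrowthLE (fun n => (EffSep.farb H S n : ENNReal))
        (fun n => EffSep.logFun n ^ (EffSep.hirschLength N * M.index ^ 2))) ∧
    EffSep.GrowthLE (fun n => (n : ENNReal)) (fun n => (EffSep.subSep Γ S n : ENNReal)) ∧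
    (∀ T : Finset N, Subgroup.closure (T : Set N) = ⊤ →
      (∃ k : ℕ,
        EffSep.GrowthLE (fun n => (n : ENNReal)) (fun n => (EffSep.subSep N T n : ENNReal)) ∧
        EffSep.GrowthLE (fun n => (EffSep.subSep N T n : ENNReal))
          (fun n => (n : ENNReal) ^ k)) ∧
      (∀ k : ℕ,
        EffSep.GrowthLE (fun n => (EffSep.subSep N T n : ENNReal))
          (fun n => (n : ENNReal) ^ k) →
        EffSep.GrowthLE (fun n => (EffSep.subSep Γ S n : ENNReal))
          (fun n => (n : ENNReal) ^ (k * M.index ^ 2)))) := by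
  set j : N →* Γ := M.subtype.comp e.toMonoidHom with hj
  have hjinj : Function.Injective j := M.subtype_injective.comp e.injective
  have hjM : j.range = M := by
    rw [hj, MonoidHom.range_comp, MonoidHom.range_eq_top.2 e.surjective, ← MonoidHom.range_eq_map,
      M.range_subtype]
  have : j.range.Normal := hjM ▸ inferInstance
  have : j.range.FiniteIndex := hjM ▸ inferInstance
  -- A trivial `N` of finite index would make `Γ` finite; any nontrivial element then has infinite
  -- order and feeds the lower bounds for `Sub`.
  have hnontriv : ∃ x : N, x ≠ 1 := by
    by_contra! h
    have : Subsingleton N := ⟨fun a b => (h a).trans (h b).symm⟩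
    have : Finite M := Finite.of_equiv N e.toEquiv
    have h1 := M.card_mul_index
    rw [Nat.card_eq_zero_of_infinite (α := Γ)] at h1
    exact (Nat.mul_ne_zero Nat.card_pos.ne' Subgroup.FiniteIndex.index_ne_zero) h1
  obtain ⟨x, hx⟩ := hnontriv
  have hxN := hN x hx
  have hxΓ : ¬ IsOfFinOrder (j x) := fun h => hxN ((hjinj.isOfFinOrder_iff).1 h)
  refine ⟨fun H hfg hH => ⟨EffSep.growthLE_farb_lower j hS hH, ?_⟩,
    EffSep.growthLE_subSep hS hxΓ, fun T hT => ⟨?_, fun k hk => ?_⟩⟩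
  · rw [← hjM]
    exact EffSep.growthLE_farb_upper hN hjinj hS H hfg
  · obtain ⟨A, k, hA⟩ := EffSep.exists_subSep_le hN hT
    exact ⟨k, EffSep.growthLE_subSep hT hxN, EffSep.growthLE_pow (EffSep.subSep_zero hT) hA⟩
  · rw [← hjM]
    exact EffSep.growthLE_subSep_upper hjinj hS hT hk
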